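/- **Model.** Let $n=2^{L_{max}+1}$, $x_i=i/n$, and $Y_i=f_0(x_i)+\varepsilon_i$ with $\varepsilon_i$ i.i.d. $N(0,1)$, $1\le i\le n$. Let $\psi_{-1,0}=1_{[0,1]}$ and $\psi_{lk}(x)=2^{l/2}\psi(2^lx-k)$ with $\psi=1_{(0,1/2]}-1_{(1/2,1]}$ be the Haar basis. For $L\le L_{max}$ let $\mathbb T_L$ be the set of dyadic trees $T$ of depth at most $L$: $T_{int}$ consists of $(-1,0)$ and of a set of nodes $(l,k)$, $0\le l<L$, $0\le k<2^l$, containing with a node all its ancestors; $T_{ext}$ is the set of nodes that are not internal but whose parent is (and $T_{ext}=\{(0,0)\}$ for the null tree $T_{int}=\{(-1,0)\}$). Order trees by inclusion of the internal nodes. The prior is $\Pi(T)\propto\prod_{T_{int}}n^{-c}\prod_{T_{ext}}(1-n^{-c})$ on $\mathbb T_L$, and given $T$ the coefficients $(\beta_{lk})_{(l,k)\in T_{int}}$ are i.i.d. $N(0,1)$ and the others are $0$. Let $\Pi(T\mid Y)$ be the posterior. **Signal.** $f_0=\sum_{(l,k)\in\mathcal B}\beta^*_{lk}\psi_{lk}$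 with $\mathcal B\subseteq\{(l,k):-1\le l<L\}$ and $A\log n/\sqrt n<|\beta^*_{lk}|<C$ on $\mathcal B$; $T^*$ is the smallest tree in $\mathbb T_L$ with $\mathcal B\subseteq T^*_{int}$. The signal is *connected* if $T^*_{int}=\mathcal B\cup\{(-1,0)\}$. **Samplers.** Both are Metropolis–Hastings chains on $\mathbb T_L$ with target $\Pi(\cdot\mid Y)$, whose proposal is a GROW move with probability $1/2$ and else a PRUNE move (always GROW at the null tree, always PRUNE at the full tree). *Bayesian CART*: GROW makes a uniformly chosen external node internal (a proposal outside $\mathbb T_L$ is rejected); PRUNE makes external a uniformly chosen pre-terminal node, i.e. an internal node both of whose children are external. *Twiggy Bayesian CART* with parameter $1<D\le e$: GROW chooses a level $l<L$ among those with a non-internal node with probability proportional to $D^{-l}$, then uniformly a non-internal node $(l,k)$ of this level, and makes internal all nodes on the path to $(l,k)$ from the external node above it (or equal to it); PRUNE chooses uniformly an internal node $(l,k)\ne(-1,0)$ whose internal descendants, itself included, form a downward path, and removes this path from $T_{int}$. Let $P$ be the transition matrix, $P_{lazy}=(P+I)/2$, and let $$\tau_\epsilon=\max_{T\in\mathbb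 T_L}\min\{t\in\mathbb N:\ \|P_{lazy}^{t'}(T,\cdot)-\Pi(\cdot\mid Y)\|_{TV}\le\epsilon\ \text{ for all } t'\ge t\}.$$ Put $\delta_1=M=1$ for Bayesian CART and $\delta_1=\frac{2(D-1)}{D^L-1}$, $M=2L$ for Twiggy Bayesian CART. Let $F=(f_0(x_i))_{i\le n}$, let $X_T$ be the matrix with columns $(\psi_{lk}(x_i))_{i\le n}$, $(l,k)\in T_{int}$, and $$V_1(T)=\exp\Big\{\tfrac{1}{2^LC^2n}F'\big(I-\tfrac1nX_TX_T'\big)F\Big\},\quad V_2(T)=\exp\Big\{\tfrac1{2^L}\big(|T_{int}\setminus T^*_{int}|+(|T^*_{int}\setminus T_{int}|\wedge1)(2^L-|T_{int}\cup T^*_{int}|)\big)\Big\}.$$ **Theorem.** (1) There is an absolute constant $K>0$ such that for every $c>3$ there is $A_0=A_0(c)>0$ such that the following holds for all $A\ge A_0$, $C>0$ and either of the two samplers (with $1<D\le e$ for the Twiggy one). There is $L_0$, depending on $c$, $A$, $C$ and the sampler, such that for all $L_0\le L\le L_{max}$ and every signal as above, which has to be connected in the case of Bayesian CART, we have with probability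 at least $1-4/n$ simultaneously: (i) for every $T\in\mathbb T_L$ with $T\not\supseteq T^*$, $$\frac{(PV_1)(T)}{V_1(T)}\le1-\frac{\delta_1A^2\log^2n}{2^{2L+2}C^2n}+\frac{e-1}{2\,n^{(A^2/8)\log n-1}};$$ (ii) for every $T\in\mathbb T_L$ with $T\supsetneq T^*$, $$\frac{(PV_2)(T)}{V_2(T)}\le1-\frac1{2^{2L+2}}+\frac M{n^{c-3/2}}+n^{1-(A^2\log n)/8};$$ (iii) if $c\ge4$, then for all $\epsilon\in(0,1)$ $$\tau_\epsilon\le K\,\log(6/\epsilon)\,\max\Big(\frac{C^2}{\delta_1A^2}\,\frac{2^{2L}n}{\log^2n},\ 2^{2L+1}\Big).$$ (2) The rate in (iii) improves on the canonical-path bound $$\kappa\,2^{2L+3}\Big\{n\big[(c+\tfrac12)\log(1+n)+|T^*_{int}|C^2+1\big]+4|T^*_{int}|\log n+\log(2/\epsilon)\Big\},$$ where $\kappa=1$ for Bayesian CART and $\kappa=\frac{D^L-1}{D-1}$ for Twiggy Bayesian CART, by at least a logarithmic factor: for fixed $c\ge4$, $A$, $C>0$, sampler and $\epsilon\in(0,1)$,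 there is $K'>0$ such that for all $1\le L\le L_{max}$ and every value of $|T^*_{int}|$, $\log(6/\epsilon)\max\big(\frac{C^2}{\delta_1A^2}\frac{2^{2L}n}{\log^2n},2^{2L+1}\big)$ is at most $\frac{K'}{\log n}$ times this bound. -/

import Mathlib

open MeasureTheory ProbabilityTheory
open scoped ENNReal Matrix

namespace BCART

/-! ### Dyadic trees -/

/-- A node `(l, k)` of the dyadic tree, `l` the level and `k < 2 ^ l` the position in the level. -/
abbrev Node := ℕ × ℕ

/-- A wavelet index: `none` stands for `(-1, 0)`, `some (l, k)` for `(l, k)` with `0 ≤ l`. -/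
abbrev Index := Option Node

/-- All nodes of level less than `L` (without `(-1, 0)`). -/
def fullNodes (L : ℕ) : Finset Node :=
  (Finset.range L ×ˢ Finset.range (2 ^ L)).filter fun v => v.2 < 2 ^ v.1

/-- All indices of level less than `L`, including `(-1, 0)`. -/
def fullIndices (L : ℕ) : Finset Index := Finset.insertNone (fullNodes L)

/-- `u` is an ancestor of `v`, or `u = v`. -/
def IsAnc (u v : Node) : Prop := u.1 ≤ v.1 ∧ u.2 = v.2 / 2 ^ (v.1 - u.1)

instance (u v : Node) : Decidable (IsAnc u v) := inferInstanceAs (Decidable (_ ∧ _))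

/-- The twig `[u ↔ v]`: the nodes on the path from `u` down to its descendant `v`. -/
def twig (u v : Node) : Finset Node :=
  (Finset.Icc u.1 v.1).image fun j => (j, v.2 / 2 ^ (v.1 - j))

/-- The possible sets of internal nodes, without `(-1, 0)`, of trees of depth at most `L`: the sets
of nodes of level less than `L` that contain with a node all its ancestors. -/
def treeSets (L : ℕ) : Finset (Finset Node) :=
  (fullNodes L).powerset.filter fun S =>
    ∀ v ∈ S, ∀ j < v.1, (j, v.2 / 2 ^ (v.1 - j)) ∈ S

/-- The set of trees of depth at most `L`. A tree is determined by its internal nodes, and `(-1, 0)`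
is an internal node of every tree; so a tree `T` is given by `T.1`, the set of its internal
nodes other than `(-1, 0)`. -/
abbrev CartTree (L : ℕ) := {S : Finset Node // S ∈ treeSets L}

variable {L : ℕ}

/-- The internal nodes, including `(-1, 0)`. -/
def CartTree.int (T : CartTree L) : Finset Index := Finset.insertNone T.1

/-- The external nodes: those that are not internal but whose parent is. The root `(0, 0)` is
external in the null tree. External nodes may have level `L`. -/
def CartTree.ext (T : CartTree L) : Finset Node :=
  (fullNodes (L + 1)).filter fun v => v ∉ T.1 ∧ (v.1 = 0 ∨ (v.1 - 1, v.2 / 2) ∈ T.1)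

/-- The pre-terminal nodes: the internal nodes both of whose children are external. -/
def CartTree.preterminal (T : CartTree L) : Finset Node :=
  T.1.filter fun v => (v.1 + 1, 2 * v.2) ∈ T.ext ∧ (v.1 + 1, 2 * v.2 + 1) ∈ T.ext

/-- The descendants of `v` (including `v`) among the internal nodes. -/
def CartTree.desc (T : CartTree L) (v : Node) : Finset Node := T.1.filter fun w => IsAnc v w

/-! ### The proposal distributions -/

/-- The probability of a GROW move: 1 at the null tree, 0 at the full tree, else 1/2. -/
noncomputable def growProb (T : CartTree L) : ℝ :=
  if T.1 = ∅ then 1 else if T.1 = fullNodes L then 0 else 1 / 2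

/-- GROW of Bayesian CART: a uniformly chosen external node becomes internal. A node of level `L`
that is chosen leads out of the state space; such a proposal is rejected. -/
noncomputable def cartGrow (T T' : CartTree L) : ℝ :=
  ∑ v ∈ T.ext, if T'.1 = insert v T.1 then 1 / (T.ext.card : ℝ) else 0

/-- PRUNE of Bayesian CART: a uniformly chosen pre-terminal node becomes external. -/
noncomputable def cartPrune (T T' : CartTree L) : ℝ :=
  ∑ v ∈ T.preterminal, if T'.1 = T.1.erase v then 1 / (T.preterminal.card : ℝ) else 0

/-- The positions of level `l` that are not occupied by internal nodes. -/
def CartTree.free (T : CartTree L) (l : ℕ) : Finset ℕ :=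
  (Finset.range (2 ^ l)).filter fun k => (l, k) ∉ T.1

/-- The levels that have a node that is not internal. -/
def CartTree.eligible (T : CartTree L) : Finset ℕ :=
  (Finset.range L).filter fun l => (T.free l).Nonempty

/-- Twiggy GROW: choose an eligible level `l` with probability proportional to `D ^ (-l)`, then
uniformly a node `(l, k)` of that level that is not internal, and attach the twig to `(l, k)` from
the closest external node, that is, from the external node above `(l, k)`. -/
noncomputable def twiggyGrow (D : ℝ) (T T' : CartTree L) : ℝ :=
  ∑ l ∈ T.eligible, ∑ k ∈ T.free l,
    if ∃ e ∈ T.ext, IsAnc e (l, k) ∧ T'.1 = T.1 ∪ twig e (l, k) then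
      ((D ^ l)⁻¹ / ∑ l' ∈ T.eligible, (D ^ l')⁻¹) / ((T.free l).card : ℝ)
    else 0

/-- The internal nodes whose entire branch below them is a twig. -/
def CartTree.twigTops (T : CartTree L) : Finset Node :=
  T.1.filter fun v => ∃ w ∈ T.1, IsAnc v w ∧ T.desc v = twig v w

/-- Twiggy PRUNE: remove the branch below a node chosen uniformly among those whose branch is a
twig. -/
noncomputable def twiggyPrune (T T' : CartTree L) : ℝ :=
  ∑ v ∈ T.twigTops, if T'.1 = T.1 \ T.desc v then 1 / (T.twigTops.card : ℝ) else 0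

/-- The two (non-informed) samplers; `D` is the depth penalty of the Twiggy proposal. -/
inductive Sampler
  | bayesianCART
  | twiggy (D : ℝ)

/-- The range of the parameter of the sampler: `1 < D ≤ e`. -/
def Sampler.Valid : Sampler → Prop
  | .bayesianCART => True
  | .twiggy D => 1 < D ∧ D ≤ Real.exp 1

/-- The proposal probability `S(T → T')`. -/
noncomputable def Sampler.proposal : Sampler → CartTree L → CartTree L → ℝ
  | .bayesianCART, T, T' => growProb T * cartGrow T T' + (1 - growProb T) * cartPrune T T'
  | .twiggy D, T, T' => growProb T * twiggyGrow D T T' + (1 - growProb T) * twiggyPrune T T'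

/-- The constant `δ₁`. -/
noncomputable def Sampler.delta : Sampler → ℕ → ℝ
  | .bayesianCART, _ => 1
  | .twiggy D, L => 2 * (D - 1) / (D ^ L - 1)

/-- The constant `M`. -/
def Sampler.bigM : Sampler → ℕ → ℝ
  | .bayesianCART, _ => 1
  | .twiggy _, L => 2 * L

/-! ### Markov chains on a finite state space -/

section Chains

variable {α : Type*} [Fintype α] [DecidableEq α]

/-- The Metropolis-Hastings transition matrix for the proposal `S` and the target `π`. -/
noncomputable def metropolisHastings (S : α → α → ℝ) (π : α → ℝ) : Matrix α α ℝ :=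
  let move : α → α → ℝ := fun x y => S x y * min 1 (π y * S y x / (π x * S x y))
  fun x y => if y = x then 1 - ∑ z ∈ Finset.univ.erase x, move x z else move x y

/-- The lazy version of a transition matrix. -/
noncomputable def lazyChain (P : Matrix α α ℝ) : Matrix α α ℝ :=
  (1 / 2 : ℝ) • P + (1 / 2 : ℝ) • (1 : Matrix α α ℝ)

/-- The total variation distance between `P ^ t (x, ·)` and `π`. -/
noncomputable def tvDist (P : Matrix α α ℝ) (π : α → ℝ) (x : α) (t : ℕ) : ℝ :=
  ⨆ S : Finset α, |∑ y ∈ S, (P ^ t) x y - ∑ y ∈ S, π y|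

/-- The `ε`-mixing time; it is `⊤` if from some state the distance does not stay below `ε`
eventually. -/
noncomputable def mixingTime (P : Matrix α α ℝ) (π : α → ℝ) (ε : ℝ) : ℕ∞ :=
  ⨆ x : α, ⨅ t ∈ {t : ℕ | ∀ t' ≥ t, tvDist P π x t' ≤ ε}, (t : ℕ∞)

end Chains

/-! ### The regression model and the posterior -/

/-- The Haar mother wavelet `1_{(0,1/2]} - 1_{(1/2,1]}`. -/
noncomputable def haarMother (x : ℝ) : ℝ :=
  Set.indicator (Set.Ioc 0 (1 / 2)) 1 x - Set.indicator (Set.Ioc (1 / 2) 1) 1 x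

/-- The Haar basis. -/
noncomputable def haar : Index → ℝ → ℝ
  | none, x => Set.indicator (Set.Icc 0 1) 1 x
  | some (l, k), x => (2 : ℝ) ^ ((l : ℝ) / 2) * haarMother (2 ^ l * x - k)

/-- The sample size `n = 2 ^ (Lmax + 1)`. -/
def sampleSize (Lmax : ℕ) : ℕ := 2 ^ (Lmax + 1)

/-- The design points `1/n, 2/n, …, 1`. -/
noncomputable def designPoint (n : ℕ) (i : Fin n) : ℝ := ((i : ℕ) + 1 : ℝ) / n

/-- The columns of the design matrix that are active in the tree `T`. -/
noncomputable def design (n : ℕ) (T : CartTree L) : Matrix (Fin n) T.int ℝ :=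
  fun i v => haar v.1 (designPoint n i)

/-- The regression function with coefficients `β` on the set `B`. -/
noncomputable def regFun (B : Finset Index) (β : Index → ℝ) (x : ℝ) : ℝ :=
  ∑ v ∈ B, haar v x * β v

/-- The vector of the values of the regression function at the design points. -/
noncomputable def signalVec (n : ℕ) (B : Finset Index) (β : Index → ℝ) : Fin n → ℝ :=
  fun i => regFun B β (designPoint n i)

/-- The law `N(0, Iₙ)` of the noise. -/
noncomputable def noiseLaw (n : ℕ) : Measure (Fin n → ℝ) := Measure.pi fun _ => gaussianReal 0 1

/-- The tree prior, up to normalization, for the split probability `n ^ (-c)`. -/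
noncomputable def treePrior (n : ℕ) (c : ℝ) (T : CartTree L) : ℝ :=
  (∏ _v ∈ T.int, (n : ℝ) ^ (-c)) * ∏ _v ∈ T.ext, (1 - (n : ℝ) ^ (-c))

/-- The marginal likelihood of the data `Y` given the tree: the density of `N(X_T b, Iₙ)` at `Y`,
integrated over the standard Gaussian prior of the coefficients `b` inside the tree. -/
noncomputable def marginalLikelihood (n : ℕ) (Y : Fin n → ℝ) (T : CartTree L) : ℝ :=
  ∫ b : T.int → ℝ, ∏ i, gaussianPDFReal ((design n T *ᵥ b) i) 1 (Y i)
    ∂(Measure.pi fun _ => gaussianReal 0 1)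

/-- The posterior probability of the tree `T`. -/
noncomputable def posterior (n : ℕ) (c : ℝ) (Y : Fin n → ℝ) (T : CartTree L) : ℝ :=
  treePrior n c T * marginalLikelihood n Y T /
    ∑ T' : CartTree L, treePrior n c T' * marginalLikelihood n Y T'

/-- The transition matrix of the sampler. -/
noncomputable def transition (s : Sampler) (n : ℕ) (c : ℝ) (Y : Fin n → ℝ) :
    Matrix (CartTree L) (CartTree L) ℝ :=
  metropolisHastings s.proposal (posterior n c Y)

/-- The signal assumption: `B` is a set of indices of level less than `L`, and the coefficients on
`B` lie between `A log n / √n` and `C` in absolute value. -/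
def SignalAssumption (n L : ℕ) (A C : ℝ) (B : Finset Index) (β : Index → ℝ) : Prop :=
  B ⊆ fullIndices L ∧ ∀ v ∈ B, A * Real.log n / √n < |β v| ∧ |β v| < C

/-! ### Drift functions and rates -/

/-- The first drift function; `F` is the vector of values of the true regression function. -/
noncomputable def drift₁ (n : ℕ) (C : ℝ) (F : Fin n → ℝ) (T : CartTree L) : ℝ :=
  Real.exp (1 / (2 ^ L * C ^ 2 * n) *
    (F ⬝ᵥ ((1 - (1 / (n : ℝ)) • (design n T * (design n T)ᵀ)) *ᵥ F)))

/-- The second drift function; `Ts` is the smallest tree that contains the signal. -/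
noncomputable def drift₂ (Ts T : CartTree L) : ℝ :=
  Real.exp (1 / 2 ^ L * (((T.int \ Ts.int).card : ℝ) +
    (min (Ts.int \ T.int).card 1 : ℕ) * (2 ^ L - ((T.int ∪ Ts.int).card : ℝ))))

/-- The mixing rate `log(6/ε) · max(C² / (δ₁ A²) · 2^{2L} n / log² n, 2^{2L+1})`. -/
noncomputable def twoDriftRate (s : Sampler) (n L : ℕ) (A C ε : ℝ) : ℝ :=
  Real.log (6 / ε) * max (C ^ 2 / (s.delta L * A ^ 2) * (2 ^ (2 * L) * n / Real.log n ^ 2))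
    (2 ^ (2 * L + 1))

/-- The upper bounds on the mixing times given by canonical paths; `m` is the number of internal
nodes of the smallest tree that contains the signal. -/
noncomputable def canonicalPathRate (s : Sampler) (n L m : ℕ) (c C ε : ℝ) : ℝ :=
  (match s with
    | .bayesianCART => 1
    | .twiggy D => (D ^ L - 1) / (D - 1)) *
  2 ^ (2 * L + 3) * (n * ((c + 1 / 2) * Real.log (1 + n) + m * C ^ 2 + 1)
    + 4 * m * Real.log n + Real.log (2 / ε))

end BCART

/-!
The columns of the full Haar design are orthogonal, so the posterior mass of a tree is a constant
times a product of one weight per internal node. With probability at least `1 - 4 / n` the inner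
products of the noise with all columns are `O(√(n log n))`. Then every node off the signal has
weight at most `n ^ (-(c - 3/2))`, so the chain hardly ever accepts a growth outside the signal
and always accepts the removal of such nodes. A path of nodes that meets the signal has weight at
least `n ^ ((A² / 8) log n)`, so the chain always accepts its growth and hardly ever its removal.

The first drift function is the exponential of the signal energy that the tree misses. It
decreases when the path to a missing signal node is grown, which is proposed with probability at
least `δ₁ / 2 ^ (L + 1)`; the second one decreases when a superfluous node is removed from a tree
above `T*`. The second function on the trees above `T*` and a multiple of the first one on the
others give a single function that decreases in the mean everywhere except at `T*`. So the chain
reaches `T*` quickly, and by reversibility it is then at `T*` with probability bounded below,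
since `T*` carries most of the posterior mass. Doeblin's argument bounds the mixing time.
-/

namespace BCART

variable {L : ℕ}

/-! ### Reversible Markov chains on a finite state space -/

section Chains

/-- Reversibility of the transition matrix `P` with respect to `π`. -/
def DetailedBalance {α : Type*} (π : α → ℝ) (P : Matrix α α ℝ) : Prop :=
  ∀ x y, π x * P x y = π y * P y x

variable {α : Type*} [DecidableEq α] {P : Matrix α α ℝ} {π : α → ℝ}

lemma DetailedBalance.lazyChain (h : DetailedBalance π P) :
    DetailedBalance π (lazyChain P) := by
  intro x y
  rcases eq_or_ne x y with rfl | hxy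
  · rfl
  · simp only [BCART.lazyChain, Matrix.add_apply, Matrix.smul_apply, smul_eq_mul,
      Matrix.one_apply_ne hxy, Matrix.one_apply_ne hxy.symm]
    linear_combination h x y / 2

variable [Fintype α]

lemma DetailedBalance.pow (h : DetailedBalance π P) (t : ℕ) : DetailedBalance π (P ^ t) := by
  induction t with
  | zero =>
    intro x y
    rcases eq_or_ne x y with rfl | hxy
    · rfl
    · simp [Matrix.one_apply_ne hxy, Matrix.one_apply_ne hxy.symm]
  | succ t ih =>
    intro x y
    rw [pow_succ, Matrix.mul_apply, ← pow_succ, pow_succ', Matrix.mul_apply, Finset.mul_sum,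
      Finset.mul_sum]
    refine Finset.sum_congr rfl fun z _ => ?_
    linear_combination P z y * ih x z + (P ^ t) z x * h z y

lemma DetailedBalance.vecMul_eq (h : DetailedBalance π P) (hP : P ∈ Matrix.rowStochastic ℝ α) :
    π ᵥ* P = π := by
  ext y
  calc ∑ x, π x * P x y = ∑ x, π y * P y x := Finset.sum_congr rfl fun x _ => h x y
    _ = π y := by rw [← Finset.mul_sum, Matrix.sum_row_of_mem_rowStochastic hP, mul_one]

section MetropolisHastings

variable {S : α → α → ℝ}

lemma metropolisHastings_of_ne (hS : ∀ x y, 0 ≤ S x y) (hπ : ∀ x, 0 < π x) {x y : α}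
    (h : y ≠ x) : metropolisHastings S π x y = min (S x y) (π y / π x * S y x) := by
  have hx := hπ x
  have hy := hπ y
  simp only [metropolisHastings, if_neg h]
  rcases (hS x y).eq_or_lt with h0 | h0
  · have := hS y x
    rw [← h0, zero_mul, min_eq_left (by positivity)]
  · rw [mul_min_of_nonneg _ _ h0.le, mul_one]
    congr 1
    field_simp

lemma metropolisHastings_nonneg_of_ne (hS : ∀ x y, 0 ≤ S x y) (hπ : ∀ x, 0 < π x) {x y : α}
    (h : y ≠ x) : 0 ≤ metropolisHastings S π x y := by
  rw [metropolisHastings_of_ne hS hπ h]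
  exact le_min (hS x y) (mul_nonneg (div_pos (hπ y) (hπ x)).le (hS y x))

lemma metropolisHastings_le_of_ne (hS : ∀ x y, 0 ≤ S x y) (hπ : ∀ x, 0 < π x) {x y : α}
    (h : y ≠ x) : metropolisHastings S π x y ≤ S x y := by
  rw [metropolisHastings_of_ne hS hπ h]
  exact min_le_left _ _

lemma sum_metropolisHastings (S : α → α → ℝ) (π : α → ℝ) (x : α) :
    ∑ y, metropolisHastings S π x y = 1 := by
  have hoff : ∑ y ∈ Finset.univ.erase x, metropolisHastings S π x y =
      ∑ y ∈ Finset.univ.erase x, S x y * min 1 (π y * S y x / (π x * S x y)) :=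
    Finset.sum_congr rfl fun y hy => if_neg (Finset.ne_of_mem_erase hy)
  rw [← Finset.add_sum_erase _ _ (Finset.mem_univ x), hoff]
  simp [metropolisHastings]

lemma metropolisHastings_mem_rowStochastic (hS : ∀ x y, 0 ≤ S x y) (hS' : ∀ x, ∑ y, S x y ≤ 1)
    (hπ : ∀ x, 0 < π x) : metropolisHastings S π ∈ Matrix.rowStochastic ℝ α := by
  refine Matrix.mem_rowStochastic_iff_sum.2 ⟨fun x y => ?_, sum_metropolisHastings S π⟩
  rcases eq_or_ne y x with rfl | h
  · have htotal := sum_metropolisHastings S π y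
    rw [← Finset.add_sum_erase _ _ (Finset.mem_univ y)] at htotal
    have hoff : ∑ z ∈ Finset.univ.erase y, metropolisHastings S π y z ≤ ∑ z, S y z :=
      (Finset.sum_le_sum fun z hz =>
        metropolisHastings_le_of_ne hS hπ (Finset.ne_of_mem_erase hz)).trans
          (Finset.sum_le_sum_of_subset_of_nonneg (Finset.erase_subset _ _) fun z _ _ => hS y z)
    linarith [hS' y]
  · exact metropolisHastings_nonneg_of_ne hS hπ h

lemma detailedBalance_metropolisHastings (hS : ∀ x y, 0 ≤ S x y) (hπ : ∀ x, 0 < π x) :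
    DetailedBalance π (metropolisHastings S π) := by
  intro x y
  rcases eq_or_ne y x with rfl | h
  · rfl
  · have hx := (hπ x).ne'
    have hy := (hπ y).ne'
    rw [metropolisHastings_of_ne hS hπ h, metropolisHastings_of_ne hS hπ h.symm,
      mul_min_of_nonneg _ _ (hπ x).le, mul_min_of_nonneg _ _ (hπ y).le, min_comm]
    congr 1 <;> field_simp

end MetropolisHastings

lemma lazyChain_mem_rowStochastic (hP : P ∈ Matrix.rowStochastic ℝ α) :
    lazyChain P ∈ Matrix.rowStochastic ℝ α :=
  Matrix.convex_rowStochastic hP (one_mem _) (by norm_num) (by norm_num) (by norm_num)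

lemma half_le_lazyChain (hP : P ∈ Matrix.rowStochastic ℝ α) (x : α) :
    1 / 2 ≤ lazyChain P x x := by
  have : 0 ≤ P x x := Matrix.nonneg_of_mem_rowStochastic hP
  simp only [lazyChain, Matrix.add_apply, Matrix.smul_apply, smul_eq_mul, Matrix.one_apply_eq]
  linarith

lemma lazyChain_mulVec (P : Matrix α α ℝ) (V : α → ℝ) (x : α) :
    (lazyChain P *ᵥ V) x = (1 / 2) * (P *ᵥ V) x + (1 / 2) * V x := by
  simp [lazyChain, Matrix.add_mulVec, Matrix.smul_mulVec]

lemma DetailedBalance.stationary_le_return_even (h : DetailedBalance π P)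
    (hP : P ∈ Matrix.rowStochastic ℝ α) (hπ : ∀ x, 0 < π x) (hsum : ∑ x, π x = 1) (t : ℕ)
    (x : α) : π x ≤ (P ^ (2 * t)) x x := by
  have hcauchy : 1 ≤ ∑ y, (P ^ t) x y ^ 2 / π y := by
    simpa [hsum, Matrix.sum_row_of_mem_rowStochastic (pow_mem hP t)] using
      Finset.sq_sum_div_le_sum_sq_div Finset.univ (fun y => (P ^ t) x y) fun y _ => hπ y
  have hreturn : (P ^ (2 * t)) x x = π x * ∑ y, (P ^ t) x y ^ 2 / π y := by
    rw [two_mul, pow_add, Matrix.mul_apply, Finset.mul_sum]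
    refine Finset.sum_congr rfl fun y _ => ?_
    have := (hπ y).ne'
    field_simp
    linear_combination -(P ^ t) x y * h.pow t x y
  rw [hreturn]
  exact le_mul_of_one_le_right (hπ x).le hcauchy

lemma DetailedBalance.half_stationary_le_return (h : DetailedBalance π P)
    (hP : P ∈ Matrix.rowStochastic ℝ α) (hπ : ∀ x, 0 < π x) (hsum : ∑ x, π x = 1) (t : ℕ)
    (x : α) : π x / 2 ≤ (BCART.lazyChain P ^ t) x x := by
  have hQ := lazyChain_mem_rowStochastic hP
  have heven := fun k => h.lazyChain.stationary_le_return_even hQ hπ hsum k x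
  have hx := hπ x
  rcases Nat.even_or_odd' t with ⟨k, rfl | rfl⟩
  · linarith [heven k]
  · have hstay : (BCART.lazyChain P ^ (2 * k)) x x * BCART.lazyChain P x x ≤
        (BCART.lazyChain P ^ (2 * k + 1)) x x := by
      rw [pow_succ, Matrix.mul_apply]
      exact Finset.single_le_sum
        (f := fun z => (BCART.lazyChain P ^ (2 * k)) x z * BCART.lazyChain P z x)
        (fun z _ => mul_nonneg (Matrix.nonneg_of_mem_rowStochastic (pow_mem hQ _))
          (Matrix.nonneg_of_mem_rowStochastic hQ)) (Finset.mem_univ x)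
    nlinarith [heven k, half_le_lazyChain hP x]

lemma le_pow_apply_of_drift (hP : P ∈ Matrix.rowStochastic ℝ α) {z : α} {m γ : ℝ} (hm : 0 ≤ m)
    (hγ : γ ≤ 1) (hret : ∀ t, m ≤ (P ^ t) z z) {W : α → ℝ} (hz : W z = 0)
    (hW : ∀ x, x ≠ z → 1 ≤ W x) (hdrift : ∀ x, x ≠ z → (P *ᵥ W) x ≤ (1 - γ) * W x)
    (t : ℕ) (x : α) : m * (1 - (1 - γ) ^ t * W x) ≤ (P ^ t) x z := by
  induction t generalizing x with
  | zero =>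
    rcases eq_or_ne x z with rfl | hx
    · simpa [hz] using hret 0
    · simpa [Matrix.one_apply_ne hx] using
        mul_nonpos_of_nonneg_of_nonpos hm (sub_nonpos.2 (hW x hx))
  | succ t ih =>
    rcases eq_or_ne x z with rfl | hx
    · simpa [hz] using hret (t + 1)
    have hdrift' : (1 - γ) ^ t * (P *ᵥ W) x ≤ (1 - γ) ^ (t + 1) * W x := by
      rw [pow_succ, mul_assoc]
      exact mul_le_mul_of_nonneg_left (hdrift x hx) (pow_nonneg (by linarith) _)
    calc m * (1 - (1 - γ) ^ (t + 1) * W x) ≤ m * (1 - (1 - γ) ^ t * (P *ᵥ W) x) := by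
          gcongr
      _ = m * (∑ y, P x y - (1 - γ) ^ t * ∑ y, P x y * W y) := by
          rw [Matrix.sum_row_of_mem_rowStochastic hP]
          rfl
      _ = ∑ y, P x y * (m * (1 - (1 - γ) ^ t * W y)) := by
          rw [Finset.mul_sum, ← Finset.sum_sub_distrib, Finset.mul_sum]
          exact Finset.sum_congr rfl fun y _ => by ring
      _ ≤ ∑ y, P x y * (P ^ t) y z := Finset.sum_le_sum fun y _ =>
          mul_le_mul_of_nonneg_left (ih y) (Matrix.nonneg_of_mem_rowStochastic hP)
      _ = (P ^ (t + 1)) x z := by rw [pow_succ', Matrix.mul_apply]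

lemma dotProduct_mem_Icc {ι : Type*} [Fintype ι] {w f : ι → ℝ} (hw : ∀ x, 0 ≤ w x) {a b : ℝ}
    (hf : ∀ x, f x ∈ Set.Icc a b) : w ⬝ᵥ f ∈ Set.Icc ((∑ x, w x) * a) ((∑ x, w x) * b) := by
  rw [Finset.sum_mul, Finset.sum_mul]
  exact ⟨Finset.sum_le_sum fun x _ => mul_le_mul_of_nonneg_left (hf x).1 (hw x),
    Finset.sum_le_sum fun x _ => mul_le_mul_of_nonneg_left (hf x).2 (hw x)⟩

lemma mulVec_mem_Icc (hP : P ∈ Matrix.rowStochastic ℝ α) {f : α → ℝ} {a b : ℝ}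
    (hf : ∀ x, f x ∈ Set.Icc a b) (x : α) : (P *ᵥ f) x ∈ Set.Icc a b := by
  simpa [Matrix.mulVec, Matrix.sum_row_of_mem_rowStochastic hP] using
    dotProduct_mem_Icc (w := P x) (fun _ => Matrix.nonneg_of_mem_rowStochastic hP) hf

/-- Each row of `P` is `θ` times the point mass at `z` plus a nonnegative vector of mass `1 - θ`. -/
lemma exists_mulVec_mem_Icc_of_doeblin (hP : P ∈ Matrix.rowStochastic ℝ α) {z : α} {θ : ℝ}
    (hθ : ∀ x, θ ≤ P x z) {f : α → ℝ} {a r : ℝ} (hf : ∀ x, f x ∈ Set.Icc a (a + r)) :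
    ∃ a', ∀ x, (P *ᵥ f) x ∈ Set.Icc a' (a' + (1 - θ) * r) := by
  refine ⟨θ * f z + (1 - θ) * a, fun x => ?_⟩
  let w : α → ℝ := P x - Pi.single z θ
  have hw : ∀ y, 0 ≤ w y := by
    intro y
    rcases eq_or_ne y z with rfl | hy
    · simpa [w] using hθ x
    · simpa [w, hy] using Matrix.nonneg_of_mem_rowStochastic hP
  have hmass : ∑ y, w y = 1 - θ := by
    simp [w, Finset.sum_sub_distrib, Matrix.sum_row_of_mem_rowStochastic hP]
  have h := dotProduct_mem_Icc hw hf
  rw [hmass, sub_dotProduct, single_dotProduct, Set.mem_Icc] at h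
  change P x ⬝ᵥ f ∈ _
  constructor <;> linarith [h.1, h.2]

lemma exists_pow_mulVec_mem_Icc_of_doeblin (hP : P ∈ Matrix.rowStochastic ℝ α) {z : α} {θ : ℝ}
    (hθ : ∀ x, θ ≤ P x z) {f : α → ℝ} {a r : ℝ} (hf : ∀ x, f x ∈ Set.Icc a (a + r)) (k : ℕ) :
    ∃ a', ∀ x, (P ^ k *ᵥ f) x ∈ Set.Icc a' (a' + (1 - θ) ^ k * r) := by
  induction k with
  | zero => exact ⟨a, by simpa using hf⟩
  | succ k ih =>
    obtain ⟨a', ha'⟩ := ih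
    simpa only [pow_succ', ← Matrix.mulVec_mulVec, mul_assoc] using
      exists_mulVec_mem_Icc_of_doeblin hP hθ ha'

lemma vecMul_pow_eq (hstat : π ᵥ* P = π) (t : ℕ) : π ᵥ* P ^ t = π := by
  induction t with
  | zero => simp
  | succ t ih => rw [pow_succ, ← Matrix.vecMul_vecMul, ih, hstat]

lemma tvDist_le_of_doeblin (hP : P ∈ Matrix.rowStochastic ℝ α) (hπ : ∀ x, 0 ≤ π x)
    (hsum : ∑ x, π x = 1) (hstat : π ᵥ* P = π) {z : α} {θ : ℝ} {t₀ : ℕ}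
    (hθ : ∀ x, θ ≤ (P ^ t₀) x z) {k t : ℕ} (ht : t₀ * k ≤ t) (x : α) :
    tvDist P π x t ≤ (1 - θ) ^ k := by
  refine ciSup_le fun S => ?_
  let f : α → ℝ := Set.indicator S 1
  have hdot : ∀ w : α → ℝ, w ⬝ᵥ f = ∑ y ∈ S, w y := fun w => by
    simp [f, dotProduct, Set.indicator_apply]
  have hf : ∀ y, f y ∈ Set.Icc (0 : ℝ) (0 + 1) := fun y => by
    by_cases hy : y ∈ S <;> simp [f, hy]
  obtain ⟨a, ha⟩ := exists_pow_mulVec_mem_Icc_of_doeblin (pow_mem hP t₀) hθ hf k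
  rw [mul_one] at ha
  have hosc : ∀ y, (P ^ t *ᵥ f) y ∈ Set.Icc a (a + (1 - θ) ^ k) := by
    rw [← Nat.sub_add_cancel ht, pow_add, pow_mul, ← Matrix.mulVec_mulVec]
    exact mulVec_mem_Icc (pow_mem hP _) ha
  have hmean : ∑ y ∈ S, π y ∈ Set.Icc a (a + (1 - θ) ^ k) := by
    rw [← hdot, ← vecMul_pow_eq hstat t, ← Matrix.dotProduct_mulVec]
    simpa [hsum] using dotProduct_mem_Icc hπ hosc
  have hx : ∑ y ∈ S, (P ^ t) x y ∈ Set.Icc a (a + (1 - θ) ^ k) := hdot _ ▸ hosc x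
  rw [abs_le]
  constructor <;> linarith [hmean.1, hmean.2, hx.1, hx.2]

lemma one_sub_pow_le_exp_neg {x : ℝ} (hx : x ≤ 1) (k : ℕ) :
    (1 - x) ^ k ≤ Real.exp (-(k * x)) := by
  rw [← mul_neg, Real.exp_nat_mul]
  exact pow_le_pow_left₀ (sub_nonneg.2 hx) (Real.one_sub_le_exp_neg x) k

lemma mixingTime_le_of_forall_tvDist_le {ε : ℝ} {t : ℕ}
    (h : ∀ x, ∀ t' ≥ t, tvDist P π x t' ≤ ε) : mixingTime P π ε ≤ t :=
  iSup_le fun x => iInf₂_le t (h x)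

/-- The drift carries the chain into `z` from everywhere, and reversibility keeps the chance of
being at `z` above `π z / 2` from then on. -/
lemma quarter_stationary_le_lazyChain_pow (hP : P ∈ Matrix.rowStochastic ℝ α)
    (hπ : ∀ x, 0 < π x) (hsum : ∑ x, π x = 1) (hrev : DetailedBalance π P) {z : α} {W : α → ℝ}
    (hz : W z = 0) (hW : ∀ x, x ≠ z → 1 ≤ W x) {H : ℝ} (hH : 0 < H) (hWH : ∀ x, W x ≤ H) {γ : ℝ}
    (hγ : 0 < γ) (hγ' : γ ≤ 1) (hdrift : ∀ x, x ≠ z → (P *ᵥ W) x ≤ (1 - γ) * W x) (x : α) :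
    π z / 4 ≤ (lazyChain P ^ ⌈2 * Real.log (2 * H) / γ⌉₊) x z := by
  set t := ⌈2 * Real.log (2 * H) / γ⌉₊
  have hz₀ := hπ z
  have hWx : 0 ≤ W x := by
    rcases eq_or_ne x z with rfl | hx
    · exact hz.ge
    · exact zero_le_one.trans (hW x hx)
  have hhit : (1 - γ / 2) ^ t * W x ≤ 1 / 2 :=
    calc (1 - γ / 2) ^ t * W x ≤ Real.exp (-(t * (γ / 2))) * H :=
          mul_le_mul (one_sub_pow_le_exp_neg (by linarith) t) (hWH x) hWx (Real.exp_pos _).le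
      _ ≤ Real.exp (-Real.log (2 * H)) * H := by
          have ht : 2 * Real.log (2 * H) / γ ≤ t := Nat.le_ceil _
          rw [div_le_iff₀ hγ] at ht
          gcongr
          linarith
      _ = 1 / 2 := by
          rw [Real.exp_neg, Real.exp_log (by positivity)]
          field_simp
  calc π z / 4 ≤ π z / 2 * (1 - (1 - γ / 2) ^ t * W x) := by nlinarith
    _ ≤ (lazyChain P ^ t) x z :=
        le_pow_apply_of_drift (lazyChain_mem_rowStochastic hP) (by positivity) (by linarith)
          (fun t => hrev.half_stationary_le_return hP hπ hsum t z) hz hW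
          (fun y hy => by rw [lazyChain_mulVec]; linarith [hdrift y hy]) t x

theorem mixingTime_lazyChain_le (hP : P ∈ Matrix.rowStochastic ℝ α) (hπ : ∀ x, 0 < π x)
    (hsum : ∑ x, π x = 1) (hrev : DetailedBalance π P) {z : α} {W : α → ℝ} (hz : W z = 0)
    (hW : ∀ x, x ≠ z → 1 ≤ W x) {H : ℝ} (hH : 0 < H) (hWH : ∀ x, W x ≤ H) {γ : ℝ} (hγ : 0 < γ)
    (hγ' : γ ≤ 1) (hdrift : ∀ x, x ≠ z → (P *ᵥ W) x ≤ (1 - γ) * W x) {ε : ℝ} (hε : 0 < ε) :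
    mixingTime (lazyChain P) π ε ≤
      (⌈2 * Real.log (2 * H) / γ⌉₊ * ⌈4 / π z * Real.log (1 / ε)⌉₊ : ℕ) := by
  have hQ := lazyChain_mem_rowStochastic hP
  have hz₁ : π z ≤ 1 := hsum ▸ Finset.single_le_sum (fun x _ => (hπ x).le) (Finset.mem_univ z)
  set k := ⌈4 / π z * Real.log (1 / ε)⌉₊
  refine mixingTime_le_of_forall_tvDist_le fun x t ht => ?_
  calc tvDist (lazyChain P) π x t ≤ (1 - π z / 4) ^ k :=
        tvDist_le_of_doeblin hQ (fun x => (hπ x).le) hsum (hrev.lazyChain.vecMul_eq hQ)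
          (quarter_stationary_le_lazyChain_pow hP hπ hsum hrev hz hW hH hWH hγ hγ' hdrift) ht x
    _ ≤ Real.exp (-(k * (π z / 4))) := one_sub_pow_le_exp_neg (by linarith) k
    _ ≤ Real.exp (Real.log ε) := by
        have hk : 4 / π z * Real.log (1 / ε) ≤ k := Nat.le_ceil _
        rw [one_div, Real.log_inv, div_mul_eq_mul_div, div_le_iff₀ (hπ z)] at hk
        gcongr
        linarith
    _ = ε := Real.exp_log hε

lemma one_le_log_six : 1 ≤ Real.log 6 := by
  rw [Real.le_log_iff_exp_le (by norm_num)]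
  linarith [Real.exp_one_lt_d9]

lemma log_sixteen_le_three : Real.log 16 ≤ 3 := by
  rw [show (16 : ℝ) = 2 ^ 4 by norm_num, Real.log_pow]
  norm_num
  linarith [Real.log_two_lt_d9]

theorem mixingTime_lazyChain_le_of_quarter_le (hP : P ∈ Matrix.rowStochastic ℝ α)
    (hπ : ∀ x, 0 < π x) (hsum : ∑ x, π x = 1) (hrev : DetailedBalance π P) {z : α}
    (hπz : 1 / 4 ≤ π z) {W : α → ℝ} (hz : W z = 0) (hW : ∀ x, x ≠ z → 1 ≤ W x)
    (hW' : ∀ x, W x ≤ 8) {γ : ℝ} (hγ : 0 < γ) (hγ' : γ ≤ 1)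
    (hdrift : ∀ x, x ≠ z → (P *ᵥ W) x ≤ (1 - γ) * W x) {ε : ℝ} (hε : 0 < ε) (hε' : ε < 1) :
    (mixingTime (lazyChain P) π ε : ℝ≥0∞) ≤ ENNReal.ofReal (119 / γ * Real.log (6 / ε)) := by
  have hlog : 0 < Real.log (1 / ε) := Real.log_pos (by rwa [lt_div_iff₀ hε, one_mul])
  have hhit : (⌈2 * Real.log (2 * 8) / γ⌉₊ : ℝ) ≤ 7 / γ :=
    calc (⌈2 * Real.log (2 * 8) / γ⌉₊ : ℝ) ≤ 2 * Real.log (2 * 8) / γ + 1 :=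
          (Nat.ceil_lt_add_one (by positivity)).le
      _ ≤ 6 / γ + 1 / γ := by
          norm_num
          gcongr
          · linarith [log_sixteen_le_three]
          · exact (one_le_inv₀ hγ).2 hγ'
      _ = 7 / γ := by ring
  have hcouple : (⌈4 / π z * Real.log (1 / ε)⌉₊ : ℝ) ≤ 17 * Real.log (6 / ε) :=
    calc (⌈4 / π z * Real.log (1 / ε)⌉₊ : ℝ) ≤ 4 / π z * Real.log (1 / ε) + 1 :=
          (Nat.ceil_lt_add_one (mul_nonneg (div_pos (by norm_num) (hπ z)).le hlog.le)).le
      _ ≤ 16 * Real.log (1 / ε) + 17 * Real.log 6 := by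
          gcongr
          · rw [div_le_iff₀ (hπ z)]
            linarith
          · linarith [one_le_log_six]
      _ ≤ 17 * Real.log (6 / ε) := by
          rw [div_eq_mul_one_div 6, Real.log_mul (by norm_num) (by positivity)]
          linarith
  calc (mixingTime (lazyChain P) π ε : ℝ≥0∞) ≤
        (⌈2 * Real.log (2 * 8) / γ⌉₊ * ⌈4 / π z * Real.log (1 / ε)⌉₊ : ℕ) := by
        exact_mod_cast
          mixingTime_lazyChain_le hP hπ hsum hrev hz hW (by norm_num) hW' hγ hγ' hdrift hε
    _ ≤ ENNReal.ofReal (119 / γ * Real.log (6 / ε)) := by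
        rw [← ENNReal.ofReal_natCast, Nat.cast_mul]
        refine ENNReal.ofReal_le_ofReal ((mul_le_mul hhit hcouple (by positivity)
          (by positivity)).trans_eq (by ring))

lemma mulVec_sub_eq (hP : P ∈ Matrix.rowStochastic ℝ α) (V : α → ℝ) (x : α) :
    (P *ᵥ V) x - V x = ∑ y, P x y * (V y - V x) := by
  simp only [Matrix.mulVec, dotProduct, mul_sub, Finset.sum_sub_distrib, ← Finset.sum_mul,
    Matrix.sum_row_of_mem_rowStochastic hP, one_mul]

lemma mulVec_div_le (hP : P ∈ Matrix.rowStochastic ℝ α) {V u : α → ℝ} {x g : α} (hV : 0 < V x)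
    (hu : ∀ y, 0 ≤ u y) (hVu : ∀ y, P x y ≠ 0 → V y - V x ≤ u y * V x) {p η : ℝ} (hη : 0 ≤ η)
    (hg : V g ≤ (1 - η) * V x) (hp : p ≤ P x g) :
    (P *ᵥ V) x / V x ≤ 1 - p * η + ∑ y, P x y * u y := by
  have h0 : ∀ y, 0 ≤ P x y := fun y => Matrix.nonneg_of_mem_rowStochastic hP
  have hgood : P x g * (V g - V x) ≤ -(p * η) * V x :=
    calc P x g * (V g - V x) ≤ P x g * (-η * V x) :=
          mul_le_mul_of_nonneg_left (by linarith) (h0 g)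
      _ ≤ -(p * η) * V x := by nlinarith [mul_le_mul_of_nonneg_right hp (mul_nonneg hη hV.le)]
  have hrest : ∑ y ∈ Finset.univ.erase g, P x y * (V y - V x) ≤ (∑ y, P x y * u y) * V x := by
    rw [Finset.sum_mul]
    refine (Finset.sum_le_sum fun y _ => ?_).trans (Finset.sum_le_sum_of_subset_of_nonneg
      (Finset.erase_subset g _) fun y _ _ => mul_nonneg (mul_nonneg (h0 y) (hu y)) hV.le)
    by_cases hy : P x y = 0
    · simp [hy]
    · rw [mul_assoc]
      exact mul_le_mul_of_nonneg_left (hVu y hy) (h0 y)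
  have hdrift := mulVec_sub_eq hP V x
  rw [← Finset.add_sum_erase _ _ (Finset.mem_univ g)] at hdrift
  rw [div_le_iff₀ hV]
  linarith

lemma mul_sum_compl_le_of_drift (hP : P ∈ Matrix.rowStochastic ℝ α) (hπ : ∀ x, 0 ≤ π x)
    (hsum : ∑ x, π x = 1) (hrev : DetailedBalance π P) {V : α → ℝ} {S : Finset α} {a r : ℝ}
    (hS : ∀ x ∈ S, (P *ᵥ V) x ≤ V x + r) (hS' : ∀ x ∉ S, (P *ᵥ V) x ≤ V x + r - a) :
    a * ∑ x ∈ Sᶜ, π x ≤ r := by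
  have hstat : ∑ x, π x * (P *ᵥ V) x = ∑ x, π x * V x := by
    have hdot := Matrix.dotProduct_mulVec π P V
    rwa [hrev.vecMul_eq hP] at hdot
  have hpt : ∀ x, π x * (P *ᵥ V) x + (if x ∈ S then 0 else a * π x) ≤ π x * V x + π x * r := by
    intro x
    split_ifs with hx
    · linarith [mul_le_mul_of_nonneg_left (hS x hx) (hπ x)]
    · linarith [mul_le_mul_of_nonneg_left (hS' x hx) (hπ x)]
  have hle := Finset.sum_le_sum fun x (_ : x ∈ Finset.univ) => hpt x
  have hcompl : ∑ x, (if x ∈ S then 0 else a * π x) = a * ∑ x ∈ Sᶜ, π x := by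
    rw [Finset.sum_ite, Finset.sum_const_zero, zero_add, Finset.filter_notMem_eq_sdiff,
      ← Finset.compl_eq_univ_sdiff, Finset.mul_sum]
  rw [Finset.sum_add_distrib, Finset.sum_add_distrib, hstat, hcompl, ← Finset.sum_mul, hsum,
    one_mul] at hle
  linarith

end Chains

/-! ### Combinatorics of dyadic trees -/

lemma mem_fullNodes {v : Node} : v ∈ fullNodes L ↔ v.1 < L ∧ v.2 < 2 ^ v.1 := by
  simp only [fullNodes, Finset.mem_filter, Finset.mem_product, Finset.mem_range]
  exact ⟨fun h => ⟨h.1.1, h.2⟩,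
    fun h => ⟨⟨h.1, h.2.trans (Nat.pow_lt_pow_right (by norm_num) h.1)⟩, h.2⟩⟩

lemma fullNodes_mono {L' : ℕ} (h : L ≤ L') : fullNodes L ⊆ fullNodes L' := fun _ hv =>
  mem_fullNodes.2 ⟨(mem_fullNodes.1 hv).1.trans_le h, (mem_fullNodes.1 hv).2⟩

lemma fullNodes_succ (L : ℕ) :
    fullNodes (L + 1) = fullNodes L ∪ {L} ×ˢ Finset.range (2 ^ L) := by
  ext ⟨l, k⟩
  simp only [mem_fullNodes, Finset.mem_union, Finset.mem_product, Finset.mem_singleton,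
    Finset.mem_range, Nat.lt_succ_iff_lt_or_eq, or_and_right]
  exact or_congr_right (and_congr_right fun h => by rw [h])

lemma card_fullNodes (L : ℕ) : (fullNodes L).card + 1 = 2 ^ L := by
  induction L with
  | zero => simp [fullNodes]
  | succ L ih =>
    have hdisj : Disjoint (fullNodes L) ({L} ×ˢ Finset.range (2 ^ L)) := by
      rw [Finset.disjoint_left]
      intro v hv hv'
      exact (mem_fullNodes.1 hv).1.ne (Finset.mem_singleton.1 (Finset.mem_product.1 hv').1)
    rw [fullNodes_succ, Finset.card_union_of_disjoint hdisj, Finset.card_product,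
      Finset.card_singleton, Finset.card_range, pow_succ]
    omega

lemma eq_root_of_level_eq_zero {v : Node} (hv : v ∈ fullNodes L) (h : v.1 = 0) : v = (0, 0) := by
  have := (mem_fullNodes.1 hv).2
  rw [h] at this
  exact Prod.ext h (by simpa using this)

namespace IsAnc

variable {u v w : Node}

lemma refl (v : Node) : IsAnc v v := by simp [IsAnc]

lemma trans (h : IsAnc u v) (h' : IsAnc v w) : IsAnc u w := by
  refine ⟨h.1.trans h'.1, ?_⟩
  rw [h.2, h'.2, Nat.div_div_eq_div_mul, ← pow_add, Nat.sub_add_sub_cancel h'.1 h.1]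

lemma of_level_le (h : IsAnc u w) (h' : IsAnc v w) (hle : u.1 ≤ v.1) : IsAnc u v := by
  refine ⟨hle, ?_⟩
  rw [h.2, h'.2, Nat.div_div_eq_div_mul, ← pow_add, Nat.sub_add_sub_cancel h'.1 hle]

lemma eq_of_level (h : IsAnc u v) (hl : v.1 ≤ u.1) : u = v :=
  Prod.ext (h.1.antisymm hl) (by simpa [Nat.sub_eq_zero_of_le hl] using h.2)

lemma mem_fullNodes (h : IsAnc u v) (hv : v ∈ fullNodes L) : u ∈ fullNodes L := by
  obtain ⟨hl, hk⟩ := BCART.mem_fullNodes.1 hv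
  refine BCART.mem_fullNodes.2 ⟨h.1.trans_lt hl, ?_⟩
  rwa [h.2, Nat.div_lt_iff_lt_mul (by positivity), ← pow_add, Nat.add_sub_cancel' h.1]

end IsAnc

lemma isAnc_parent {v : Node} (h : v.1 ≠ 0) : IsAnc (v.1 - 1, v.2 / 2) v := by
  refine ⟨Nat.sub_le _ _, ?_⟩
  simp [Nat.sub_sub_self (Nat.one_le_iff_ne_zero.2 h)]

lemma IsAnc.level_ne_zero {u v : Node} (h : IsAnc u v) (hne : u ≠ v) : v.1 ≠ 0 := fun h0 =>
  hne (h.eq_of_level (h0 ▸ Nat.zero_le _))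

lemma IsAnc.to_parent {u v : Node} (h : IsAnc u v) (hne : u ≠ v) :
    IsAnc u (v.1 - 1, v.2 / 2) := by
  refine h.of_level_le (isAnc_parent (h.level_ne_zero hne)) ?_
  have := mt h.eq_of_level hne
  simp only
  omega

/-- The left (`false`) and the right (`true`) child of a node. -/
def child (v : Node) (b : Bool) : Node := (v.1 + 1, Nat.bit b v.2)

lemma parent_child (v : Node) (b : Bool) : ((child v b).1 - 1, (child v b).2 / 2) = v := by
  simp [child]

lemma child_injective2 : Function.Injective2 child := by
  intro u v b b' h
  have hbit : Nat.bit b u.2 = Nat.bit b' v.2 := congrArg Prod.snd h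
  exact ⟨Prod.ext (Nat.succ_injective (congrArg Prod.fst h))
    (by simpa using congrArg Nat.div2 hbit), by simpa using congrArg Nat.bodd hbit⟩

lemma exists_child_eq {v : Node} (h : v.1 ≠ 0) : ∃ b, child (v.1 - 1, v.2 / 2) b = v :=
  ⟨v.2.bodd, Prod.ext (Nat.sub_add_cancel (Nat.one_le_iff_ne_zero.2 h))
    (by simp only [child, ← Nat.div2_val, Nat.bit_bodd_div2])⟩

lemma isAnc_child (v : Node) (b : Bool) : IsAnc v (child v b) := by
  simpa only [parent_child] using isAnc_parent (v := child v b) (Nat.succ_ne_zero _)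

lemma child_mem_fullNodes_succ {v : Node} (hv : v ∈ fullNodes L) (b : Bool) :
    child v b ∈ fullNodes (L + 1) := by
  obtain ⟨hl, hk⟩ := mem_fullNodes.1 hv
  refine mem_fullNodes.2 ⟨Nat.succ_lt_succ hl, ?_⟩
  simp only [child, pow_succ]
  cases b <;> simp only [Nat.bit_false, Nat.bit_true] <;> omega

lemma IsAnc.exists_child {u v : Node} (h : IsAnc u v) (hne : u ≠ v) :
    ∃ b, IsAnc (child u b) v := by
  induction hl : v.1 generalizing v with
  | zero => exact absurd hl (h.level_ne_zero hne)
  | succ l ih =>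
    have hv := h.level_ne_zero hne
    rcases eq_or_ne u (v.1 - 1, v.2 / 2) with rfl | hne'
    · obtain ⟨b, hb⟩ := exists_child_eq hv
      exact ⟨b, hb.symm ▸ IsAnc.refl v⟩
    · obtain ⟨b, hb⟩ := ih (h.to_parent hne) hne' (by simp [hl])
      exact ⟨b, hb.trans (isAnc_parent hv)⟩

section Twig

variable {u v w : Node}

lemma mem_twig : w ∈ twig u v ↔ IsAnc w v ∧ u.1 ≤ w.1 := by
  simp only [twig, Finset.mem_image, Finset.mem_Icc, IsAnc]
  constructor
  · rintro ⟨j, ⟨hu, hv⟩, rfl⟩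
    exact ⟨⟨hv, rfl⟩, hu⟩
  · rintro ⟨⟨hl, hk⟩, hu⟩
    exact ⟨w.1, ⟨hu, hl⟩, Prod.ext rfl hk.symm⟩

lemma mem_twig_of_isAnc (h : IsAnc u v) : w ∈ twig u v ↔ IsAnc u w ∧ IsAnc w v := by
  rw [mem_twig]
  exact ⟨fun h' => ⟨h.of_level_le h'.1 h'.2, h'.1⟩, fun h' => ⟨h'.2, h'.1.1⟩⟩

lemma twig_self (v : Node) : twig v v = {v} := by
  ext w
  rw [mem_twig, Finset.mem_singleton]
  exact ⟨fun h => h.1.eq_of_level h.2, fun h => h ▸ ⟨IsAnc.refl _, le_rfl⟩⟩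

lemma card_twig_le (hv : v ∈ fullNodes L) : (twig u v).card ≤ L := by
  refine Finset.card_image_le.trans ?_
  have := (mem_fullNodes.1 hv).1
  rw [Nat.card_Icc]
  omega

end Twig

lemma mem_treeSets_of_closed {S : Finset Node} (hS : S ⊆ fullNodes L)
    (h : ∀ v ∈ S, ∀ u, IsAnc u v → u ∈ S) : S ∈ treeSets L :=
  Finset.mem_filter.2 ⟨Finset.mem_powerset.2 hS, fun v hv _ hj => h v hv _ ⟨hj.le, rfl⟩⟩

namespace CartTree

variable {T : CartTree L} {u v w e : Node}

lemma subset_full (T : CartTree L) : T.1 ⊆ fullNodes L :=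
  Finset.mem_powerset.1 (Finset.mem_filter.1 T.2).1

lemma closed (T : CartTree L) (hv : v ∈ T.1) (h : IsAnc u v) : u ∈ T.1 := by
  rcases h.1.lt_or_eq with hl | hl
  · have := (Finset.mem_filter.1 T.2).2 v hv u.1 hl
    rwa [← h.2] at this
  · rwa [h.eq_of_level hl.ge]

lemma card_add_one_le (T : CartTree L) : T.1.card + 1 ≤ 2 ^ L :=
  card_fullNodes L ▸ Nat.succ_le_succ (Finset.card_le_card T.subset_full)

lemma mem_desc : w ∈ T.desc v ↔ w ∈ T.1 ∧ IsAnc v w := Finset.mem_filter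

lemma mem_ext :
    v ∈ T.ext ↔ v ∈ fullNodes (L + 1) ∧ v ∉ T.1 ∧ (v.1 = 0 ∨ (v.1 - 1, v.2 / 2) ∈ T.1) :=
  Finset.mem_filter

lemma notMem_of_mem_ext (h : v ∈ T.ext) : v ∉ T.1 := (mem_ext.1 h).2.1

lemma child_mem_ext_iff (hv : v ∈ T.1) {b : Bool} : child v b ∈ T.ext ↔ child v b ∉ T.1 :=
  ⟨notMem_of_mem_ext, fun h => mem_ext.2 ⟨child_mem_fullNodes_succ (T.subset_full hv) b, h,
    Or.inr ((parent_child v b).symm ▸ hv)⟩⟩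

lemma mem_preterminal : v ∈ T.preterminal ↔ v ∈ T.1 ∧ ∀ b, child v b ∉ T.1 := by
  rw [preterminal, Finset.mem_filter]
  refine and_congr_right fun hv => ?_
  rw [Bool.forall_bool, ← child_mem_ext_iff hv, ← child_mem_ext_iff hv]
  rfl

lemma mem_or_mem_ext_iff :
    v ∈ T.1 ∨ v ∈ T.ext ↔ v = (0, 0) ∨ ∃ u ∈ T.1, ∃ b, child u b = v := by
  constructor
  · intro hv
    have hfull : v ∈ fullNodes (L + 1) :=
      hv.elim (fun h => fullNodes_mono L.le_succ (T.subset_full h)) fun h => (mem_ext.1 h).1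
    rcases eq_or_ne v.1 0 with h0 | h0
    · exact Or.inl (eq_root_of_level_eq_zero hfull h0)
    · exact Or.inr ⟨_, hv.elim (fun h => T.closed h (isAnc_parent h0))
        fun h => (mem_ext.1 h).2.2.resolve_left h0, exists_child_eq h0⟩
  · intro hv
    refine or_iff_not_imp_left.2 fun hT => ?_
    rcases hv with rfl | ⟨u, hu, b, rfl⟩
    · exact mem_ext.2 ⟨mem_fullNodes.2 ⟨by simp, by simp⟩, hT, Or.inl rfl⟩
    · exact (child_mem_ext_iff hu).2 hT

lemma card_ext (T : CartTree L) : T.ext.card = T.1.card + 1 := by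
  have hunion : T.1 ∪ T.ext =
      insert (0, 0) ((T.1 ×ˢ Finset.univ).image (Function.uncurry child)) := by
    ext v
    simp only [Finset.mem_union, mem_or_mem_ext_iff, Finset.mem_insert, Finset.mem_image,
      Finset.mem_product, Finset.mem_univ, and_true, Prod.exists (α := Node), Function.uncurry]
    grind
  have hroot : (0, 0) ∉ (T.1 ×ˢ Finset.univ).image (Function.uncurry child) := by
    simp [child]
  have hcard := congrArg Finset.card hunion
  rw [Finset.card_union_of_disjoint (Finset.disjoint_right.2 fun _ => notMem_of_mem_ext),
    Finset.card_insert_of_notMem hroot, Finset.card_image_of_injective _ child_injective2.uncurry,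
    Finset.card_product, Finset.card_univ, Fintype.card_bool] at hcard
  omega

lemma card_ext_le (T : CartTree L) : T.ext.card ≤ 2 ^ L := T.card_ext ▸ T.card_add_one_le

lemma mem_of_isAnc_ext (he : e ∈ T.ext) (h : IsAnc u e) (hne : u ≠ e) : u ∈ T.1 :=
  T.closed ((mem_ext.1 he).2.2.resolve_left (h.level_ne_zero hne)) (h.to_parent hne)

lemma exists_ext (T : CartTree L) (hv : v ∈ fullNodes L) (hT : v ∉ T.1) :
    ∃ e ∈ T.ext, IsAnc e v := by
  induction hl : v.1 generalizing v with
  | zero => exact ⟨v, mem_ext.2 ⟨fullNodes_mono L.le_succ hv, hT, Or.inl hl⟩, IsAnc.refl v⟩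
  | succ l ih =>
    have hpar : IsAnc (v.1 - 1, v.2 / 2) v := isAnc_parent (by omega)
    by_cases hp : (v.1 - 1, v.2 / 2) ∈ T.1
    · exact ⟨v, mem_ext.2 ⟨fullNodes_mono L.le_succ hv, hT, Or.inr hp⟩, IsAnc.refl v⟩
    · obtain ⟨e, he, h⟩ := ih (hpar.mem_fullNodes hv) hp (by simp [hl])
      exact ⟨e, he, h.trans hpar⟩

lemma ext_unique (T : CartTree L) {e' : Node} (he : e ∈ T.ext) (he' : e' ∈ T.ext)
    (h : IsAnc e v) (h' : IsAnc e' v) : e = e' := by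
  wlog hle : e.1 ≤ e'.1 generalizing e e'
  · exact (this he' he h' h (Nat.le_of_not_le hle)).symm
  by_contra hne
  exact notMem_of_mem_ext he (mem_of_isAnc_ext he' (h.of_level_le h' hle) hne)

lemma mem_or_mem_twig (he : e ∈ T.ext) (h : IsAnc e v) (hw : IsAnc w v) :
    w ∈ T.1 ∨ w ∈ twig e v := by
  rcases le_or_gt e.1 w.1 with hl | hl
  · exact Or.inr (mem_twig.2 ⟨hw, hl⟩)
  · exact Or.inl (mem_of_isAnc_ext he (hw.of_level_le h hl.le) fun heq => hl.ne (heq ▸ rfl))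

/-- The tree that is left when the branch below `v`, including `v`, is removed. -/
def prune (T : CartTree L) (v : Node) : CartTree L :=
  ⟨T.1 \ T.desc v, mem_treeSets_of_closed (Finset.sdiff_subset.trans T.subset_full)
    fun w hw u hu => by
      rw [Finset.mem_sdiff, mem_desc] at hw ⊢
      exact ⟨T.closed hw.1 hu, fun h => hw.2 ⟨hw.1, h.2.trans hu⟩⟩⟩

lemma val_prune (T : CartTree L) (v : Node) : (T.prune v).1 = T.1 \ T.desc v := rfl

end CartTree

/-- `T'` arises from `T` by attaching the twig from the external node `e` to `v`. -/
structure IsGrowth (T T' : CartTree L) (e v : Node) : Prop where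
  ext : e ∈ T.ext
  full : v ∈ fullNodes L
  anc : IsAnc e v
  eq : T'.1 = T.1 ∪ twig e v

lemma exists_isGrowth (T : CartTree L) {e v : Node} (he : e ∈ T.ext) (hv : v ∈ fullNodes L)
    (h : IsAnc e v) : ∃ T' : CartTree L, IsGrowth T T' e v := by
  refine ⟨⟨T.1 ∪ twig e v, mem_treeSets_of_closed ?_ ?_⟩, he, hv, h, rfl⟩
  · exact Finset.union_subset T.subset_full fun w hw => (mem_twig.1 hw).1.mem_fullNodes hv
  · intro w hw u hu
    rw [Finset.mem_union] at hw ⊢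
    rcases hw with hw | hw
    · exact Or.inl (T.closed hw hu)
    · exact CartTree.mem_or_mem_twig he h (hu.trans (mem_twig.1 hw).1)

lemma isGrowth_prune {T : CartTree L} {v w : Node} (hw : w ∈ T.1) (hvw : IsAnc v w)
    (h : T.desc v = twig v w) : IsGrowth (T.prune v) T v w := by
  have hv := T.closed hw hvw
  refine ⟨CartTree.mem_ext.2 ⟨fullNodes_mono L.le_succ (T.subset_full hv), ?_, ?_⟩,
    T.subset_full hw, hvw, ?_⟩
  · exact fun hmem => (Finset.mem_sdiff.1 hmem).2 (CartTree.mem_desc.2 ⟨hv, IsAnc.refl v⟩)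
  · refine or_iff_not_imp_left.2 fun h0 => Finset.mem_sdiff.2 ⟨T.closed hv (isAnc_parent h0), ?_⟩
    intro hmem
    have := (CartTree.mem_desc.1 hmem).2.1
    simp only at this
    omega
  · rw [← h]
    exact (Finset.sdiff_union_of_subset (Finset.filter_subset _ _)).symm

namespace IsGrowth

variable {T T' : CartTree L} {e v : Node}

lemma notMem (h : IsGrowth T T' e v) {w : Node} (hw : IsAnc e w) : w ∉ T.1 := fun hw' =>
  CartTree.notMem_of_mem_ext h.ext (T.closed hw' hw)

lemma disjoint (h : IsGrowth T T' e v) : Disjoint T.1 (twig e v) :=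
  Finset.disjoint_right.2 fun _ hw => h.notMem ((mem_twig_of_isAnc h.anc).1 hw).1

lemma le (h : IsGrowth T T' e v) : T ≤ T' :=
  show T.1 ⊆ T'.1 from h.eq ▸ Finset.subset_union_left

lemma sdiff_eq (h : IsGrowth T T' e v) : T'.1 \ T.1 = twig e v := by
  rw [h.eq, Finset.union_sdiff_left, Finset.sdiff_eq_self_of_disjoint h.disjoint.symm]

lemma card_sdiff_le (h : IsGrowth T T' e v) : (T'.1 \ T.1).card ≤ L :=
  h.sdiff_eq ▸ card_twig_le h.full

lemma mem_bot (h : IsGrowth T T' e v) : v ∈ T'.1 := by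
  rw [h.eq]
  exact Finset.mem_union_right _ (mem_twig.2 ⟨IsAnc.refl _, h.anc.1⟩)

lemma mem_top (h : IsGrowth T T' e v) : e ∈ T'.1 := T'.closed h.mem_bot h.anc

lemma lt (h : IsGrowth T T' e v) : T < T' :=
  lt_of_le_of_ne h.le fun heq => h.notMem h.anc (heq ▸ h.mem_bot)

lemma desc_eq (h : IsGrowth T T' e v) : T'.desc e = twig e v := by
  ext w
  rw [CartTree.mem_desc, h.eq, Finset.mem_union]
  exact ⟨fun hw => hw.1.resolve_left (h.notMem hw.2),
    fun hw => ⟨Or.inr hw, ((mem_twig_of_isAnc h.anc).1 hw).1⟩⟩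

lemma eq_prune (h : IsGrowth T T' e v) : T = T'.prune e := by
  refine Subtype.ext ?_
  rw [CartTree.val_prune, h.desc_eq, h.eq, Finset.union_sdiff_right,
    Finset.sdiff_eq_self_of_disjoint h.disjoint]

lemma eq_union_path (h : IsGrowth T T' e v) : T'.1 = T.1 ∪ twig (0, 0) v := by
  rw [h.eq]
  refine subset_antisymm (Finset.union_subset_union_right fun w hw =>
    mem_twig.2 ⟨(mem_twig.1 hw).1, Nat.zero_le _⟩) (Finset.union_subset Finset.subset_union_left
      fun w hw => Finset.mem_union.2 (CartTree.mem_or_mem_twig h.ext h.anc (mem_twig.1 hw).1))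

end IsGrowth

lemma exists_isGrowth_of_lt {Ts T : CartTree L} (h : Ts < T) :
    ∃ (T' : CartTree L) (v : Node), Ts ≤ T' ∧ v ∉ Ts.1 ∧ IsGrowth T' T v v := by
  have hne : (T.1 \ Ts.1).Nonempty := Finset.sdiff_nonempty.2 h.not_ge
  obtain ⟨v, hv, hmax⟩ := Finset.exists_max_image _ (fun v : Node => v.1) hne
  rw [Finset.mem_sdiff] at hv
  have hout : ∀ w ∈ T.desc v, w ∉ Ts.1 := fun w hw hw' =>
    hv.2 (Ts.closed hw' (CartTree.mem_desc.1 hw).2)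
  have hdesc : T.desc v = twig v v := by
    ext w
    rw [twig_self, Finset.mem_singleton]
    constructor
    · intro hw
      obtain ⟨hwT, hvw⟩ := CartTree.mem_desc.1 hw
      exact (hvw.eq_of_level (hmax w (Finset.mem_sdiff.2 ⟨hwT, hout w hw⟩))).symm
    · rintro rfl
      exact CartTree.mem_desc.2 ⟨hv.1, IsAnc.refl w⟩
  exact ⟨T.prune v, v, fun w hw => Finset.mem_sdiff.2 ⟨h.le hw, fun hw' => hout w hw' hw⟩, hv.2,
    isGrowth_prune hv.1 (IsAnc.refl v) hdesc⟩

/-- The upward steps of the samplers: attaching a twig, of length one for Bayesian CART. -/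
def Sampler.Step (s : Sampler) (T T' : CartTree L) : Prop :=
  ∃ e v, IsGrowth T T' e v ∧ (s = .bayesianCART → e = v)

lemma card_step_up_le (s : Sampler) (T : CartTree L) [DecidablePred (s.Step T)] :
    (Finset.univ.filter (s.Step T)).card ≤ 2 ^ L := by
  have hmaps : ∀ T' ∈ Finset.univ.filter (s.Step T),
      T'.1 ∈ (fullNodes L).image fun v => T.1 ∪ twig (0, 0) v := by
    intro T' hT'
    obtain ⟨e, v, h, -⟩ := (Finset.mem_filter.1 hT').2
    exact Finset.mem_image.2 ⟨v, h.full, h.eq_union_path.symm⟩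
  exact (Finset.card_le_card_of_injOn _ hmaps Subtype.val_injective.injOn).trans
    (Finset.card_image_le.trans (Nat.le_of_succ_le (card_fullNodes L).le))

lemma card_step_down_le (s : Sampler) (T : CartTree L) [DecidablePred fun T' => s.Step T' T] :
    (Finset.univ.filter fun T' => s.Step T' T).card ≤ 2 ^ L := by
  have hsub : (Finset.univ.filter fun T' => s.Step T' T) ⊆ T.1.image T.prune := by
    intro T' hT'
    obtain ⟨e, v, h, -⟩ := (Finset.mem_filter.1 hT').2
    exact Finset.mem_image.2 ⟨e, h.mem_top, h.eq_prune.symm⟩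
  exact (Finset.card_le_card hsub).trans
    (Finset.card_image_le.trans (Nat.le_of_succ_le T.card_add_one_le))

/-! ### The proposals -/

lemma growProb_nonneg (T : CartTree L) : 0 ≤ growProb T := by
  unfold growProb
  split_ifs <;> norm_num

lemma growProb_le_one (T : CartTree L) : growProb T ≤ 1 := by
  unfold growProb
  split_ifs <;> norm_num

lemma half_le_growProb {T T' : CartTree L} (h : T < T') : 1 / 2 ≤ growProb T := by
  have hT : T.1 ≠ fullNodes L := fun heq => h.not_ge
    (show T'.1 ⊆ T.1 from heq ▸ T'.subset_full)
  rw [growProb, if_neg hT]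
  split_ifs <;> norm_num

lemma growProb_le_half {T T' : CartTree L} (h : T < T') : growProb T' ≤ 1 / 2 := by
  have hT' : T'.1 ≠ ∅ := fun heq => h.not_ge
    (show T'.1 ⊆ T.1 from heq ▸ Finset.empty_subset _)
  rw [growProb, if_neg hT']
  split_ifs <;> norm_num

lemma sum_one_div_card_le_one {ι : Type*} (s : Finset ι) :
    ∑ _i ∈ s, 1 / (s.card : ℝ) ≤ 1 := by
  rw [Finset.sum_const, nsmul_eq_mul, mul_one_div]
  exact div_self_le_one _

lemma sum_sum_ite_le_of_unique {α ι : Type*} [Fintype α] (s : Finset ι) (p : ι → α → Prop)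
    [∀ i, DecidablePred (p i)] (w : ι → ℝ) (hw : ∀ i ∈ s, 0 ≤ w i)
    (hp : ∀ i ∈ s, ∀ x y, p i x → p i y → x = y) :
    ∑ x, ∑ i ∈ s, (if p i x then w i else 0) ≤ ∑ i ∈ s, w i := by
  rw [Finset.sum_comm]
  refine Finset.sum_le_sum fun i hi => ?_
  by_cases h : ∃ x, p i x
  · obtain ⟨x, hx⟩ := h
    rw [Finset.sum_eq_single x]
    · rw [if_pos hx]
    · exact fun y _ hy => if_neg fun hy' => hy (hp i hi _ _ hy' hx)
    · simp
  · push Not at h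
    simp [h, hw i hi]

lemma one_div_le_sum_ite {ι : Type*} {s : Finset ι} {p : ι → Prop} [DecidablePred p] {i : ι}
    {N : ℝ} (hs : s.card ≤ N) (hi : i ∈ s) (hp : p i) :
    1 / N ≤ ∑ j ∈ s, if p j then 1 / (s.card : ℝ) else 0 := by
  have hpos : (0 : ℝ) < s.card := by exact_mod_cast Finset.card_pos.2 ⟨i, hi⟩
  refine (one_div_le_one_div_of_le hpos hs).trans ?_
  have hterm := Finset.single_le_sum (f := fun j => if p j then 1 / (s.card : ℝ) else 0)
    (fun j _ => by split_ifs <;> positivity) hi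
  rwa [if_pos hp] at hterm

lemma cartGrow_nonneg (T T' : CartTree L) : 0 ≤ cartGrow T T' :=
  Finset.sum_nonneg fun v _ => by split_ifs <;> positivity

lemma cartPrune_nonneg (T T' : CartTree L) : 0 ≤ cartPrune T T' :=
  Finset.sum_nonneg fun v _ => by split_ifs <;> positivity

lemma twiggyPrune_nonneg (T T' : CartTree L) : 0 ≤ twiggyPrune T T' :=
  Finset.sum_nonneg fun v _ => by split_ifs <;> positivity

lemma twiggyGrow_nonneg {D : ℝ} (hD : 0 ≤ D) (T T' : CartTree L) : 0 ≤ twiggyGrow D T T' :=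
  Finset.sum_nonneg fun l _ => Finset.sum_nonneg fun k _ => by split_ifs <;> positivity

lemma sum_cartGrow_le (T : CartTree L) : ∑ T', cartGrow T T' ≤ 1 :=
  (sum_sum_ite_le_of_unique T.ext (fun v (T' : CartTree L) => T'.1 = insert v T.1) _
    (fun _ _ => by positivity) fun _ _ _ _ h h' => Subtype.ext (h.trans h'.symm)).trans
    (sum_one_div_card_le_one _)

lemma sum_cartPrune_le (T : CartTree L) : ∑ T', cartPrune T T' ≤ 1 :=
  (sum_sum_ite_le_of_unique T.preterminal (fun v (T' : CartTree L) => T'.1 = T.1.erase v) _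
    (fun _ _ => by positivity) fun _ _ _ _ h h' => Subtype.ext (h.trans h'.symm)).trans
    (sum_one_div_card_le_one _)

lemma sum_twiggyPrune_le (T : CartTree L) : ∑ T', twiggyPrune T T' ≤ 1 :=
  (sum_sum_ite_le_of_unique T.twigTops (fun v (T' : CartTree L) => T'.1 = T.1 \ T.desc v) _
    (fun _ _ => by positivity) fun _ _ _ _ h h' => Subtype.ext (h.trans h'.symm)).trans
    (sum_one_div_card_le_one _)

lemma sum_twiggyGrow_le {D : ℝ} (hD : 0 ≤ D) (T : CartTree L) :
    ∑ T', twiggyGrow D T T' ≤ 1 := by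
  unfold twiggyGrow
  rw [Finset.sum_comm]
  calc _ ≤ ∑ l ∈ T.eligible, (D ^ l)⁻¹ / ∑ l' ∈ T.eligible, (D ^ l')⁻¹ := by
        refine Finset.sum_le_sum fun l _ => ?_
        refine (sum_sum_ite_le_of_unique (T.free l) (fun k (T' : CartTree L) =>
          ∃ e ∈ T.ext, IsAnc e (l, k) ∧ T'.1 = T.1 ∪ twig e (l, k)) _
          (fun _ _ => by positivity) ?_).trans ?_
        · rintro k - T₁ T₂ ⟨e, he, ha, h⟩ ⟨e', he', ha', h'⟩
          obtain rfl := T.ext_unique he he' ha ha'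
          exact Subtype.ext (h.trans h'.symm)
        · rw [Finset.sum_const, nsmul_eq_mul, mul_div_left_comm]
          exact mul_le_of_le_one_right (by positivity) (div_self_le_one _)
    _ ≤ 1 := by
        rw [← Finset.sum_div]
        exact div_self_le_one _

lemma Sampler.proposal_nonneg {s : Sampler} (hs : s.Valid) (T T' : CartTree L) :
    0 ≤ s.proposal T T' := by
  have hgrow := growProb_nonneg T
  have hprune := sub_nonneg.2 (growProb_le_one T)
  cases s with
  | bayesianCART =>
    exact add_nonneg (mul_nonneg hgrow (cartGrow_nonneg _ _))
      (mul_nonneg hprune (cartPrune_nonneg _ _))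
  | twiggy D =>
    exact add_nonneg (mul_nonneg hgrow (twiggyGrow_nonneg (zero_le_one.trans hs.1.le) _ _))
      (mul_nonneg hprune (twiggyPrune_nonneg _ _))

lemma sum_mixture_le {α : Type*} [Fintype α] {g p : α → ℝ} {w : ℝ} (h₀ : 0 ≤ w) (h₁ : w ≤ 1)
    (hg : ∑ x, g x ≤ 1) (hp : ∑ x, p x ≤ 1) : ∑ x, (w * g x + (1 - w) * p x) ≤ 1 := by
  rw [Finset.sum_add_distrib, ← Finset.mul_sum, ← Finset.mul_sum]
  nlinarith

lemma Sampler.sum_proposal_le {s : Sampler} (hs : s.Valid) (T : CartTree L) :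
    ∑ T', s.proposal T T' ≤ 1 := by
  cases s with
  | bayesianCART =>
    exact sum_mixture_le (growProb_nonneg T) (growProb_le_one T) (sum_cartGrow_le T)
      (sum_cartPrune_le T)
  | twiggy D =>
    exact sum_mixture_le (growProb_nonneg T) (growProb_le_one T)
      (sum_twiggyGrow_le (zero_le_one.trans hs.1.le) T) (sum_twiggyPrune_le T)

lemma Sampler.proposal_le_one {s : Sampler} (hs : s.Valid) (T T' : CartTree L) :
    s.proposal T T' ≤ 1 :=
  (Finset.single_le_sum (fun T' _ => s.proposal_nonneg hs T T') (Finset.mem_univ T')).trans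
    (s.sum_proposal_le hs T)

lemma CartTree.desc_of_mem_preterminal {T : CartTree L} {v : Node} (h : v ∈ T.preterminal) :
    T.desc v = {v} := by
  obtain ⟨hv, hchild⟩ := CartTree.mem_preterminal.1 h
  ext w
  rw [CartTree.mem_desc, Finset.mem_singleton]
  constructor
  · rintro ⟨hw, hvw⟩
    by_contra hne
    obtain ⟨b, hb⟩ := hvw.exists_child (Ne.symm hne)
    exact hchild b (T.closed hw hb)
  · rintro rfl
    exact ⟨hv, IsAnc.refl _⟩

lemma step_of_cartGrow_ne_zero {T T' : CartTree L} (h : cartGrow T T' ≠ 0) :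
    Sampler.bayesianCART.Step T T' := by
  obtain ⟨v, hv, hne⟩ := Finset.exists_ne_zero_of_sum_ne_zero h
  have hT' : T'.1 = insert v T.1 := (ite_ne_right_iff.1 hne).1
  refine ⟨v, v, ⟨hv, T'.subset_full (hT' ▸ Finset.mem_insert_self _ _), IsAnc.refl v, ?_⟩,
    fun _ => rfl⟩
  rw [twig_self, hT', Finset.insert_eq, Finset.union_comm]

lemma step_of_cartPrune_ne_zero {T T' : CartTree L} (h : cartPrune T T' ≠ 0) :
    Sampler.bayesianCART.Step T' T := by
  obtain ⟨v, hv, hne⟩ := Finset.exists_ne_zero_of_sum_ne_zero h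
  have hdesc := CartTree.desc_of_mem_preterminal hv
  have hT' : T' = T.prune v := Subtype.ext <| (ite_ne_right_iff.1 hne).1.trans <| by
    rw [CartTree.val_prune, hdesc, Finset.sdiff_singleton_eq_erase]
  rw [hT']
  exact ⟨v, v, isGrowth_prune (CartTree.mem_preterminal.1 hv).1 (IsAnc.refl v)
    (hdesc.trans (twig_self v).symm), fun _ => rfl⟩

lemma step_of_twiggyGrow_ne_zero {D : ℝ} {T T' : CartTree L} (h : twiggyGrow D T T' ≠ 0) :
    (Sampler.twiggy D).Step T T' := by
  obtain ⟨l, hl, hne⟩ := Finset.exists_ne_zero_of_sum_ne_zero h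
  obtain ⟨k, hk, hne⟩ := Finset.exists_ne_zero_of_sum_ne_zero hne
  obtain ⟨e, he, ha, hT'⟩ := (ite_ne_right_iff.1 hne).1
  exact ⟨e, (l, k), ⟨he, mem_fullNodes.2 ⟨Finset.mem_range.1 (Finset.mem_filter.1 hl).1,
    Finset.mem_range.1 (Finset.mem_filter.1 hk).1⟩, ha, hT'⟩, nofun⟩

lemma step_of_twiggyPrune_ne_zero {D : ℝ} {T T' : CartTree L} (h : twiggyPrune T T' ≠ 0) :
    (Sampler.twiggy D).Step T' T := by
  obtain ⟨v, hv, hne⟩ := Finset.exists_ne_zero_of_sum_ne_zero h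
  have hT' : T' = T.prune v := Subtype.ext (ite_ne_right_iff.1 hne).1
  obtain ⟨-, w, hw, ha, hd⟩ := Finset.mem_filter.1 hv
  exact hT' ▸ ⟨v, w, isGrowth_prune hw ha hd, nofun⟩

lemma Sampler.step_of_proposal_ne_zero {s : Sampler} {T T' : CartTree L}
    (h : s.proposal T T' ≠ 0) : s.Step T T' ∨ s.Step T' T := by
  cases s with
  | bayesianCART =>
    by_cases h' : cartGrow T T' = 0
    · exact Or.inr (step_of_cartPrune_ne_zero fun h'' => h (by simp [proposal, h', h'']))
    · exact Or.inl (step_of_cartGrow_ne_zero h')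
  | twiggy D =>
    by_cases h' : twiggyGrow D T T' = 0
    · exact Or.inr (step_of_twiggyPrune_ne_zero fun h'' => h (by simp [proposal, h', h'']))
    · exact Or.inl (step_of_twiggyGrow_ne_zero h')

lemma CartTree.card_le_of_subset {T : CartTree L} {S : Finset Node} (h : S ⊆ T.1) :
    (S.card : ℝ) ≤ 2 ^ L := by
  exact_mod_cast (Finset.card_le_card h).trans (Nat.le_of_succ_le T.card_add_one_le)

lemma IsGrowth.mem_preterminal {T T' : CartTree L} {v : Node} (h : IsGrowth T T' v v) :
    v ∈ T'.preterminal := by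
  refine CartTree.mem_preterminal.2 ⟨h.mem_top, fun b hb => ?_⟩
  rw [h.eq, twig_self, Finset.mem_union, Finset.mem_singleton] at hb
  rcases hb with hb | hb
  · exact h.notMem (isAnc_child v b) hb
  · exact Nat.succ_ne_self _ (congrArg Prod.fst hb)

lemma inv_le_cartGrow {T T' : CartTree L} {v : Node} (h : IsGrowth T T' v v) :
    1 / 2 ^ L ≤ cartGrow T T' :=
  one_div_le_sum_ite (by exact_mod_cast T.card_ext_le) h.ext
    (by rw [h.eq, twig_self, Finset.union_comm, Finset.insert_eq])

lemma inv_le_cartPrune {T T' : CartTree L} {v : Node} (h : IsGrowth T T' v v) :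
    1 / 2 ^ L ≤ cartPrune T' T :=
  one_div_le_sum_ite (CartTree.card_le_of_subset (Finset.filter_subset _ _)) h.mem_preterminal
    (by rw [h.eq_prune, CartTree.val_prune, h.desc_eq, twig_self, Finset.sdiff_singleton_eq_erase])

lemma inv_le_twiggyPrune {T T' : CartTree L} {e v : Node} (h : IsGrowth T T' e v) :
    1 / 2 ^ L ≤ twiggyPrune T' T :=
  one_div_le_sum_ite (CartTree.card_le_of_subset (Finset.filter_subset _ _))
    (Finset.mem_filter.2 ⟨h.mem_top, v, h.mem_bot, h.anc, h.desc_eq⟩)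
    (congrArg Subtype.val h.eq_prune)

lemma IsGrowth.mem_free {T T' : CartTree L} {e v : Node} (h : IsGrowth T T' e v) :
    v.2 ∈ T.free v.1 :=
  Finset.mem_filter.2 ⟨Finset.mem_range.2 (mem_fullNodes.1 h.full).2, h.notMem h.anc⟩

lemma IsGrowth.mem_eligible {T T' : CartTree L} {e v : Node} (h : IsGrowth T T' e v) :
    v.1 ∈ T.eligible :=
  Finset.mem_filter.2 ⟨Finset.mem_range.2 (mem_fullNodes.1 h.full).1, v.2, h.mem_free⟩

lemma IsGrowth.le_twiggyGrow {D : ℝ} (hD : 0 ≤ D) {T T' : CartTree L} {e v : Node}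
    (h : IsGrowth T T' e v) :
    (D ^ v.1)⁻¹ / (∑ l ∈ T.eligible, (D ^ l)⁻¹) / ((T.free v.1).card : ℝ) ≤ twiggyGrow D T T' := by
  refine le_trans ?_ (Finset.single_le_sum (fun _ _ => Finset.sum_nonneg fun _ _ => by
    split_ifs <;> positivity) h.mem_eligible)
  refine le_trans ?_ (Finset.single_le_sum (fun _ _ => by split_ifs <;> positivity) h.mem_free)
  rw [if_pos ⟨e, h.ext, h.anc, h.eq⟩]

lemma pow_mul_sum_inv_pow {D : ℝ} (hD : 1 < D) (N : ℕ) :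
    D ^ N * ∑ l ∈ Finset.range (N + 1), (D ^ l)⁻¹ = (D ^ (N + 1) - 1) / (D - 1) := by
  have hD0 : D ≠ 0 := by linarith
  rw [← geom_sum_eq hD.ne', Finset.mul_sum, ← Finset.sum_range_reflect]
  refine Finset.sum_congr rfl fun l hl => ?_
  have hl := Finset.mem_range.1 hl
  rw [← div_eq_mul_inv, div_eq_iff (pow_ne_zero _ hD0), ← pow_add]
  congr 1
  omega

lemma pow_mul_sum_eligible_le {D : ℝ} (hD : 1 < D) (T : CartTree (L + 1)) :
    D ^ L * ∑ l ∈ T.eligible, (D ^ l)⁻¹ ≤ (D ^ (L + 1) - 1) / (D - 1) := by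
  rw [← pow_mul_sum_inv_pow hD L]
  refine mul_le_mul_of_nonneg_left ?_ (by positivity)
  exact Finset.sum_le_sum_of_subset_of_nonneg (Finset.filter_subset _ _) fun _ _ _ => by positivity

lemma delta_le_twiggyGrow {D : ℝ} (hD : 1 < D) {T T' : CartTree L} {e v : Node}
    (h : IsGrowth T T' e v) : (Sampler.twiggy D).delta L / 2 ^ L ≤ twiggyGrow D T T' := by
  have hl := (mem_fullNodes.1 h.full).1
  have hcard : ((T.free v.1).card : ℝ) ≤ 2 ^ v.1 := by
    exact_mod_cast (Finset.card_filter_le _ _).trans (Finset.card_range _).le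
  have hcpos : (0 : ℝ) < (T.free v.1).card := by exact_mod_cast Finset.card_pos.2 ⟨_, h.mem_free⟩
  have hGpos : 0 < ∑ l ∈ T.eligible, (D ^ l)⁻¹ :=
    Finset.sum_pos (fun _ _ => by positivity) ⟨_, h.mem_eligible⟩
  obtain ⟨N, rfl⟩ : ∃ N, L = N + 1 := ⟨L - 1, by omega⟩
  have hdelta : (Sampler.twiggy D).delta (N + 1) = 2 / ((D ^ (N + 1) - 1) / (D - 1)) :=
    (div_div_eq_mul_div _ _ _).symm
  refine le_trans ?_ (h.le_twiggyGrow (by linarith))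
  set G := ∑ l ∈ T.eligible, (D ^ l)⁻¹
  calc (Sampler.twiggy D).delta (N + 1) / 2 ^ (N + 1)
      ≤ 2 / (D ^ N * G) / 2 ^ (N + 1) := by
        rw [hdelta]
        gcongr
        exact pow_mul_sum_eligible_le hD T
    _ = 1 / ((D ^ N * 2 ^ N) * G) := by
        rw [pow_succ]; field_simp
    _ ≤ 1 / ((D ^ v.1 * 2 ^ v.1) * G) := by
        have := Nat.le_of_lt_succ hl
        gcongr
        · exact hD.le
        · norm_num
    _ ≤ 1 / ((D ^ v.1 * (T.free v.1).card) * G) := by gcongr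
    _ = (D ^ v.1)⁻¹ / G / (T.free v.1).card := by field_simp

lemma Sampler.delta_nonneg {s : Sampler} (hs : s.Valid) (L : ℕ) : 0 ≤ s.delta L := by
  cases s with
  | bayesianCART => exact zero_le_one
  | twiggy D =>
    exact div_nonneg (mul_nonneg zero_le_two (sub_nonneg.2 hs.1.le))
      (sub_nonneg.2 (one_le_pow₀ hs.1.le))

lemma Sampler.delta_le_proposal {s : Sampler} (hs : s.Valid) {T T' : CartTree L}
    (h : s.Step T T') : s.delta L / 2 ^ (L + 1) ≤ s.proposal T T' := by
  obtain ⟨e, v, h, he⟩ := h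
  have hgrow := half_le_growProb h.lt
  have hprune := sub_nonneg.2 (growProb_le_one T)
  have hsplit : s.delta L / 2 ^ (L + 1) = 1 / 2 * (s.delta L / 2 ^ L) := by
    rw [pow_succ]; field_simp
  have hdelta : 0 ≤ s.delta L / 2 ^ L := div_nonneg (s.delta_nonneg hs L) (by positivity)
  rw [hsplit]
  cases s with
  | bayesianCART =>
    obtain rfl := he rfl
    exact le_add_of_le_of_nonneg
      (mul_le_mul hgrow (inv_le_cartGrow h) hdelta (by linarith))
      (mul_nonneg hprune (cartPrune_nonneg _ _))
  | twiggy D =>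
    exact le_add_of_le_of_nonneg
      (mul_le_mul hgrow (delta_le_twiggyGrow hs.1 h) hdelta (by linarith))
      (mul_nonneg hprune (twiggyPrune_nonneg _ _))

lemma Sampler.inv_le_proposal {s : Sampler} (hs : s.Valid) {T T' : CartTree L}
    (h : s.Step T T') : 1 / 2 ^ (L + 1) ≤ s.proposal T' T := by
  obtain ⟨e, v, h, he⟩ := h
  have hprune : 1 / 2 ≤ 1 - growProb T' := by linarith [growProb_le_half h.lt]
  have hgrow := growProb_nonneg T'
  have hsplit : (1 : ℝ) / 2 ^ (L + 1) = 1 / 2 * (1 / 2 ^ L) := by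
    rw [pow_succ]; field_simp
  rw [hsplit]
  cases s with
  | bayesianCART =>
    obtain rfl := he rfl
    exact le_add_of_nonneg_of_le (mul_nonneg hgrow (cartGrow_nonneg _ _))
      (mul_le_mul hprune (inv_le_cartPrune h) (by positivity) (by linarith))
  | twiggy D =>
    exact le_add_of_nonneg_of_le
      (mul_nonneg hgrow (twiggyGrow_nonneg (zero_le_one.trans hs.1.le) _ _))
      (mul_le_mul hprune (inv_le_twiggyPrune h) (by positivity) (by linarith))

/-! ### The Haar design -/

lemma card_filter_div_eq {N q n : ℕ} (hN : 0 < N) (h : (q + 1) * N ≤ n) :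
    ((Finset.range n).filter fun i => i / N = q).card = N := by
  have hblock : (Finset.range n).filter (fun i => i / N = q) =
      Finset.Ico (q * N) ((q + 1) * N) := by
    ext i
    simp only [Finset.mem_filter, Finset.mem_range, Finset.mem_Ico, Nat.div_eq_iff hN]
    rw [Nat.add_mul, one_mul] at h ⊢
    omega
  rw [hblock, Nat.card_Ico, Nat.add_mul, one_mul, Nat.add_sub_cancel_left]

lemma add_one_div_mem_Ioc_iff {N : ℕ} (hN : 0 < N) (i q : ℕ) :
    ((i : ℝ) + 1) / N ∈ Set.Ioc (q : ℝ) (q + 1) ↔ i / N = q := by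
  have hN' : (0 : ℝ) < N := by exact_mod_cast hN
  rw [Set.mem_Ioc, lt_div_iff₀ hN', div_le_iff₀ hN', Nat.div_eq_iff hN]
  norm_cast
  rw [Nat.add_mul, one_mul]
  omega

/-- The mother wavelet, stretched to length `2 * N` and moved by `k` of its lengths, at the
integer `i + 1`. -/
def haarStep (N k i : ℕ) : ℝ :=
  (if i / N = 2 * k then 1 else 0) - if i / N = 2 * k + 1 then 1 else 0

lemma haarStep_mul_self (N k i : ℕ) : haarStep N k i * haarStep N k i =
    (if i / N = 2 * k then 1 else 0) + if i / N = 2 * k + 1 then 1 else 0 := by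
  simp only [haarStep]
  split_ifs <;> first | omega | norm_num

lemma haarStep_mul_of_ne {k k' : ℕ} (hk : k ≠ k') (N i : ℕ) :
    haarStep N k i * haarStep N k' i = 0 := by
  simp only [haarStep]
  split_ifs <;> first | omega | norm_num

lemma mul_haarStep (g : ℕ → ℝ) (N k i : ℕ) : g (i / (2 * N)) * haarStep N k i =
    (if i / N = 2 * k then g k else 0) - if i / N = 2 * k + 1 then g k else 0 := by
  have hdiv : i / (2 * N) = i / N / 2 := by rw [mul_comm, Nat.div_div_eq_div_mul]
  by_cases hk : i / N / 2 = k
  · simp only [hdiv, hk, haarStep, mul_sub, mul_ite, mul_one, mul_zero]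
  · have hleft : i / N ≠ 2 * k := by omega
    have hright : i / N ≠ 2 * k + 1 := by omega
    simp [haarStep, hleft, hright]

lemma sum_mul_haarStep {N k n : ℕ} (hN : 0 < N) (h : (2 * k + 2) * N ≤ n) (g : ℕ → ℝ) :
    ∑ i ∈ Finset.range n, g (i / (2 * N)) * haarStep N k i = 0 := by
  simp only [mul_haarStep]
  rw [Finset.sum_sub_distrib, ← Finset.sum_filter, ← Finset.sum_filter, Finset.sum_const,
    Finset.sum_const, card_filter_div_eq hN, card_filter_div_eq hN h, sub_self]
  exact (Nat.mul_le_mul_right _ (Nat.le_succ _)).trans h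

lemma sum_haarStep_sq {N k n : ℕ} (hN : 0 < N) (h : (2 * k + 2) * N ≤ n) :
    ∑ i ∈ Finset.range n, haarStep N k i * haarStep N k i = 2 * N := by
  simp only [haarStep_mul_self]
  rw [Finset.sum_add_distrib, ← Finset.sum_filter, ← Finset.sum_filter, Finset.sum_const,
    Finset.sum_const, card_filter_div_eq hN, card_filter_div_eq hN h, nsmul_eq_mul, mul_one,
    two_mul]
  exact (Nat.mul_le_mul_right _ (Nat.le_succ _)).trans h

lemma haarMother_add_one_div {N : ℕ} (hN : 0 < N) (i k : ℕ) :
    haarMother (((i : ℝ) + 1) / N / 2 - k) = haarStep N k i := by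
  have hleft : ((i : ℝ) + 1) / N / 2 - k ∈ Set.Ioc (0 : ℝ) (1 / 2) ↔ i / N = 2 * k := by
    rw [← add_one_div_mem_Ioc_iff hN]
    push_cast
    constructor <;> rintro ⟨hl, hr⟩ <;> constructor <;> linarith
  have hright : ((i : ℝ) + 1) / N / 2 - k ∈ Set.Ioc (1 / 2 : ℝ) 1 ↔ i / N = 2 * k + 1 := by
    rw [← add_one_div_mem_Ioc_iff hN]
    push_cast
    constructor <;> rintro ⟨hl, hr⟩ <;> constructor <;> linarith
  simp only [haarMother, haarStep, Set.indicator_apply, hleft, hright, Pi.one_apply]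

lemma sampleSize_eq {Lmax l : ℕ} (hl : l ≤ Lmax) :
    sampleSize Lmax = 2 ^ l * (2 * 2 ^ (Lmax - l)) := by
  rw [sampleSize, ← pow_succ', ← pow_add]
  congr 1
  omega

lemma haar_some_designPoint {Lmax : ℕ} {w : Node} (hw : w.1 ≤ Lmax) (i : Fin (sampleSize Lmax)) :
    haar (some w) (designPoint (sampleSize Lmax) i) =
      (2 : ℝ) ^ ((w.1 : ℝ) / 2) * haarStep (2 ^ (Lmax - w.1)) w.2 i := by
  have hn : (sampleSize Lmax : ℝ) = 2 ^ w.1 * (2 * (2 ^ (Lmax - w.1) : ℕ)) := by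
    exact_mod_cast sampleSize_eq hw
  have hx : (2 : ℝ) ^ w.1 * designPoint (sampleSize Lmax) i - w.2 =
      (((i : ℕ) : ℝ) + 1) / (2 ^ (Lmax - w.1) : ℕ) / 2 - w.2 := by
    rw [designPoint, hn]
    push_cast
    field_simp
  rw [haar, hx, haarMother_add_one_div (by positivity)]

lemma haar_none_designPoint {n : ℕ} (i : Fin n) : haar none (designPoint n i) = 1 := by
  have hn : (0 : ℝ) < n := by exact_mod_cast i.pos
  have hi : ((i : ℕ) + 1 : ℝ) ≤ n := by exact_mod_cast i.2
  have hmem : designPoint n i ∈ Set.Icc (0 : ℝ) 1 :=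
    ⟨by rw [designPoint]; positivity, (div_le_one hn).2 hi⟩
  simp [haar, Set.indicator_of_mem hmem]

section Orthogonality

variable {Lmax : ℕ} {v w : Node}

lemma haar_designPoint_const_of_level_lt {l : ℕ} (hl : l ≤ Lmax) {u : Index}
    (hu : ∀ v ∈ u, v.1 < l) : ∃ g : ℕ → ℝ, ∀ i : Fin (sampleSize Lmax),
      haar u (designPoint (sampleSize Lmax) i) = g (i / (2 * 2 ^ (Lmax - l))) := by
  rcases u with _ | ⟨j, k⟩
  · exact ⟨fun _ => 1, haar_none_designPoint⟩
  · have hj : j < l := hu _ rfl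
    refine ⟨fun q => (2 : ℝ) ^ ((j : ℝ) / 2) * haarStep (2 ^ (l - j - 1)) k q, fun i => ?_⟩
    have hdiv : (i : ℕ) / (2 * 2 ^ (Lmax - l)) / 2 ^ (l - j - 1) = i / 2 ^ (Lmax - j) := by
      rw [Nat.div_div_eq_div_mul, ← pow_succ', ← pow_add]
      congr 2
      omega
    simp only [haar_some_designPoint (w := (j, k)) (hj.le.trans hl), haarStep, hdiv]

lemma block_le_sampleSize (hL : L ≤ Lmax) (hw : w ∈ fullNodes L) :
    (2 * w.2 + 2) * 2 ^ (Lmax - w.1) ≤ sampleSize Lmax := by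
  obtain ⟨hl, hk⟩ := mem_fullNodes.1 hw
  rw [sampleSize_eq (hl.le.trans hL), mul_left_comm, ← mul_assoc]
  exact Nat.mul_le_mul_right _ (by omega)

lemma sum_haar_mul_haar_of_level_lt (hL : L ≤ Lmax) {u : Index} (hw : w ∈ fullNodes L)
    (hu : ∀ v ∈ u, v.1 < w.1) :
    ∑ i, haar u (designPoint (sampleSize Lmax) i) *
      haar (some w) (designPoint (sampleSize Lmax) i) = 0 := by
  have hl : w.1 ≤ Lmax := (mem_fullNodes.1 hw).1.le.trans hL
  obtain ⟨g, hg⟩ := haar_designPoint_const_of_level_lt hl hu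
  have hzero := sum_mul_haarStep (by positivity) (block_le_sampleSize hL hw) g
  rw [Finset.sum_range] at hzero
  calc
    _ = ∑ i : Fin (sampleSize Lmax), (2 : ℝ) ^ ((w.1 : ℝ) / 2) *
        (g (i / (2 * 2 ^ (Lmax - w.1))) * haarStep (2 ^ (Lmax - w.1)) w.2 i) :=
      Finset.sum_congr rfl fun i _ => by rw [hg, haar_some_designPoint hl, mul_left_comm]
    _ = 0 := by rw [← Finset.mul_sum, hzero, mul_zero]

lemma sum_haar_sq (hL : L ≤ Lmax) (hw : w ∈ fullNodes L) :
    ∑ i, haar (some w) (designPoint (sampleSize Lmax) i) *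
      haar (some w) (designPoint (sampleSize Lmax) i) = sampleSize Lmax := by
  have hl : w.1 ≤ Lmax := (mem_fullNodes.1 hw).1.le.trans hL
  have hsum := sum_haarStep_sq (by positivity) (block_le_sampleSize hL hw)
  rw [Finset.sum_range] at hsum
  calc
    _ = ∑ i : Fin (sampleSize Lmax), (2 : ℝ) ^ ((w.1 : ℝ) / 2) * 2 ^ ((w.1 : ℝ) / 2) *
        (haarStep (2 ^ (Lmax - w.1)) w.2 i * haarStep (2 ^ (Lmax - w.1)) w.2 i) :=
      Finset.sum_congr rfl fun i _ => by rw [haar_some_designPoint hl, mul_mul_mul_comm]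
    _ = sampleSize Lmax := by
      rw [← Finset.mul_sum, hsum, ← Real.rpow_add two_pos, add_halves, Real.rpow_natCast,
        sampleSize_eq hl]
      push_cast
      rfl

lemma sum_haar_mul_haar_of_level_eq (hL : L ≤ Lmax) (hw : w ∈ fullNodes L)
    (hl : v.1 = w.1) (hne : v ≠ w) :
    ∑ i, haar (some v) (designPoint (sampleSize Lmax) i) *
      haar (some w) (designPoint (sampleSize Lmax) i) = 0 := by
  have hk : v.2 ≠ w.2 := fun h => hne (Prod.ext hl h)
  have hlw : w.1 ≤ Lmax := (mem_fullNodes.1 hw).1.le.trans hL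
  refine Finset.sum_eq_zero fun i _ => ?_
  rw [haar_some_designPoint (hl.trans_le hlw), haar_some_designPoint hlw, hl,
    mul_mul_mul_comm, haarStep_mul_of_ne hk, mul_zero]

lemma sum_haar_mul_haar (hL : L ≤ Lmax) {u u' : Index} (hu : u ∈ fullIndices L)
    (hu' : u' ∈ fullIndices L) :
    ∑ i, haar u (designPoint (sampleSize Lmax) i) * haar u' (designPoint (sampleSize Lmax) i) =
      if u = u' then (sampleSize Lmax : ℝ) else 0 := by
  simp only [fullIndices, Finset.mem_insertNone] at hu hu'
  split_ifs with h
  · subst h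
    rcases u with _ | v
    · simp [haar_none_designPoint]
    · exact sum_haar_sq hL (hu v rfl)
  · rcases u with _ | v <;> rcases u' with _ | w
    · exact absurd rfl h
    · exact sum_haar_mul_haar_of_level_lt hL (hu' w rfl) (by simp)
    · simp_rw [mul_comm (haar (some v) _)]
      exact sum_haar_mul_haar_of_level_lt hL (hu v rfl) (by simp)
    · rcases lt_trichotomy v.1 w.1 with hl | hl | hl
      · exact sum_haar_mul_haar_of_level_lt hL (hu' w rfl) (by simpa using hl)
      · exact sum_haar_mul_haar_of_level_eq hL (hu' w rfl) hl (mt (congrArg some) h)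
      · simp_rw [mul_comm (haar (some v) _)]
        exact sum_haar_mul_haar_of_level_lt hL (hu v rfl) (by simpa using hl)

end Orthogonality

/-- The inner product of the data with a column of the full design. -/
noncomputable def haarCoef (n : ℕ) (Y : Fin n → ℝ) (v : Index) : ℝ :=
  ∑ i, haar v (designPoint n i) * Y i

lemma CartTree.int_subset (T : CartTree L) : T.int ⊆ fullIndices L := fun _ hv =>
  Finset.mem_insertNone.2 fun w hw => T.subset_full (Finset.mem_insertNone.1 hv w hw)

lemma haarCoef_add {n : ℕ} (Y Z : Fin n → ℝ) (v : Index) :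
    haarCoef n (Y + Z) v = haarCoef n Y v + haarCoef n Z v := by
  simp [haarCoef, mul_add, Finset.sum_add_distrib]

lemma design_transpose_mulVec {n : ℕ} (Y : Fin n → ℝ) (T : CartTree L) (v : T.int) :
    ((design n T)ᵀ *ᵥ Y) v = haarCoef n Y v := by
  simp [Matrix.mulVec, dotProduct, design, haarCoef]

lemma signalVec_dotProduct (n : ℕ) (B : Finset Index) (β : Index → ℝ) (Y : Fin n → ℝ) :
    signalVec n B β ⬝ᵥ Y = ∑ v ∈ B, β v * haarCoef n Y v := by
  simp only [dotProduct, signalVec, regFun, haarCoef, Finset.mul_sum, Finset.sum_mul]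
  rw [Finset.sum_comm]
  exact Finset.sum_congr rfl fun v _ => Finset.sum_congr rfl fun i _ => by ring

section Orthogonal

variable {Lmax : ℕ} {B : Finset Index}

lemma design_transpose_mul (hL : L ≤ Lmax) (T : CartTree L) :
    (design (sampleSize Lmax) T)ᵀ * design (sampleSize Lmax) T =
      (sampleSize Lmax : ℝ) • (1 : Matrix T.int T.int ℝ) := by
  ext v w
  simp only [Matrix.mul_apply, Matrix.transpose_apply, design, Matrix.smul_apply,
    Matrix.one_apply, smul_eq_mul, mul_ite, mul_one, mul_zero]
  rw [sum_haar_mul_haar hL (T.int_subset v.2) (T.int_subset w.2)]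
  simp only [Subtype.ext_iff]

lemma haarCoef_signalVec (hL : L ≤ Lmax) (hB : B ⊆ fullIndices L) (β : Index → ℝ) {v : Index}
    (hv : v ∈ fullIndices L) :
    haarCoef (sampleSize Lmax) (signalVec (sampleSize Lmax) B β) v =
      if v ∈ B then sampleSize Lmax * β v else 0 := by
  simp only [haarCoef, signalVec, regFun, Finset.mul_sum]
  rw [Finset.sum_comm]
  calc _ = ∑ w ∈ B, (if v = w then (sampleSize Lmax : ℝ) else 0) * β w := by
        refine Finset.sum_congr rfl fun w hw => ?_
        rw [← sum_haar_mul_haar hL hv (hB hw), Finset.sum_mul]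
        exact Finset.sum_congr rfl fun i _ => by ring
    _ = _ := by simp [ite_mul]

lemma signalVec_dotProduct_self (hL : L ≤ Lmax) (hB : B ⊆ fullIndices L) (β : Index → ℝ) :
    signalVec (sampleSize Lmax) B β ⬝ᵥ signalVec (sampleSize Lmax) B β =
      sampleSize Lmax * ∑ v ∈ B, β v ^ 2 := by
  rw [signalVec_dotProduct, Finset.mul_sum]
  refine Finset.sum_congr rfl fun v hv => ?_
  rw [haarCoef_signalVec hL hB β (hB hv), if_pos hv]
  ring

lemma norm_sq_design_transpose_mulVec_signalVec (hL : L ≤ Lmax) (hB : B ⊆ fullIndices L)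
    (β : Index → ℝ) (T : CartTree L) :
    (design (sampleSize Lmax) T)ᵀ *ᵥ signalVec (sampleSize Lmax) B β ⬝ᵥ
      (design (sampleSize Lmax) T)ᵀ *ᵥ signalVec (sampleSize Lmax) B β =
        (sampleSize Lmax : ℝ) ^ 2 * ∑ v ∈ B ∩ T.int, β v ^ 2 := by
  have hsum : (design (sampleSize Lmax) T)ᵀ *ᵥ signalVec (sampleSize Lmax) B β ⬝ᵥ
      (design (sampleSize Lmax) T)ᵀ *ᵥ signalVec (sampleSize Lmax) B β =
        ∑ v ∈ T.int, if v ∈ B then (sampleSize Lmax : ℝ) ^ 2 * β v ^ 2 else 0 := by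
    rw [← Finset.sum_coe_sort]
    refine Finset.sum_congr rfl fun v _ => ?_
    rw [design_transpose_mulVec, haarCoef_signalVec hL hB β (T.int_subset v.2)]
    split_ifs <;> ring
  rw [hsum, ← Finset.sum_filter, Finset.filter_mem_eq_inter, Finset.inter_comm, Finset.mul_sum]

lemma signalVec_dotProduct_residual (hL : L ≤ Lmax) (hB : B ⊆ fullIndices L) (β : Index → ℝ)
    (T : CartTree L) :
    signalVec (sampleSize Lmax) B β ⬝ᵥ ((1 - (1 / (sampleSize Lmax : ℝ)) •
      (design (sampleSize Lmax) T * (design (sampleSize Lmax) T)ᵀ)) *ᵥ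
        signalVec (sampleSize Lmax) B β) =
      sampleSize Lmax * ∑ v ∈ B \ T.int, β v ^ 2 := by
  have hn : (sampleSize Lmax : ℝ) ≠ 0 := by simp [sampleSize]
  rw [Matrix.sub_mulVec, Matrix.one_mulVec, dotProduct_sub, Matrix.smul_mulVec, dotProduct_smul,
    ← Matrix.mulVec_mulVec, Matrix.dotProduct_mulVec, ← Matrix.mulVec_transpose,
    signalVec_dotProduct_self hL hB, norm_sq_design_transpose_mulVec_signalVec hL hB,
    ← Finset.sum_inter_add_sum_sdiff B T.int fun v => β v ^ 2, smul_eq_mul]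
  field_simp
  ring

lemma drift₁_eq (hL : L ≤ Lmax) (hB : B ⊆ fullIndices L) (β : Index → ℝ) (C : ℝ)
    (T : CartTree L) :
    drift₁ (sampleSize Lmax) C (signalVec (sampleSize Lmax) B β) T =
      Real.exp (1 / (2 ^ L * C ^ 2) * ∑ v ∈ B \ T.int, β v ^ 2) := by
  have hn : (sampleSize Lmax : ℝ) ≠ 0 := by simp [sampleSize]
  rw [drift₁, signalVec_dotProduct_residual hL hB]
  congr 1
  field_simp

end Orthogonal

/-! ### The posterior -/

lemma integral_exp_quadratic_gaussianReal {a : ℝ} (ha : 0 < a + 1) (z : ℝ) :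
    ∫ b, Real.exp (b * z - a * b ^ 2 / 2) ∂(gaussianReal 0 1) =
      (√(a + 1))⁻¹ * Real.exp (z ^ 2 / (2 * (a + 1))) := by
  let w : NNReal := ⟨1 / (a + 1), by positivity⟩
  have hw : (w : ℝ) = 1 / (a + 1) := rfl
  have hw0 : w ≠ 0 := by
    rw [← NNReal.coe_ne_zero, hw]
    positivity
  have hsqrt : √(2 * Real.pi * (1 / (a + 1))) = √(2 * Real.pi) * (√(a + 1))⁻¹ := by
    rw [mul_one_div, Real.sqrt_div (by positivity), div_eq_mul_inv]
  have hdensity : ∀ b : ℝ, gaussianPDFReal 0 1 b • Real.exp (b * z - a * b ^ 2 / 2) =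
      ((√(a + 1))⁻¹ * Real.exp (z ^ 2 / (2 * (a + 1)))) * gaussianPDFReal (z / (a + 1)) w b := by
    intro b
    have hne : √(a + 1) ≠ 0 := (Real.sqrt_pos.2 ha).ne'
    simp only [gaussianPDFReal, smul_eq_mul, hw, NNReal.coe_one, mul_one, hsqrt, mul_inv, inv_inv]
    calc _ = (√(2 * Real.pi))⁻¹ *
          (Real.exp (-(b - 0) ^ 2 / 2) * Real.exp (b * z - a * b ^ 2 / 2)) := by ring
      _ = (√(2 * Real.pi))⁻¹ * (Real.exp (z ^ 2 / (2 * (a + 1))) *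
          Real.exp (-(b - z / (a + 1)) ^ 2 / (2 * (1 / (a + 1))))) := by
          rw [← Real.exp_add, ← Real.exp_add]
          congr 2
          field_simp
          ring
      _ = _ := by field_simp
  rw [integral_gaussianReal_eq_integral_smul one_ne_zero]
  simp_rw [hdensity]
  rw [integral_const_mul, integral_gaussianPDFReal_eq_one _ hw0, mul_one]

section MarginalLikelihood

variable {n : ℕ} {T : CartTree L}

lemma prod_gaussianPDFReal_design (h : (design n T)ᵀ * design n T = (n : ℝ) • 1)
    (Y : Fin n → ℝ) (b : T.int → ℝ) :
    ∏ i, gaussianPDFReal ((design n T *ᵥ b) i) 1 (Y i) =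
      ((√(2 * Real.pi))⁻¹ ^ n * Real.exp (-(Y ⬝ᵥ Y) / 2)) *
        ∏ v, Real.exp (b v * haarCoef n Y v - n * b v ^ 2 / 2) := by
  set X := design n T with hX
  have hsq : ∑ i, -(Y i - (X *ᵥ b) i) ^ 2 / 2 =
      -(Y ⬝ᵥ Y) / 2 + Y ⬝ᵥ (X *ᵥ b) - (X *ᵥ b) ⬝ᵥ (X *ᵥ b) / 2 := by
    simp only [dotProduct]
    rw [← Finset.sum_neg_distrib, Finset.sum_div, Finset.sum_div, ← Finset.sum_add_distrib,
      ← Finset.sum_sub_distrib]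
    exact Finset.sum_congr rfl fun i _ => by ring
  have hcross : Y ⬝ᵥ (X *ᵥ b) = ∑ v, b v * haarCoef n Y v := by
    rw [Matrix.dotProduct_mulVec, ← Matrix.mulVec_transpose, dotProduct]
    exact Finset.sum_congr rfl fun v _ => by rw [hX, design_transpose_mulVec]; ring
  have hnorm : (X *ᵥ b) ⬝ᵥ (X *ᵥ b) = n * ∑ v, b v ^ 2 := by
    rw [Matrix.dotProduct_mulVec, ← Matrix.mulVec_transpose, Matrix.mulVec_mulVec, h,
      Matrix.smul_mulVec, Matrix.one_mulVec, smul_dotProduct, smul_eq_mul, dotProduct]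
    simp only [sq]
  simp only [gaussianPDFReal, NNReal.coe_one, mul_one]
  rw [Finset.prod_mul_distrib, Finset.prod_const, Finset.card_univ, Fintype.card_fin, mul_assoc,
    ← Real.exp_sum, ← Real.exp_sum, ← Real.exp_add, hsq, hcross, hnorm, Finset.sum_sub_distrib,
    add_sub_assoc, Finset.mul_sum, Finset.sum_div]

lemma marginalLikelihood_eq (h : (design n T)ᵀ * design n T = (n : ℝ) • 1) (Y : Fin n → ℝ) :
    marginalLikelihood n Y T = ((√(2 * Real.pi))⁻¹ ^ n * Real.exp (-(Y ⬝ᵥ Y) / 2)) *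
      ∏ v ∈ T.int, ((√(n + 1))⁻¹ * Real.exp (haarCoef n Y v ^ 2 / (2 * (n + 1)))) := by
  rw [marginalLikelihood,
    integral_congr_ae (.of_forall (prod_gaussianPDFReal_design h Y)), integral_const_mul,
    integral_fintype_prod_eq_prod
      (f := fun (v : T.int) (b : ℝ) => Real.exp (b * haarCoef n Y v - n * b ^ 2 / 2)),
    ← Finset.prod_coe_sort T.int]
  congr 1
  exact Finset.prod_congr rfl fun v _ => integral_exp_quadratic_gaussianReal (by positivity) _

end MarginalLikelihood

/-- The factor by which the posterior weight of a tree changes when `v` is made internal. -/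
noncomputable def nodeWeight (n : ℕ) (c : ℝ) (Y : Fin n → ℝ) (v : Index) : ℝ :=
  (n : ℝ) ^ (-c) * (1 - (n : ℝ) ^ (-c)) * ((√(n + 1))⁻¹ *
    Real.exp (haarCoef n Y v ^ 2 / (2 * (n + 1))))

lemma CartTree.card_int (T : CartTree L) : T.int.card = T.1.card + 1 := by
  simp [CartTree.int, Finset.card_insertNone]

lemma CartTree.prod_int_sdiff {M : Type*} [CommMonoid M] (T T' : CartTree L) (f : Index → M) :
    ∏ v ∈ T'.int \ T.int, f v = ∏ v ∈ T'.1 \ T.1, f (some v) := by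
  have himage : T'.int \ T.int = (T'.1 \ T.1).image some := by
    ext (_ | v) <;> simp [CartTree.int]
  rw [himage, Finset.prod_image fun _ _ _ _ h => Option.some_injective _ h]

lemma CartTree.int_mono {T T' : CartTree L} (h : T ≤ T') : T.int ⊆ T'.int := by
  rintro (_ | v) hv
  · simp [CartTree.int]
  · exact Finset.some_mem_insertNone.2 (h (Finset.some_mem_insertNone.1 hv))

/-- The prior factors are `p` per internal and `1 - p` per external node; since there are as many
external as internal nodes, they can be paired into one factor per internal node. -/
lemma treePrior_eq (n : ℕ) (c : ℝ) (T : CartTree L) :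
    treePrior n c T = ∏ _v ∈ T.int, ((n : ℝ) ^ (-c) * (1 - (n : ℝ) ^ (-c))) := by
  rw [treePrior, Finset.prod_mul_distrib, Finset.prod_const (1 - (n : ℝ) ^ (-c)),
    Finset.prod_const (1 - (n : ℝ) ^ (-c)), T.card_ext, T.card_int]

lemma nodeWeight_pos {n : ℕ} (hn : 1 < n) {c : ℝ} (hc : 0 < c) (Y : Fin n → ℝ) (v : Index) :
    0 < nodeWeight n c Y v := by
  have hlt : (n : ℝ) ^ (-c) < 1 :=
    Real.rpow_lt_one_of_one_lt_of_neg (by exact_mod_cast hn) (neg_neg_of_pos hc)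
  have hn0 : (0 : ℝ) < n := by exact_mod_cast one_pos.trans hn
  exact mul_pos (mul_pos (Real.rpow_pos_of_pos hn0 _) (sub_pos.2 hlt)) (by positivity)

lemma one_lt_sampleSize (Lmax : ℕ) : 1 < sampleSize Lmax :=
  Nat.one_lt_two_pow (Nat.succ_ne_zero Lmax)

instance : Nonempty (CartTree L) :=
  ⟨⟨∅, mem_treeSets_of_closed (Finset.empty_subset _) (by simp)⟩⟩

section Posterior

variable {Lmax : ℕ} {c : ℝ} (Y : Fin (sampleSize Lmax) → ℝ)

lemma treePrior_mul_marginalLikelihood (hL : L ≤ Lmax) (T : CartTree L) :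
    treePrior (sampleSize Lmax) c T * marginalLikelihood (sampleSize Lmax) Y T =
      ((√(2 * Real.pi))⁻¹ ^ sampleSize Lmax * Real.exp (-(Y ⬝ᵥ Y) / 2)) *
      ∏ v ∈ T.int, nodeWeight (sampleSize Lmax) c Y v := by
  simp only [nodeWeight]
  rw [marginalLikelihood_eq (design_transpose_mul hL T), treePrior_eq, mul_left_comm,
    ← Finset.prod_mul_distrib]

lemma treeWeight_pos (hL : L ≤ Lmax) (hc : 0 < c) (T : CartTree L) :
    0 < treePrior (sampleSize Lmax) c T * marginalLikelihood (sampleSize Lmax) Y T := by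
  rw [treePrior_mul_marginalLikelihood Y hL]
  have := Finset.prod_pos fun v (_ : v ∈ T.int) => nodeWeight_pos (one_lt_sampleSize Lmax) hc Y v
  positivity

lemma sum_treeWeight_pos (hL : L ≤ Lmax) (hc : 0 < c) :
    0 < ∑ T : CartTree L,
      treePrior (sampleSize Lmax) c T * marginalLikelihood (sampleSize Lmax) Y T :=
  Finset.sum_pos (fun T _ => treeWeight_pos Y hL hc T) Finset.univ_nonempty

lemma posterior_pos (hL : L ≤ Lmax) (hc : 0 < c) (T : CartTree L) :
    0 < posterior (sampleSize Lmax) c Y T :=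
  div_pos (treeWeight_pos Y hL hc T) (sum_treeWeight_pos Y hL hc)

lemma sum_posterior (hL : L ≤ Lmax) (hc : 0 < c) :
    ∑ T : CartTree L, posterior (sampleSize Lmax) c Y T = 1 := by
  simp only [posterior]
  rw [← Finset.sum_div, div_self (sum_treeWeight_pos Y hL hc).ne']

lemma posterior_eq_mul_prod (hL : L ≤ Lmax) {T T' : CartTree L} (h : T ≤ T') :
    posterior (sampleSize Lmax) c Y T' = posterior (sampleSize Lmax) c Y T *
      ∏ v ∈ T'.1 \ T.1, nodeWeight (sampleSize Lmax) c Y (some v) := by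
  simp only [posterior, treePrior_mul_marginalLikelihood Y hL]
  rw [← Finset.prod_sdiff (CartTree.int_mono h), CartTree.prod_int_sdiff]
  ring

end Posterior

/-! ### The noise event -/

instance (n : ℕ) : IsProbabilityMeasure (noiseLaw n) := by
  unfold noiseLaw
  infer_instance

lemma hasSubgaussianMGF_mul_gaussianReal (a : ℝ) :
    HasSubgaussianMGF (fun x => a * x) (a ^ 2).toNNReal (gaussianReal 0 1) where
  integrable_exp_mul t := by
    have := integrable_exp_mul_gaussianReal (μ := 0) (v := 1) (t * a)
    simpa only [mul_assoc] using this
  mgf_le t := by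
    have h : mgf (fun x => a * x) (gaussianReal 0 1) t = mgf id (gaussianReal 0 1) (a * t) :=
      mgf_const_mul (X := id) a
    rw [h, mgf_id_gaussianReal, Real.coe_toNNReal _ (sq_nonneg a)]
    simp [mul_pow]

lemma hasSubgaussianMGF_sum_noise {n : ℕ} (a : Fin n → ℝ) :
    HasSubgaussianMGF (fun ω : Fin n → ℝ => ∑ i, a i * ω i)
      (∑ i, (a i ^ 2).toNNReal) (noiseLaw n) := by
  refine HasSubgaussianMGF.sum_of_iIndepFun (X := fun i (ω : Fin n → ℝ) => a i * ω i) ?_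
    fun i _ => ?_
  · exact iIndepFun_pi (X := fun i x => a i * x) fun i => by fun_prop
  · refine HasSubgaussianMGF.of_map (Y := fun ω : Fin n → ℝ => ω i) (X := fun x => a i * x)
      (measurable_pi_apply i).aemeasurable ?_
    rw [noiseLaw, (measurePreserving_eval (fun _ : Fin n => gaussianReal 0 1) i).map_eq]
    exact hasSubgaussianMGF_mul_gaussianReal (a i)

lemma noiseLaw_lt_abs_sum_le {n : ℕ} (a : Fin n → ℝ) {t : ℝ} (ht : 0 ≤ t) :
    (noiseLaw n).real {ω | t < |∑ i, a i * ω i|} ≤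
      2 * Real.exp (-t ^ 2 / (2 * ∑ i, a i ^ 2)) := by
  have hσ : ((∑ i, (a i ^ 2).toNNReal : NNReal) : ℝ) = ∑ i, a i ^ 2 := by
    rw [NNReal.coe_sum]
    exact Finset.sum_congr rfl fun i _ => Real.coe_toNNReal _ (sq_nonneg _)
  have hsubgaussian := hasSubgaussianMGF_sum_noise a
  have hright := hsubgaussian.measure_ge_le ht
  have hleft := hsubgaussian.neg.measure_ge_le ht
  rw [hσ] at hright hleft
  have hsub : {ω : Fin n → ℝ | t < |∑ i, a i * ω i|} ⊆
      {ω | t ≤ ∑ i, a i * ω i} ∪ {ω | t ≤ (-fun ω : Fin n → ℝ => ∑ i, a i * ω i) ω} :=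
    fun ω hω => (lt_abs.1 (Set.mem_ofPred_eq ▸ hω)).imp le_of_lt le_of_lt
  calc _ ≤ _ := measureReal_mono hsub
    _ ≤ _ := measureReal_union_le _ _
    _ ≤ _ := by linarith

lemma noiseLaw_exists_lt_abs_sum_le {ι : Type*} {n : ℕ} {s : Finset ι} {a : ι → Fin n → ℝ}
    {σ t : ℝ} (hσ : ∀ v ∈ s, ∑ i, a v i ^ 2 = σ) (ht : 0 ≤ t) :
    (noiseLaw n).real {ω | ∃ v ∈ s, t < |∑ i, a v i * ω i|} ≤
      s.card * (2 * Real.exp (-t ^ 2 / (2 * σ))) := by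
  have hUnion : {ω : Fin n → ℝ | ∃ v ∈ s, t < |∑ i, a v i * ω i|} =
      ⋃ v ∈ s, {ω : Fin n → ℝ | t < |∑ i, a v i * ω i|} := by
    ext ω
    simp
  rw [hUnion, ← nsmul_eq_mul]
  refine (measureReal_biUnion_finset_le _ _).trans (Finset.sum_le_card_nsmul _ _ _ fun v hv => ?_)
  exact (noiseLaw_lt_abs_sum_le (a v) ht).trans_eq (by rw [hσ v hv])

/-- The event that no inner product of the noise with a column of the full design is large. -/
def noiseEvent (n L : ℕ) : Set (Fin n → ℝ) :=
  {ω | ∀ v ∈ fullIndices L, |haarCoef n ω v| ≤ √(2 * n * Real.log (n ^ 2 / 4))}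

lemma measurableSet_noiseEvent (n L : ℕ) : MeasurableSet (noiseEvent n L) := by
  have hInter : noiseEvent n L = ⋂ v ∈ fullIndices L,
      {ω | |haarCoef n ω v| ≤ √(2 * n * Real.log (n ^ 2 / 4))} := by
    ext ω
    simp [noiseEvent]
  rw [hInter]
  refine Finset.measurableSet_biInter _ fun v _ => measurableSet_le ?_ measurable_const
  unfold haarCoef
  fun_prop

lemma card_fullIndices (L : ℕ) : (fullIndices L).card = 2 ^ L := by
  rw [fullIndices, Finset.card_insertNone, card_fullNodes]

lemma two_pow_le_sampleSize {Lmax : ℕ} (hL : L ≤ Lmax) : 2 ^ (L + 1) ≤ sampleSize Lmax :=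
  Nat.pow_le_pow_right (by norm_num) (by omega)

lemma noiseLaw_noiseEvent {Lmax n : ℕ} (hL : L ≤ Lmax) (hn : n = sampleSize Lmax) :
    1 - 4 / (n : ℝ) ≤ (noiseLaw n).real (noiseEvent n L) := by
  have hn2 : (2 : ℝ) ≤ n := by exact_mod_cast hn ▸ one_lt_sampleSize Lmax
  have hpow : (2 : ℝ) ^ L * 2 ≤ n := by exact_mod_cast hn ▸ two_pow_le_sampleSize hL
  set t := √(2 * n * Real.log ((n : ℝ) ^ 2 / 4)) with ht
  have hlog : 0 ≤ Real.log ((n : ℝ) ^ 2 / 4) := Real.log_nonneg (by nlinarith)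
  have hexp : Real.exp (-t ^ 2 / (2 * n)) = 4 / n ^ 2 := by
    rw [ht, Real.sq_sqrt (by positivity), neg_div, mul_div_cancel_left₀ _ (by positivity),
      Real.exp_neg, Real.exp_log (by positivity), inv_div]
  have hnorm : ∀ v ∈ fullIndices L, ∑ i, haar v (designPoint n i) ^ 2 = n := fun v hv => by
    subst hn
    simpa only [sq, if_true] using sum_haar_mul_haar hL hv hv
  have hcompl : (noiseEvent n L)ᶜ =
      {ω | ∃ v ∈ fullIndices L, t < |∑ i, haar v (designPoint n i) * ω i|} := by
    ext ω
    simp [noiseEvent, haarCoef, ht]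
  have hprob : (noiseLaw n).real (noiseEvent n L)ᶜ ≤ 4 / n :=
    calc _ ≤ (2 : ℝ) ^ L * (2 * (4 / n ^ 2)) := by
          have := noiseLaw_exists_lt_abs_sum_le hnorm (Real.sqrt_nonneg _ : 0 ≤ t)
          rwa [← hcompl, hexp, card_fullIndices, Nat.cast_pow, Nat.cast_two] at this
      _ = 2 ^ L * 2 * (4 / n ^ 2) := by ring
      _ ≤ n * (4 / n ^ 2) := by gcongr
      _ = 4 / n := by field_simp
  rw [probReal_compl_eq_one_sub (measurableSet_noiseEvent n L)] at hprob
  linarith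

/-! ### Node weights on the noise event -/

section Weights

variable {n : ℕ} {c : ℝ}

/-- The upper bound for the weight of a node outside the signal on the noise event. -/
noncomputable def noiseWeight (n : ℕ) (c : ℝ) : ℝ := (n : ℝ) ^ (-(c - 3 / 2)) / 4

/-- The lower bound on the noise event for the product of the weights of the nodes of a path that
meets the signal. -/
noncomputable def signalWeight (n : ℕ) (A : ℝ) : ℝ := (n : ℝ) ^ (A ^ 2 / 8 * Real.log n)

lemma nodeWeight_le_of_abs_haarCoef_le (hn : 2 ≤ n) {Y : Fin n → ℝ} {v : Index}
    (h : |haarCoef n Y v| ≤ √(2 * n * Real.log (n ^ 2 / 4))) :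
    nodeWeight n c Y v ≤ noiseWeight n c := by
  have hn' : (2 : ℝ) ≤ n := by exact_mod_cast hn
  have hn0 : (0 : ℝ) < n := by linarith
  have hlog : 0 ≤ Real.log ((n : ℝ) ^ 2 / 4) := Real.log_nonneg (by nlinarith)
  have hsq : haarCoef n Y v ^ 2 ≤ 2 * n * Real.log ((n : ℝ) ^ 2 / 4) :=
    Real.sq_le (by positivity) |>.2 (abs_le.1 h)
  have hexp : Real.exp (haarCoef n Y v ^ 2 / (2 * (n + 1))) ≤ (n : ℝ) ^ 2 / 4 := by
    rw [← Real.le_log_iff_exp_le (by positivity), div_le_iff₀ (by positivity)]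
    nlinarith
  have hsqrt : (√((n : ℝ) + 1))⁻¹ ≤ (n : ℝ) ^ (-(1 / 2) : ℝ) := by
    rw [Real.rpow_neg hn0.le, ← Real.sqrt_eq_rpow]
    exact inv_anti₀ (Real.sqrt_pos.2 hn0) (Real.sqrt_le_sqrt (by linarith))
  have hp := Real.rpow_pos_of_pos hn0 (-c)
  calc nodeWeight n c Y v ≤ (n : ℝ) ^ (-c) * ((n : ℝ) ^ (-(1 / 2) : ℝ) * ((n : ℝ) ^ 2 / 4)) := by
        unfold nodeWeight
        gcongr
        nlinarith
    _ = ((n : ℝ) ^ (-c) * (n : ℝ) ^ (-(1 / 2) : ℝ) * (n : ℝ) ^ (2 : ℝ)) / 4 := by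
        rw [Real.rpow_two]
        ring
    _ = _ := by
        rw [← Real.rpow_add hn0, ← Real.rpow_add hn0]
        congr 2
        ring

lemma le_nodeWeight (hn : 2 ≤ n) (hc : 1 ≤ c) (Y : Fin n → ℝ) (v : Index) :
    (n : ℝ) ^ (-(c + 2)) * Real.exp (haarCoef n Y v ^ 2 / (2 * (n + 1))) ≤ nodeWeight n c Y v := by
  have hn' : (2 : ℝ) ≤ n := by exact_mod_cast hn
  have hn0 : (0 : ℝ) < n := by linarith
  have hp := Real.rpow_pos_of_pos hn0 (-c)
  have hext : (1 / 2 : ℝ) ≤ 1 - (n : ℝ) ^ (-c) := by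
    have : (n : ℝ) ^ (-c) ≤ 1 / 2 :=
      calc (n : ℝ) ^ (-c) ≤ (n : ℝ) ^ (-1 : ℝ) :=
            Real.rpow_le_rpow_of_exponent_le (by linarith) (by linarith)
        _ = 1 / n := by rw [Real.rpow_neg_one, one_div]
        _ ≤ 1 / 2 := by gcongr
    linarith
  have hsqrt : 1 / (n : ℝ) ≤ (√((n : ℝ) + 1))⁻¹ := by
    rw [one_div]
    refine inv_anti₀ (Real.sqrt_pos.2 (by linarith)) ?_
    rw [Real.sqrt_le_left hn0.le]
    nlinarith
  have hpow : (n : ℝ) ^ (-(c + 2)) = (n : ℝ) ^ (-c) * (1 / n * (1 / n)) := by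
    rw [neg_add, Real.rpow_add hn0, Real.rpow_neg hn0.le 2, Real.rpow_two, one_div_mul_one_div,
      one_div, sq]
  unfold nodeWeight
  calc _ ≤ (n : ℝ) ^ (-c) * (1 / 2 * (1 / n)) *
        Real.exp (haarCoef n Y v ^ 2 / (2 * (n + 1))) := by
        rw [hpow]
        gcongr
    _ ≤ (n : ℝ) ^ (-c) * ((1 - (n : ℝ) ^ (-c)) * (√((n : ℝ) + 1))⁻¹) *
        Real.exp (haarCoef n Y v ^ 2 / (2 * (n + 1))) := by gcongr
    _ = _ := by ring

lemma rpow_neg_le_nodeWeight (hn : 2 ≤ n) (hc : 1 ≤ c) (Y : Fin n → ℝ) (v : Index) :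
    (n : ℝ) ^ (-(c + 2)) ≤ nodeWeight n c Y v :=
  (le_mul_of_one_le_right (by positivity) (Real.one_le_exp (by positivity))).trans
    (le_nodeWeight hn hc Y v)

lemma one_le_log_natCast (hn : 3 ≤ n) : 1 ≤ Real.log n := by
  have hn' : (3 : ℝ) ≤ n := by exact_mod_cast hn
  rw [Real.le_log_iff_exp_le (by linarith)]
  linarith [Real.exp_one_lt_three]

lemma abs_le_two_mul_log_mul_sqrt (hn : 3 ≤ n) {x : ℝ}
    (hx : |x| ≤ √(2 * n * Real.log (n ^ 2 / 4))) : |x| ≤ 2 * Real.log n * √n := by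
  have hn0 : (0 : ℝ) < n := by positivity
  have hlog := one_le_log_natCast hn
  have hle : Real.log ((n : ℝ) ^ 2 / 4) ≤ 2 * Real.log n :=
    calc Real.log ((n : ℝ) ^ 2 / 4) ≤ Real.log ((n : ℝ) ^ 2) :=
          Real.log_le_log (by positivity) (div_le_self (sq_nonneg _) (by norm_num))
      _ = 2 * Real.log n := by rw [Real.log_pow, Nat.cast_two]
  refine hx.trans ?_
  rw [Real.sqrt_le_left (by positivity), mul_pow, Real.sq_sqrt hn0.le]
  nlinarith [mul_le_mul_of_nonneg_left hle hn0.le, mul_le_mul_of_nonneg_left hlog hn0.le]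

lemma sq_log_le_of_signal (hn : 8 ≤ n) {A b z x : ℝ} (hA : 8 ≤ A)
    (hb : A * Real.log n / √n < |b|) (hx : |x| ≤ √(2 * n * Real.log (n ^ 2 / 4)))
    (hz : z = n * b + x) : A ^ 2 * Real.log n ^ 2 / 4 ≤ z ^ 2 / (2 * (n + 1)) := by
  have hn' : (8 : ℝ) ≤ n := by exact_mod_cast hn
  have hn0 : (0 : ℝ) < n := by linarith
  have hs0 : 0 < √(n : ℝ) := Real.sqrt_pos.2 hn0
  have hlog := one_le_log_natCast (n := n) (by omega)
  have hnoise : |x| ≤ A / 4 * Real.log n * √n :=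
    (abs_le_two_mul_log_mul_sqrt (by omega) hx).trans (by gcongr; linarith)
  set l := Real.log (n : ℝ)
  have hsn : √(n : ℝ) ^ 2 = n := Real.sq_sqrt hn0.le
  have hsignal : A * l * √n ≤ n * |b| := by
    rw [div_lt_iff₀ hs0] at hb
    calc A * l * √n ≤ |b| * √n * √n := mul_le_mul_of_nonneg_right hb.le hs0.le
      _ = n * |b| := by rw [mul_assoc, ← sq, hsn, mul_comm]
  have habs : n * |b| - |x| ≤ |z| := by
    have := abs_sub_abs_le_abs_sub (n * b) (-x)
    rwa [abs_neg, abs_mul, abs_of_pos hn0, sub_neg_eq_add, ← hz] at this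
  have hsq : (3 / 4 * A * l * √n) ^ 2 ≤ z ^ 2 := by
    rw [← sq_abs z]
    exact pow_le_pow_left₀ (by positivity) (by linarith) 2
  rw [mul_pow, hsn] at hsq
  rw [le_div_iff₀ (by positivity)]
  refine le_trans ?_ hsq
  nlinarith [show 0 ≤ A ^ 2 * l ^ 2 by positivity]

lemma natCast_le_two_mul_log_of_two_pow_le (h : 2 ^ (L + 1) ≤ n) : (L : ℝ) ≤ 2 * Real.log n := by
  have hlog : ((L : ℝ) + 1) * Real.log 2 ≤ Real.log n := by
    have : Real.log ((2 : ℝ) ^ (L + 1)) ≤ Real.log n :=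
      Real.log_le_log (by positivity) (by exact_mod_cast h)
    rw [Real.log_pow] at this
    exact_mod_cast this
  nlinarith [Real.log_two_gt_d9, (Nat.cast_nonneg L : (0 : ℝ) ≤ L)]

lemma pow_mul_le_prod {ι : Type*} {R : Finset ι} {f : ι → ℝ} {q x : ℝ} {m : ℕ}
    (hq : 0 ≤ q) (hq' : q ≤ 1) (hx : 0 ≤ x) (hf : ∀ w ∈ R, q ≤ f w) (hR : R.card ≤ m)
    {v : ι} (hv : v ∈ R) (hfv : q * x ≤ f v) : q ^ m * x ≤ ∏ w ∈ R, f w := by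
  classical
  calc q ^ m * x ≤ q ^ R.card * x :=
        mul_le_mul_of_nonneg_right (pow_le_pow_of_le_one hq hq' hR) hx
    _ = (∏ _w ∈ R.erase v, q) * (q * x) := by
        rw [Finset.prod_const, ← Finset.card_erase_add_one hv, pow_succ, mul_assoc]
    _ ≤ (∏ w ∈ R.erase v, f w) * f v := by
        have hf' : ∀ w ∈ R.erase v, q ≤ f w := fun w hw => hf w (Finset.mem_of_mem_erase hw)
        exact mul_le_mul (Finset.prod_le_prod (fun _ _ => hq) hf') hfv (mul_nonneg hq hx)
          (Finset.prod_nonneg fun w hw => hq.trans (hf' w hw))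
    _ = _ := Finset.prod_erase_mul _ _ hv

/-- The at most `L` factors are no smaller than `n ^ (-(c + 2))`, whose `L`-th power is
`exp (-O(log² n))`; the single signal node has weight `exp ((A² / 4) log² n)`, which dominates. -/
lemma le_prod_nodeWeight (hn : 3 ≤ n) (hLn : 2 ^ (L + 1) ≤ n) (hc : 1 ≤ c) {A : ℝ}
    (hA : 4 * (c + 3) ≤ A) {Y : Fin n → ℝ} {R : Finset Node}
    (hR : R.card ≤ L) {v : Node} (hv : v ∈ R)
    (hz : A ^ 2 * Real.log n ^ 2 / 4 ≤ haarCoef n Y (some v) ^ 2 / (2 * (n + 1))) :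
    signalWeight n A ≤ ∏ w ∈ R, nodeWeight n c Y (some w) := by
  have hn0 : (0 : ℝ) < n := by positivity
  have hn1 : (1 : ℝ) ≤ n := by exact_mod_cast (by omega : 1 ≤ n)
  have hlog := one_le_log_natCast hn
  have hL := natCast_le_two_mul_log_of_two_pow_le hLn
  have hsignal : (n : ℝ) ^ (-(c + 2)) * (n : ℝ) ^ (A ^ 2 / 4 * Real.log n) ≤
      nodeWeight n c Y (some v) := by
    refine le_trans (mul_le_mul_of_nonneg_left ?_ (by positivity)) (le_nodeWeight (by omega) hc Y _)
    rw [Real.rpow_def_of_pos hn0 (A ^ 2 / 4 * _)]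
    refine Real.exp_le_exp.2 (le_trans (le_of_eq ?_) hz)
    ring
  set l := Real.log (n : ℝ)
  calc (n : ℝ) ^ (A ^ 2 / 8 * l) ≤ (n : ℝ) ^ (-(c + 2) * L + A ^ 2 / 4 * l) := by
        refine Real.rpow_le_rpow_of_exponent_le hn1 ?_
        have hA2 : 16 * (c + 3) ^ 2 ≤ A ^ 2 := by nlinarith
        have hdepth : (c + 2) * L ≤ (c + 2) * (2 * l) :=
          mul_le_mul_of_nonneg_left hL (by linarith)
        have hgain : 2 * (c + 3) * l ≤ A ^ 2 / 8 * l :=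
          mul_le_mul_of_nonneg_right (by nlinarith) (by linarith)
        linarith
    _ = ((n : ℝ) ^ (-(c + 2))) ^ L * (n : ℝ) ^ (A ^ 2 / 4 * l) := by
        rw [Real.rpow_add hn0, Real.rpow_mul hn0.le, Real.rpow_natCast]
    _ ≤ _ := pow_mul_le_prod (by positivity)
        (Real.rpow_le_one_of_one_le_of_nonpos hn1 (by linarith)) (by positivity)
        (fun w _ => rpow_neg_le_nodeWeight (by omega) hc Y _) hR hv hsignal

end Weights

/-! ### Concentrated posteriors -/

lemma Sampler.bigM_nonneg (s : Sampler) (L : ℕ) : 0 ≤ s.bigM L := by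
  cases s <;> simp [Sampler.bigM]

namespace Sampler.Step

variable {s : Sampler} {T T' : CartTree L}

lemma lt (h : s.Step T T') : T < T' := by
  obtain ⟨e, v, h, -⟩ := h
  exact h.lt

lemma card_sdiff_le (h : s.Step T T') : (T'.1 \ T.1).card ≤ L := by
  obtain ⟨e, v, h, -⟩ := h
  exact h.card_sdiff_le

lemma card_sdiff_le_bigM (h : s.Step T T') : ((T'.1 \ T.1).card : ℝ) ≤ s.bigM L := by
  cases s with
  | bayesianCART =>
    obtain ⟨e, v, h, he⟩ := h
    obtain rfl := he rfl
    rw [h.sdiff_eq, twig_self, Finset.card_singleton, Nat.cast_one, Sampler.bigM]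
  | twiggy D =>
    have hcard : ((T'.1 \ T.1).card : ℝ) ≤ L := Nat.cast_le.2 h.card_sdiff_le
    rw [Sampler.bigM]
    linarith [L.cast_nonneg (α := ℝ)]

end Sampler.Step

/-- The move from `T` to `T'` loses a part of the signal: a node of `B` is internal in `T` but not
in `T'`. -/
def Loses (B : Finset Index) (T T' : CartTree L) : Prop := ∃ v ∈ T.1, v ∉ T'.1 ∧ some v ∈ B

/-- The situation on the noise event. The target `π` of the sampler `s` is a distribution on the
trees that changes by the factor `ρ v` when the node `v` becomes internal. The factors are at most
`q` outside the signal `B`, and their product over the nodes of a path that meets the signal is at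
least `Q`; a path enters only through its number of nodes, which is at most `L`. -/
structure Concentrated (s : Sampler) (q Q : ℝ) (B : Finset Index) (Ts : CartTree L)
    (π : CartTree L → ℝ) (ρ : Node → ℝ) : Prop where
  valid : s.Valid
  subset : B ⊆ fullIndices L
  isLeast : IsLeast {T : CartTree L | B ⊆ T.int} Ts
  connected : s = Sampler.bayesianCART → Ts.int = insert none B
  pos : ∀ T, 0 < π T
  sum_eq : ∑ T, π T = 1
  factor_pos : ∀ v, 0 < ρ v
  factor : ∀ T T', T ≤ T' → π T' = π T * ∏ v ∈ T'.1 \ T.1, ρ v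
  factor_le : ∀ v ∈ fullNodes L, some v ∉ B → ρ v ≤ q
  le_prod : ∀ R ⊆ fullNodes L, R.card ≤ L → (∃ v ∈ R, some v ∈ B) → Q ≤ ∏ v ∈ R, ρ v
  small_pos : 0 < q
  small_le_one : q ≤ 1
  small_le_delta : q ≤ s.delta L
  two_pow_le_large : 2 ^ (L + 1) ≤ Q

namespace Concentrated

variable {s : Sampler} {q Q : ℝ} {B : Finset Index} {Ts T T' : CartTree L} {π : CartTree L → ℝ}
  {ρ : Node → ℝ}

lemma large_pos (h : Concentrated s q Q B Ts π ρ) : 0 < Q :=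
  lt_of_lt_of_le (by positivity) h.two_pow_le_large

lemma delta_pos (h : Concentrated s q Q B Ts π ρ) : 0 < s.delta L :=
  h.small_pos.trans_le h.small_le_delta

lemma le_iff (h : Concentrated s q Q B Ts π ρ) : Ts ≤ T ↔ ∀ v, some v ∈ B → v ∈ T.1 := by
  refine ⟨fun hT v hv => hT (Finset.some_mem_insertNone.1 (h.isLeast.1 hv)),
    fun hT => h.isLeast.2 ?_⟩
  rintro (_ | v) hv
  · exact Finset.none_mem_insertNone
  · exact Finset.some_mem_insertNone.2 (hT v hv)

lemma loses_of_not_le (h : Concentrated s q Q B Ts π ρ) (hT : Ts ≤ T) (hT' : ¬ Ts ≤ T') :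
    Loses B T T' := by
  rw [h.le_iff] at hT hT'
  push Not at hT'
  obtain ⟨v, hv, hv'⟩ := hT'
  exact ⟨v, hT v hv, hv', hv⟩

lemma mem_rowStochastic (h : Concentrated s q Q B Ts π ρ) :
    metropolisHastings s.proposal π ∈ Matrix.rowStochastic ℝ (CartTree L) :=
  metropolisHastings_mem_rowStochastic (s.proposal_nonneg h.valid) (s.sum_proposal_le h.valid)
    h.pos

lemma step_of_ne_zero (h : Concentrated s q Q B Ts π ρ) (hne : T' ≠ T)
    (h0 : metropolisHastings s.proposal π T T' ≠ 0) : s.Step T T' ∨ s.Step T' T := by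
  refine Sampler.step_of_proposal_ne_zero fun hS => h0 ?_
  rw [metropolisHastings_of_ne (s.proposal_nonneg h.valid) h.pos hne, hS, min_eq_left]
  exact mul_nonneg (div_nonneg (h.pos _).le (h.pos _).le) (s.proposal_nonneg h.valid _ _)

lemma apply_le_ratio (h : Concentrated s q Q B Ts π ρ) (hne : T' ≠ T) :
    metropolisHastings s.proposal π T T' ≤ π T' / π T := by
  rw [metropolisHastings_of_ne (s.proposal_nonneg h.valid) h.pos hne]
  exact (min_le_right _ _).trans (mul_le_of_le_one_right (div_nonneg (h.pos _).le (h.pos _).le)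
    (s.proposal_le_one h.valid _ _))

lemma ratio_up (h : Concentrated s q Q B Ts π ρ) (hT : T ≤ T') :
    π T' / π T = ∏ v ∈ T'.1 \ T.1, ρ v := by
  rw [h.factor _ _ hT, mul_div_cancel_left₀ _ (h.pos T).ne']

lemma ratio_down (h : Concentrated s q Q B Ts π ρ) (hT : T ≤ T') :
    π T / π T' = (∏ v ∈ T'.1 \ T.1, ρ v)⁻¹ := by
  rw [← h.ratio_up hT, inv_div]

lemma large_le_prod_of_step (h : Concentrated s q Q B Ts π ρ) (hs : s.Step T T') {v : Node}
    (hvB : some v ∈ B) (hv : v ∉ T.1) (hv' : v ∈ T'.1) : Q ≤ ∏ w ∈ T'.1 \ T.1, ρ w :=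
  h.le_prod _ (Finset.sdiff_subset.trans T'.subset_full) hs.card_sdiff_le
    ⟨v, Finset.mem_sdiff.2 ⟨hv', hv⟩, hvB⟩

lemma prod_le_small (h : Concentrated s q Q B Ts π ρ) (hT : Ts ≤ T) (hlt : T < T') :
    ∏ v ∈ T'.1 \ T.1, ρ v ≤ q := by
  have hle : ∀ v ∈ T'.1 \ T.1, ρ v ≤ q := fun v hv =>
    h.factor_le v (T'.subset_full (Finset.mem_sdiff.1 hv).1) fun hvB =>
      (Finset.mem_sdiff.1 hv).2 (h.le_iff.1 hT v hvB)
  obtain ⟨v, hv⟩ : (T'.1 \ T.1).Nonempty := Finset.sdiff_nonempty.2 hlt.not_ge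
  rw [← Finset.mul_prod_erase _ _ hv]
  refine (mul_le_of_le_one_right (h.factor_pos v).le ?_).trans (hle v hv)
  exact Finset.prod_le_one (fun w _ => (h.factor_pos w).le) fun w hw =>
    (hle w (Finset.mem_of_mem_erase hw)).trans h.small_le_one

lemma apply_le_inv_large_of_loses (h : Concentrated s q Q B Ts π ρ) (hl : Loses B T T')
    (h0 : metropolisHastings s.proposal π T T' ≠ 0) :
    s.Step T' T ∧ metropolisHastings s.proposal π T T' ≤ Q⁻¹ := by
  obtain ⟨v, hv, hv', hvB⟩ := hl
  have hne : T' ≠ T := fun heq => hv' (heq ▸ hv)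
  have hs : s.Step T' T := (h.step_of_ne_zero hne h0).resolve_left fun hs => hv' (hs.lt.le hv)
  refine ⟨hs, (h.apply_le_ratio hne).trans ?_⟩
  rw [h.ratio_down hs.lt.le]
  exact inv_anti₀ h.large_pos (h.large_le_prod_of_step hs hvB hv' hv)

open Classical in
lemma sum_loses_le (h : Concentrated s q Q B Ts π ρ) (T : CartTree L) :
    ∑ T' with Loses B T T', metropolisHastings s.proposal π T T' ≤ 2 ^ L / Q := by
  have hQ : 0 ≤ Q⁻¹ := (inv_pos.2 h.large_pos).le
  rw [← Finset.sum_filter_ne_zero, Finset.filter_filter]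
  refine (Finset.sum_le_card_nsmul _ _ Q⁻¹ fun T' hT' => ?_).trans ?_
  · obtain ⟨hl, h0⟩ := (Finset.mem_filter.1 hT').2
    exact (h.apply_le_inv_large_of_loses hl h0).2
  · rw [nsmul_eq_mul, div_eq_mul_inv]
    refine mul_le_mul_of_nonneg_right ?_ hQ
    exact_mod_cast (Finset.card_le_card (Finset.monotone_filter_right _
      fun T' _ (hT' : Loses B T T' ∧ _ ≠ _) =>
        (h.apply_le_inv_large_of_loses hT'.1 hT'.2).1)).trans (card_step_down_le s T)

open Classical in
lemma sum_step_le (h : Concentrated s q Q B Ts π ρ) (hT : Ts ≤ T) :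
    ∑ T' with s.Step T T', metropolisHastings s.proposal π T T' ≤ 2 ^ L * q := by
  refine (Finset.sum_le_card_nsmul _ _ q fun T' hT' => ?_).trans ?_
  · have hlt := (Finset.mem_filter.1 hT').2.lt
    exact (h.apply_le_ratio hlt.ne').trans (h.ratio_up hlt.le ▸ h.prod_le_small hT hlt)
  · rw [nsmul_eq_mul]
    refine mul_le_mul_of_nonneg_right ?_ h.small_pos.le
    exact_mod_cast card_step_up_le s T

/- Twiggy GROW reaches a missing node of the signal at once; Bayesian CART makes only the external
node above it internal, which belongs to the signal because the signal is connected. -/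
lemma exists_step_gain (h : Concentrated s q Q B Ts π ρ) (hT : ¬ Ts ≤ T) :
    ∃ (T' : CartTree L) (v : Node), some v ∈ B ∧ v ∉ T.1 ∧ v ∈ T'.1 ∧ s.Step T T' := by
  rw [h.le_iff] at hT
  push Not at hT
  obtain ⟨v, hvB, hvT⟩ := hT
  have hfull : v ∈ fullNodes L := Finset.some_mem_insertNone.1 (h.subset hvB)
  obtain ⟨e, he, hev⟩ := T.exists_ext hfull hvT
  by_cases hs : s = .bayesianCART
  · have heB : some e ∈ B := by
      have hv : v ∈ Ts.1 := Finset.some_mem_insertNone.1 (h.isLeast.1 hvB)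
      have he : some e ∈ Ts.int := Finset.some_mem_insertNone.2 (Ts.closed hv hev)
      simpa [h.connected hs] using he
    obtain ⟨T', hT'⟩ := exists_isGrowth T he (hev.mem_fullNodes hfull) (IsAnc.refl e)
    exact ⟨T', e, heB, hT'.notMem hT'.anc, hT'.mem_top, e, e, hT', fun _ => rfl⟩
  · obtain ⟨T', hT'⟩ := exists_isGrowth T he hfull hev
    exact ⟨T', v, hvB, hvT, hT'.mem_bot, e, v, hT', fun h => absurd h hs⟩

lemma exists_grow (h : Concentrated s q Q B Ts π ρ) (hT : ¬ Ts ≤ T) :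
    ∃ (T' : CartTree L) (v : Node), some v ∈ B ∧ v ∉ T.1 ∧ v ∈ T'.1 ∧ T ≤ T' ∧
      s.delta L / 2 ^ (L + 1) ≤ metropolisHastings s.proposal π T T' := by
  obtain ⟨T', v, hvB, hvT, hvT', hs⟩ := h.exists_step_gain hT
  refine ⟨T', v, hvB, hvT, hvT', hs.lt.le, ?_⟩
  rw [metropolisHastings_of_ne (s.proposal_nonneg h.valid) h.pos hs.lt.ne', h.ratio_up hs.lt.le]
  refine (s.delta_le_proposal h.valid hs).trans
    (le_min le_rfl ((s.proposal_le_one h.valid _ _).trans ?_))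
  calc (1 : ℝ) = 2 ^ (L + 1) * (1 / 2 ^ (L + 1)) := (mul_one_div_cancel (by positivity)).symm
    _ ≤ _ := mul_le_mul (h.two_pow_le_large.trans (h.large_le_prod_of_step hs hvB hvT hvT'))
        (s.inv_le_proposal h.valid hs) (by positivity)
        (Finset.prod_nonneg fun w _ => (h.factor_pos w).le)

lemma exists_prune (h : Concentrated s q Q B Ts π ρ) (hT : Ts < T) :
    ∃ (T' : CartTree L) (v : Node), v ∉ T'.1 ∧ T.1 = insert v T'.1 ∧ Ts ≤ T' ∧
      1 / 2 ^ (L + 1) ≤ metropolisHastings s.proposal π T T' := by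
  obtain ⟨T', v, hTs, hv, hg⟩ := exists_isGrowth_of_lt hT
  have hs : s.Step T' T := ⟨v, v, hg, fun _ => rfl⟩
  refine ⟨T', v, hg.notMem (IsAnc.refl v), ?_, hTs, ?_⟩
  · rw [hg.eq, twig_self, Finset.union_comm, Finset.insert_eq]
  rw [metropolisHastings_of_ne (s.proposal_nonneg h.valid) h.pos hs.lt.ne, h.ratio_down hs.lt.le,
    hg.sdiff_eq, twig_self, Finset.prod_singleton]
  refine le_min (s.inv_le_proposal h.valid hs) ?_
  have hρ : ρ v ≤ s.delta L :=
    (h.factor_le v hg.full fun hvB => hv (h.le_iff.1 le_rfl v hvB)).trans h.small_le_delta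
  calc (1 : ℝ) / 2 ^ (L + 1) = (ρ v)⁻¹ * (ρ v / 2 ^ (L + 1)) := by
        rw [← mul_div_assoc, inv_mul_cancel₀ (h.factor_pos v).ne']
    _ ≤ (ρ v)⁻¹ * (s.delta L / 2 ^ (L + 1)) := by
        have := (h.factor_pos v).le
        gcongr
    _ ≤ _ := by
        have := (h.factor_pos v).le
        gcongr
        exact s.delta_le_proposal h.valid hs

end Concentrated

/-! ### The drift towards the signal -/

lemma half_le_one_sub_exp_neg {x : ℝ} (h₀ : 0 ≤ x) (h₁ : x ≤ 1) :
    x / 2 ≤ 1 - Real.exp (-x) := by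
  have hexp : Real.exp (-x) ≤ 1 / (x + 1) := by
    rw [Real.exp_neg, ← one_div]
    exact one_div_le_one_div_of_le (by linarith) (Real.add_one_le_exp x)
  have hx : x / 2 ≤ 1 - 1 / (x + 1) := by
    rw [le_sub_iff_add_le, ← le_sub_iff_add_le', div_le_iff₀ (by linarith)]
    nlinarith
  linarith

lemma exp_sub_one_le_two_mul {x : ℝ} (h₀ : 0 ≤ x) (h₁ : x ≤ 1) : Real.exp x - 1 ≤ 2 * x := by
  have habs := Real.abs_exp_sub_one_le (x := x) (by rwa [abs_of_nonneg h₀])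
  rw [abs_of_nonneg h₀] at habs
  exact (le_abs_self _).trans habs

/-- The first drift function in terms of the coefficients: the exponential of the energy of the
signal that the tree misses. -/
noncomputable def missingEnergy (κ : ℝ) (B : Finset Index) (β : Index → ℝ) (T : CartTree L) : ℝ :=
  Real.exp (κ * ∑ v ∈ B \ T.int, β v ^ 2)

section MissingEnergy

variable {B : Finset Index} {β : Index → ℝ} {κ : ℝ} {T T' : CartTree L}

lemma one_le_missingEnergy (hκ : 0 ≤ κ) (T : CartTree L) : 1 ≤ missingEnergy κ B β T :=
  Real.one_le_exp (mul_nonneg hκ (Finset.sum_nonneg fun _ _ => sq_nonneg _))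

lemma missingEnergy_le (hκ : 0 ≤ κ) (hB : κ * ∑ v ∈ B, β v ^ 2 ≤ 1) (T : CartTree L) :
    missingEnergy κ B β T ≤ Real.exp 1 :=
  Real.exp_le_exp.2 ((mul_le_mul_of_nonneg_left (Finset.sum_le_sum_of_subset_of_nonneg
    Finset.sdiff_subset fun _ _ _ => sq_nonneg _) hκ).trans hB)

lemma missingEnergy_eq_one (hT : B ⊆ T.int) : missingEnergy κ B β T = 1 := by
  rw [missingEnergy, Finset.sdiff_eq_empty_iff_subset.2 hT, Finset.sum_empty, mul_zero,
    Real.exp_zero]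

lemma missingEnergy_le_of_not_loses (hκ : 0 ≤ κ) (h : ¬ Loses B T T') :
    missingEnergy κ B β T' ≤ missingEnergy κ B β T := by
  refine Real.exp_le_exp.2 (mul_le_mul_of_nonneg_left ?_ hκ)
  refine Finset.sum_le_sum_of_subset_of_nonneg ?_ fun _ _ _ => sq_nonneg _
  rintro (_ | v) hv
  · simp [CartTree.int] at hv
  · rw [Finset.mem_sdiff] at hv ⊢
    refine ⟨hv.1, fun hvT => hv.2 (Finset.some_mem_insertNone.2 ?_)⟩
    by_contra hvT'
    exact h ⟨v, Finset.some_mem_insertNone.1 hvT, hvT', hv.1⟩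

lemma missingEnergy_le_of_mem (hκ : 0 ≤ κ) (hT : T ≤ T') {v : Node} (hvB : some v ∈ B)
    (hv : v ∉ T.1) (hv' : v ∈ T'.1) :
    missingEnergy κ B β T' ≤ Real.exp (-(κ * β (some v) ^ 2)) * missingEnergy κ B β T := by
  have hsub : insert (some v) (B \ T'.int) ⊆ B \ T.int := by
    refine Finset.insert_subset ?_ (Finset.sdiff_subset_sdiff le_rfl (CartTree.int_mono hT))
    exact Finset.mem_sdiff.2 ⟨hvB, fun hc => hv (Finset.some_mem_insertNone.1 hc)⟩
  have hnot : some v ∉ B \ T'.int := fun hc =>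
    (Finset.mem_sdiff.1 hc).2 (Finset.some_mem_insertNone.2 hv')
  have hsum : β (some v) ^ 2 + ∑ w ∈ B \ T'.int, β w ^ 2 ≤ ∑ w ∈ B \ T.int, β w ^ 2 := by
    rw [← Finset.sum_insert (f := fun w => β w ^ 2) hnot]
    exact Finset.sum_le_sum_of_subset_of_nonneg hsub fun _ _ _ => sq_nonneg _
  rw [missingEnergy, missingEnergy, ← Real.exp_add]
  exact Real.exp_le_exp.2 (by linarith [mul_le_mul_of_nonneg_left hsum hκ])

open Classical in
lemma missingEnergy_sub_le (hκ : 0 ≤ κ) (hB : κ * ∑ v ∈ B, β v ^ 2 ≤ 1) (T T' : CartTree L) :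
    missingEnergy κ B β T' - missingEnergy κ B β T ≤
      (if Loses B T T' then Real.exp 1 - 1 else 0) * missingEnergy κ B β T := by
  have hT := one_le_missingEnergy (B := B) (β := β) hκ T
  split_ifs with hl
  · have hT' := missingEnergy_le hκ hB T'
    have he := mul_le_mul_of_nonneg_left hT (Real.exp_pos 1).le
    linarith
  · linarith [missingEnergy_le_of_not_loses (β := β) hκ hl]

end MissingEnergy

lemma Concentrated.mulVec_missingEnergy_le {s : Sampler} {q Q : ℝ} {B : Finset Index}
    {Ts T : CartTree L} {π : CartTree L → ℝ} {ρ : Node → ℝ} (h : Concentrated s q Q B Ts π ρ)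
    {β : Index → ℝ} {κ x : ℝ} (hκ : 0 ≤ κ) (hB : κ * ∑ v ∈ B, β v ^ 2 ≤ 1) (hx : 0 ≤ x)
    (hβ : ∀ v ∈ B, x ≤ κ * β v ^ 2) (hT : ¬ Ts ≤ T) :
    (metropolisHastings s.proposal π *ᵥ missingEnergy κ B β) T / missingEnergy κ B β T ≤
      1 - s.delta L / 2 ^ (L + 1) * (x / 2) + (Real.exp 1 - 1) * (2 ^ L / Q) := by
  classical
  have hV := zero_lt_one.trans_le (one_le_missingEnergy (B := B) (β := β) hκ T)
  have he : 0 ≤ Real.exp 1 - 1 := by linarith [Real.add_one_le_exp 1]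
  obtain ⟨g, v, hvB, hvT, hvg, hTg, hp⟩ := h.exists_grow hT
  have hx1 : x ≤ 1 := (hβ _ hvB).trans <| le_trans (mul_le_mul_of_nonneg_left
    (Finset.single_le_sum (f := fun v => β v ^ 2) (fun _ _ => sq_nonneg _) hvB) hκ) hB
  have hgood : missingEnergy κ B β g ≤ (1 - x / 2) * missingEnergy κ B β T := by
    refine (missingEnergy_le_of_mem hκ hTg hvB hvT hvg).trans
      (mul_le_mul_of_nonneg_right ?_ hV.le)
    have hexp := Real.exp_le_exp.2 (neg_le_neg (hβ _ hvB))
    linarith [half_le_one_sub_exp_neg hx hx1]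
  refine (mulVec_div_le h.mem_rowStochastic hV (fun T' => ite_nonneg he le_rfl)
    (fun T' _ => missingEnergy_sub_le hκ hB T T') (by positivity) hgood hp).trans ?_
  simp only [mul_ite, mul_zero, ← Finset.sum_filter, ← Finset.sum_mul]
  rw [mul_comm (Real.exp 1 - 1)]
  gcongr
  exact h.sum_loses_le T

/-! ### The drift towards the smallest tree that contains the signal -/

section Drift₂

variable {Ts T T' : CartTree L}

lemma card_int_sdiff (T T' : CartTree L) : (T.int \ T'.int).card = (T.1 \ T'.1).card := by
  have hmap : T.int \ T'.int = (T.1 \ T'.1).map Function.Embedding.some := by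
    ext (_ | v) <;> simp [CartTree.int]
  rw [hmap, Finset.card_map]

lemma card_int_union_le (T T' : CartTree L) : ((T.int ∪ T'.int).card : ℝ) ≤ 2 ^ L := by
  have hcard := Finset.card_le_card (Finset.union_subset T.int_subset T'.int_subset)
  rw [card_fullIndices] at hcard
  exact_mod_cast hcard

lemma drift₂_of_le (hT : Ts ≤ T) :
    drift₂ Ts T = Real.exp (1 / 2 ^ L * ((T.1 \ Ts.1).card : ℝ)) := by
  have hempty : (Ts.1 \ T.1).card = 0 :=
    Finset.card_eq_zero.2 (Finset.sdiff_eq_empty_iff_subset.2 hT)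
  rw [drift₂, card_int_sdiff, card_int_sdiff, hempty]
  simp

lemma one_le_drift₂ (Ts T : CartTree L) : 1 ≤ drift₂ Ts T := by
  have := sub_nonneg.2 (card_int_union_le T Ts)
  exact Real.one_le_exp (by positivity)

lemma drift₂_le (Ts T : CartTree L) : drift₂ Ts T ≤ Real.exp 1 := by
  refine Real.exp_le_exp.2 ?_
  have hsdiff : ((T.int \ Ts.int).card : ℝ) ≤ (T.int ∪ Ts.int).card := by
    exact_mod_cast Finset.card_le_card (Finset.sdiff_subset.trans Finset.subset_union_left)
  have hunion := card_int_union_le T Ts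
  have hmin : ((min (Ts.int \ T.int).card 1 : ℕ) : ℝ) ≤ 1 := by exact_mod_cast min_le_right _ _
  have hmul := mul_le_mul_of_nonneg_right hmin (sub_nonneg.2 hunion)
  rw [one_div_mul_eq_div, div_le_one (by positivity)]
  linarith

lemma drift₂_eq_exp_mul (hT : Ts ≤ T) (hT' : T ≤ T') :
    drift₂ Ts T' = Real.exp (1 / 2 ^ L * ((T'.1 \ T.1).card : ℝ)) * drift₂ Ts T := by
  have hcard : (T'.1 \ Ts.1).card = (T'.1 \ T.1).card + (T.1 \ Ts.1).card := by
    rw [← Finset.card_sdiff_add_card_eq_card (Finset.sdiff_subset_sdiff (show T.1 ≤ T'.1 from hT')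
      (le_refl Ts.1)), sdiff_sdiff_sdiff_cancel_right (show Ts.1 ≤ T.1 from hT)]
  rw [drift₂_of_le hT, drift₂_of_le (hT.trans hT'), ← Real.exp_add, hcard]
  congr 1
  push_cast
  ring

lemma drift₂_mono (hT : Ts ≤ T) (hT' : T ≤ T') : drift₂ Ts T ≤ drift₂ Ts T' := by
  rw [drift₂_eq_exp_mul hT hT']
  exact le_mul_of_one_le_left (zero_le_one.trans (one_le_drift₂ Ts T))
    (Real.one_le_exp (by positivity))

lemma Sampler.Step.drift₂_sub_le {s : Sampler} (hs : s.Step T T') (hT : Ts ≤ T) :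
    drift₂ Ts T' - drift₂ Ts T ≤ 2 * s.bigM L / 2 ^ L * drift₂ Ts T := by
  have hexp := exp_sub_one_le_two_mul (x := 1 / 2 ^ L * ((T'.1 \ T.1).card : ℝ)) (by positivity)
    (by
      rw [one_div_mul_eq_div, div_le_one (by positivity)]
      exact CartTree.card_le_of_subset Finset.sdiff_subset)
  have hcard : 2 * (1 / 2 ^ L * ((T'.1 \ T.1).card : ℝ)) ≤ 2 * s.bigM L / 2 ^ L := by
    rw [one_div_mul_eq_div, ← mul_div_assoc]
    gcongr
    exact hs.card_sdiff_le_bigM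
  rw [drift₂_eq_exp_mul hT hs.lt.le, ← sub_one_mul]
  exact mul_le_mul_of_nonneg_right (hexp.trans hcard) (zero_le_one.trans (one_le_drift₂ Ts T))

lemma drift₂_le_of_erase (hT : Ts ≤ T) {v : Node} (hv : v ∉ T.1) (hv' : T'.1 = insert v T.1) :
    drift₂ Ts T ≤ (1 - 1 / 2 ^ L / 2) * drift₂ Ts T' := by
  have hexp := half_le_one_sub_exp_neg (x := 1 / 2 ^ L) (by positivity)
    (div_le_one_of_le₀ (one_le_pow₀ one_le_two) (by positivity))
  have hle : T ≤ T' := show T.1 ⊆ T'.1 from hv' ▸ Finset.subset_insert v T.1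
  have hgain : drift₂ Ts T = Real.exp (-(1 / 2 ^ L)) * drift₂ Ts T' := by
    rw [drift₂_eq_exp_mul hT hle, hv', Finset.insert_sdiff_cancel hv, Finset.card_singleton,
      Nat.cast_one, mul_one, ← mul_assoc, ← Real.exp_add, neg_add_cancel, Real.exp_zero, one_mul]
  rw [hgain]
  exact mul_le_mul_of_nonneg_right (by linarith) (zero_le_one.trans (one_le_drift₂ Ts T'))

end Drift₂

namespace Concentrated

variable {s : Sampler} {q Q : ℝ} {B : Finset Index} {Ts T : CartTree L} {π : CartTree L → ℝ}
  {ρ : Node → ℝ}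

open Classical in
lemma drift₂_sub_le (h : Concentrated s q Q B Ts π ρ) (hT : Ts ≤ T) {T' : CartTree L}
    (h0 : metropolisHastings s.proposal π T T' ≠ 0) :
    drift₂ Ts T' - drift₂ Ts T ≤ ((if Loses B T T' then 2 else 0) +
      if s.Step T T' then 2 * s.bigM L / 2 ^ L else 0) * drift₂ Ts T := by
  have hV := one_le_drift₂ Ts T
  have hM : 0 ≤ 2 * s.bigM L / 2 ^ L := by
    have := s.bigM_nonneg L
    positivity
  by_cases hl : Loses B T T'
  · have hV' : drift₂ Ts T' - drift₂ Ts T ≤ 2 * drift₂ Ts T := by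
      linarith [drift₂_le Ts T', Real.exp_one_lt_three]
    rw [if_pos hl, add_mul]
    refine hV'.trans (le_add_of_nonneg_right (mul_nonneg (ite_nonneg hM le_rfl) ?_))
    linarith
  have hT' : Ts ≤ T' := by
    by_contra hc
    exact hl (h.loses_of_not_le hT hc)
  rw [if_neg hl, zero_add]
  by_cases hs : s.Step T T'
  · rw [if_pos hs]
    exact hs.drift₂_sub_le hT
  · rw [if_neg hs, zero_mul, sub_nonpos]
    rcases eq_or_ne T' T with rfl | hne
    · exact le_rfl
    · exact drift₂_mono hT' ((h.step_of_ne_zero hne h0).resolve_left hs).lt.le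

lemma mulVec_drift₂_le (h : Concentrated s q Q B Ts π ρ) (hT : Ts < T) :
    (metropolisHastings s.proposal π *ᵥ drift₂ Ts) T / drift₂ Ts T ≤
      1 - 1 / 2 ^ (2 * L + 2) + 2 * s.bigM L * q + 2 * (2 ^ L / Q) := by
  classical
  have hM : 0 ≤ 2 * s.bigM L / 2 ^ L := by
    have := s.bigM_nonneg L
    positivity
  obtain ⟨g, v, hvg, hTg, hTsg, hp⟩ := h.exists_prune hT
  refine (mulVec_div_le h.mem_rowStochastic (zero_lt_one.trans_le (one_le_drift₂ Ts T))
    (fun T' => add_nonneg (ite_nonneg zero_le_two le_rfl) (ite_nonneg hM le_rfl))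
    (fun T' => h.drift₂_sub_le hT.le) (by positivity) (drift₂_le_of_erase hTsg hvg hTg) hp).trans ?_
  simp only [mul_add, mul_ite, mul_zero, Finset.sum_add_distrib, ← Finset.sum_filter,
    ← Finset.sum_mul]
  have hloss := mul_le_mul_of_nonneg_right (h.sum_loses_le T) zero_le_two
  have hgrow := mul_le_mul_of_nonneg_right (h.sum_step_le hT.le) hM
  have hM' : 2 ^ L * q * (2 * s.bigM L / 2 ^ L) = 2 * s.bigM L * q := by field_simp
  have hgain : (1 : ℝ) / 2 ^ (L + 1) * (1 / 2 ^ L / 2) = 1 / 2 ^ (2 * L + 2) := by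
    rw [div_div, ← pow_succ, div_mul_div_comm, ← pow_add, one_mul]
    congr 2
    ring
  rw [hgain]
  linarith

end Concentrated

/-! ### The mixing time -/

/-- The function that certifies the mixing time: off the smallest tree `Ts` that contains the
signal, it is the second drift function above `Ts` and a multiple of the first elsewhere. The
factor `e` makes the second drift function the smaller one, so that a move into the trees above
`Ts` does not increase the function. -/
noncomputable def combinedDrift (κ : ℝ) (B : Finset Index) (β : Index → ℝ) (Ts T : CartTree L) :
    ℝ :=
  open Classical in
  if T = Ts then 0 else if Ts ≤ T then drift₂ Ts T else Real.exp 1 * missingEnergy κ B β T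

section CombinedDrift

variable {κ : ℝ} {B : Finset Index} {β : Index → ℝ} {Ts T : CartTree L}

lemma combinedDrift_self : combinedDrift κ B β Ts Ts = 0 := if_pos rfl

lemma combinedDrift_of_lt (hT : Ts < T) : combinedDrift κ B β Ts T = drift₂ Ts T := by
  rw [combinedDrift, if_neg hT.ne', if_pos hT.le]

lemma combinedDrift_of_not_le (hT : ¬ Ts ≤ T) :
    combinedDrift κ B β Ts T = Real.exp 1 * missingEnergy κ B β T := by
  rw [combinedDrift, if_neg fun heq => hT heq.ge, if_neg hT]

lemma combinedDrift_le_drift₂ (hT : Ts ≤ T) : combinedDrift κ B β Ts T ≤ drift₂ Ts T := by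
  rcases hT.eq_or_lt with rfl | hlt
  · exact combinedDrift_self.trans_le (zero_le_one.trans (one_le_drift₂ _ _))
  · exact (combinedDrift_of_lt hlt).le

lemma combinedDrift_le_exp_mul (hκ : 0 ≤ κ) (T : CartTree L) :
    combinedDrift κ B β Ts T ≤ Real.exp 1 * missingEnergy κ B β T := by
  by_cases hT : Ts ≤ T
  · exact (combinedDrift_le_drift₂ hT).trans <| (drift₂_le Ts T).trans <|
      le_mul_of_one_le_right (Real.exp_pos 1).le (one_le_missingEnergy hκ T)
  · exact (combinedDrift_of_not_le hT).le

lemma one_le_combinedDrift (hκ : 0 ≤ κ) (hT : T ≠ Ts) : 1 ≤ combinedDrift κ B β Ts T := by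
  by_cases hle : Ts ≤ T
  · rw [combinedDrift_of_lt (lt_of_le_of_ne hle hT.symm)]
    exact one_le_drift₂ Ts T
  · rw [combinedDrift_of_not_le hle]
    exact one_le_mul_of_one_le_of_one_le (Real.one_le_exp zero_le_one) (one_le_missingEnergy hκ T)

lemma combinedDrift_le_eight (hκ : 0 ≤ κ) (hB : κ * ∑ v ∈ B, β v ^ 2 ≤ 1) (T : CartTree L) :
    combinedDrift κ B β Ts T ≤ 8 :=
  calc combinedDrift κ B β Ts T ≤ Real.exp 1 * Real.exp 1 :=
        (combinedDrift_le_exp_mul hκ T).trans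
          (mul_le_mul_of_nonneg_left (missingEnergy_le hκ hB T) (Real.exp_pos 1).le)
    _ ≤ 8 := by nlinarith [Real.exp_one_lt_d9, Real.exp_pos 1]

end CombinedDrift

namespace Concentrated

variable {s : Sampler} {q Q : ℝ} {B : Finset Index} {Ts T : CartTree L} {π : CartTree L → ℝ}
  {ρ : Node → ℝ}

open Classical in
lemma sum_superset_le_prod (h : Concentrated s q Q B Ts π ρ) :
    ∑ T with Ts ≤ T, π T ≤ π Ts * ∏ v ∈ fullNodes L \ Ts.1, (1 + ρ v) := by
  have hinj : Set.InjOn (fun T : CartTree L => T.1 \ Ts.1)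
      (Finset.univ.filter (Ts ≤ ·) : Finset (CartTree L)) := by
    intro T hT T' hT' heq
    have hsub : Ts.1 ⊆ T.1 := (Finset.mem_filter.1 hT).2
    have hsub' : Ts.1 ⊆ T'.1 := (Finset.mem_filter.1 hT').2
    exact Subtype.ext (by
      rw [← Finset.sdiff_union_of_subset hsub, ← Finset.sdiff_union_of_subset hsub']
      exact congrArg (· ∪ Ts.1) heq)
  rw [Finset.sum_congr rfl fun T hT => h.factor Ts T (Finset.mem_filter.1 hT).2,
    ← Finset.mul_sum, Finset.prod_one_add,
    ← Finset.sum_image (f := fun S => ∏ v ∈ S, ρ v) hinj]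
  refine mul_le_mul_of_nonneg_left ?_ (h.pos Ts).le
  refine Finset.sum_le_sum_of_subset_of_nonneg (Finset.image_subset_iff.2 fun T _ => ?_)
    fun S _ _ => Finset.prod_nonneg fun v _ => (h.factor_pos v).le
  exact Finset.mem_powerset.2 (Finset.sdiff_subset_sdiff T.subset_full le_rfl)

open Classical in
lemma sum_superset_le (h : Concentrated s q Q B Ts π ρ) (hq : 2 ^ L * q ≤ 1 / 2) :
    ∑ T with Ts ≤ T, π T ≤ 2 * π Ts := by
  have hle : ∀ v ∈ fullNodes L \ Ts.1, ρ v ≤ q := fun v hv =>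
    h.factor_le v (Finset.mem_sdiff.1 hv).1 fun hvB =>
      (Finset.mem_sdiff.1 hv).2 (h.le_iff.1 le_rfl v hvB)
  have hsum : ∑ v ∈ fullNodes L \ Ts.1, ρ v ≤ 1 / 2 := by
    refine (Finset.sum_le_card_nsmul _ _ q hle).trans (le_trans ?_ hq)
    rw [nsmul_eq_mul]
    refine mul_le_mul_of_nonneg_right ?_ h.small_pos.le
    have hcard := card_fullNodes L
    exact_mod_cast (Finset.card_le_card Finset.sdiff_subset).trans (by omega)
  have hprod : ∏ v ∈ fullNodes L \ Ts.1, (1 + ρ v) ≤ 2 :=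
    calc ∏ v ∈ fullNodes L \ Ts.1, (1 + ρ v) ≤ Real.exp (1 / 2) :=
          (Real.prod_one_add_le_exp_sum _ fun v => (h.factor_pos v).le).trans
            (Real.exp_le_exp.2 hsum)
      _ ≤ 2 := by linarith [exp_sub_one_le_two_mul (x := 1 / 2) (by norm_num) (by norm_num)]
  rw [mul_comm 2]
  exact h.sum_superset_le_prod.trans (mul_le_mul_of_nonneg_left hprod (h.pos Ts).le)

variable {β : Index → ℝ} {κ x : ℝ}

open Classical in
lemma mulVec_missingEnergy_le_add (h : Concentrated s q Q B Ts π ρ) (hκ : 0 ≤ κ)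
    (hB : κ * ∑ v ∈ B, β v ^ 2 ≤ 1) (hT : Ts ≤ T) :
    (metropolisHastings s.proposal π *ᵥ missingEnergy κ B β) T ≤
      missingEnergy κ B β T + (Real.exp 1 - 1) * (2 ^ L / Q) := by
  have he : 0 ≤ Real.exp 1 - 1 := by linarith [Real.add_one_le_exp 1]
  have hone : missingEnergy κ B β T = 1 :=
    missingEnergy_eq_one (h.isLeast.1.trans (CartTree.int_mono hT))
  rw [← sub_le_iff_le_add', mulVec_sub_eq h.mem_rowStochastic]
  refine le_trans ?_ (mul_le_mul_of_nonneg_left (h.sum_loses_le T) he)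
  rw [Finset.sum_filter, Finset.mul_sum]
  refine Finset.sum_le_sum fun T' _ => ?_
  have hchange := mul_le_mul_of_nonneg_left (missingEnergy_sub_le hκ hB T T')
    (Matrix.nonneg_of_mem_rowStochastic h.mem_rowStochastic (i := T) (j := T'))
  refine hchange.trans_eq ?_
  rw [hone]
  split_ifs <;> ring

lemma quarter_le (h : Concentrated s q Q B Ts π ρ) (hq : 2 ^ L * q ≤ 1 / 2) (hκ : 0 ≤ κ)
    (hB : κ * ∑ v ∈ B, β v ^ 2 ≤ 1) (hx : 0 < x) (hβ : ∀ v ∈ B, x ≤ κ * β v ^ 2)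
    (hloss : 2 * ((Real.exp 1 - 1) * (2 ^ L / Q)) ≤ s.delta L / 2 ^ (L + 1) * (x / 2)) :
    1 / 4 ≤ π Ts := by
  classical
  set a := s.delta L / 2 ^ (L + 1) * (x / 2) with ha
  set r := (Real.exp 1 - 1) * (2 ^ L / Q) with hr
  have ha0 : 0 < a := by
    have := h.delta_pos
    positivity
  have hcompl : a * ∑ T ∈ (Finset.univ.filter (Ts ≤ ·))ᶜ, π T ≤ r := by
    refine mul_sum_compl_le_of_drift (V := missingEnergy κ B β) h.mem_rowStochastic
      (fun T => (h.pos T).le) h.sum_eq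
      (detailedBalance_metropolisHastings (s.proposal_nonneg h.valid) h.pos)
      (fun T hT => h.mulVec_missingEnergy_le_add hκ hB (Finset.mem_filter.1 hT).2)
      fun T hT => ?_
    have hV := one_le_missingEnergy (B := B) (β := β) hκ T
    have hdrift := h.mulVec_missingEnergy_le hκ hB hx.le hβ (T := T)
      fun hle => hT (Finset.mem_filter.2 ⟨Finset.mem_univ T, hle⟩)
    rw [← ha, ← hr, div_le_iff₀ (by linarith)] at hdrift
    nlinarith
  have hhalf : ∑ T ∈ (Finset.univ.filter (Ts ≤ ·))ᶜ, π T ≤ 1 / 2 :=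
    le_of_mul_le_mul_left (by linarith) ha0
  have hsplit := Finset.sum_add_sum_compl (Finset.univ.filter (Ts ≤ ·)) π
  linarith [h.sum_superset_le hq, h.sum_eq]

open Classical in
lemma mulVec_combinedDrift_le_of_le (h : Concentrated s q Q B Ts π ρ) (hκ : 0 ≤ κ)
    (hB : κ * ∑ v ∈ B, β v ^ 2 ≤ 1) (hT : Ts ≤ T) :
    (metropolisHastings s.proposal π *ᵥ combinedDrift κ B β Ts) T ≤
      (metropolisHastings s.proposal π *ᵥ drift₂ Ts) T + 8 * (2 ^ L / Q) := by
  refine le_trans ?_ (add_le_add_right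
    (mul_le_mul_of_nonneg_left (h.sum_loses_le T) (by norm_num : (0 : ℝ) ≤ 8)) _)
  simp only [Matrix.mulVec, dotProduct]
  rw [Finset.sum_filter, Finset.mul_sum, ← Finset.sum_add_distrib]
  refine Finset.sum_le_sum fun T' _ => ?_
  have hjump : combinedDrift κ B β Ts T' ≤ drift₂ Ts T' + if Loses B T T' then 8 else 0 := by
    by_cases hT' : Ts ≤ T'
    · exact (combinedDrift_le_drift₂ hT').trans
        (le_add_of_nonneg_right (ite_nonneg (by norm_num) le_rfl))
    · rw [if_pos (h.loses_of_not_le hT hT')]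
      linarith [combinedDrift_le_eight (Ts := Ts) hκ hB T', one_le_drift₂ Ts T']
  refine (mul_le_mul_of_nonneg_left hjump
    (Matrix.nonneg_of_mem_rowStochastic h.mem_rowStochastic)).trans_eq ?_
  split_ifs <;> ring

lemma mulVec_combinedDrift_le (h : Concentrated s q Q B Ts π ρ) (hκ : 0 ≤ κ)
    (hB : κ * ∑ v ∈ B, β v ^ 2 ≤ 1) (hx : 0 ≤ x) (hβ : ∀ v ∈ B, x ≤ κ * β v ^ 2) {γ : ℝ}
    (hloss : (Real.exp 1 - 1) * (2 ^ L / Q) ≤ γ)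
    (hγ₁ : 2 * γ ≤ s.delta L / 2 ^ (L + 1) * (x / 2))
    (hγ₂ : γ + 2 * s.bigM L * q + 10 * (2 ^ L / Q) ≤ 1 / 2 ^ (2 * L + 2)) (hT : T ≠ Ts) :
    (metropolisHastings s.proposal π *ᵥ combinedDrift κ B β Ts) T ≤
      (1 - γ) * combinedDrift κ B β Ts T := by
  by_cases hle : Ts ≤ T
  · have hlt : Ts < T := lt_of_le_of_ne hle hT.symm
    have hV := one_le_drift₂ Ts T
    have hdrift := h.mulVec_drift₂_le hlt
    rw [div_le_iff₀ (by linarith)] at hdrift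
    have hR : 0 ≤ 2 ^ L / Q := div_nonneg (by positivity) h.large_pos.le
    rw [combinedDrift_of_lt hlt]
    calc _ ≤ _ := h.mulVec_combinedDrift_le_of_le hκ hB hle
      _ ≤ (1 - 1 / 2 ^ (2 * L + 2) + 2 * s.bigM L * q + 2 * (2 ^ L / Q)) * drift₂ Ts T +
          8 * (2 ^ L / Q) * drift₂ Ts T :=
        add_le_add hdrift (le_mul_of_one_le_right (by positivity) hV)
      _ ≤ (1 - γ) * drift₂ Ts T := by
        rw [← add_mul]
        exact mul_le_mul_of_nonneg_right (by linarith) (by linarith)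
  · have hV := one_le_missingEnergy (B := B) (β := β) hκ T
    have hdrift := h.mulVec_missingEnergy_le hκ hB hx hβ hle
    rw [div_le_iff₀ (by linarith)] at hdrift
    rw [combinedDrift_of_not_le hle]
    calc _ ≤ (metropolisHastings s.proposal π *ᵥ (Real.exp 1 • missingEnergy κ B β)) T :=
          Finset.sum_le_sum fun T' _ => mul_le_mul_of_nonneg_left (combinedDrift_le_exp_mul hκ T')
            (Matrix.nonneg_of_mem_rowStochastic h.mem_rowStochastic)
      _ ≤ Real.exp 1 * ((1 - γ) * missingEnergy κ B β T) := by
        rw [Matrix.mulVec_smul, Pi.smul_apply, smul_eq_mul]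
        refine mul_le_mul_of_nonneg_left (hdrift.trans ?_) (Real.exp_pos 1).le
        exact mul_le_mul_of_nonneg_right (by linarith) (by linarith)
      _ = _ := by ring

theorem mixingTime_le (h : Concentrated s q Q B Ts π ρ) (hq : 2 ^ L * q ≤ 1 / 2) (hκ : 0 ≤ κ)
    (hB : κ * ∑ v ∈ B, β v ^ 2 ≤ 1) (hx : 0 < x) (hβ : ∀ v ∈ B, x ≤ κ * β v ^ 2) {γ : ℝ}
    (hγ : 0 < γ) (hloss : (Real.exp 1 - 1) * (2 ^ L / Q) ≤ γ)
    (hγ₁ : 2 * γ ≤ s.delta L / 2 ^ (L + 1) * (x / 2))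
    (hγ₂ : γ + 2 * s.bigM L * q + 10 * (2 ^ L / Q) ≤ 1 / 2 ^ (2 * L + 2)) {ε : ℝ} (hε : 0 < ε)
    (hε' : ε < 1) :
    (mixingTime (lazyChain (metropolisHastings s.proposal π)) π ε : ℝ≥0∞) ≤
      ENNReal.ofReal (119 / γ * Real.log (6 / ε)) := by
  have hγ1 : γ ≤ 1 := by
    have hpow : (1 : ℝ) / 2 ^ (2 * L + 2) ≤ 1 :=
      div_le_one_of_le₀ (one_le_pow₀ one_le_two) (by positivity)
    have hM := mul_nonneg (s.bigM_nonneg L) h.small_pos.le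
    have hR : 0 ≤ 2 ^ L / Q := div_nonneg (by positivity) h.large_pos.le
    linarith
  exact mixingTime_lazyChain_le_of_quarter_le h.mem_rowStochastic h.pos h.sum_eq
    (detailedBalance_metropolisHastings (s.proposal_nonneg h.valid) h.pos)
    (h.quarter_le hq hκ hB hx hβ (by linarith)) combinedDrift_self
    (fun T => one_le_combinedDrift hκ) (combinedDrift_le_eight hκ hB) hγ hγ1
    (fun T hT => h.mulVec_combinedDrift_le hκ hB hx.le hβ hloss hγ₁ hγ₂ hT) hε hε'

end Concentrated

/-! ### Large samples -/

lemma two_point_eight_pow_le_rpow {n : ℕ} (h : 2 ^ L ≤ n) :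
    (2.8 : ℝ) ^ L ≤ (n : ℝ) ^ (3 / 2 : ℝ) := by
  have hbase : (2.8 : ℝ) ≤ 2 ^ (3 / 2 : ℝ) := by
    have hsqrt : (1.4 : ℝ) ≤ √2 := Real.le_sqrt_of_sq_le (by norm_num)
    rw [show (3 / 2 : ℝ) = 1 + 1 / 2 by norm_num, Real.rpow_add two_pos, Real.rpow_one,
      ← Real.sqrt_eq_rpow]
    linarith
  calc (2.8 : ℝ) ^ L ≤ (2 ^ (3 / 2 : ℝ)) ^ L := pow_le_pow_left₀ (by norm_num) hbase L
    _ = ((2 : ℝ) ^ L) ^ (3 / 2 : ℝ) := Real.rpow_pow_comm zero_le_two _ _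
    _ ≤ _ := Real.rpow_le_rpow (by positivity) (by exact_mod_cast h) (by norm_num)

/-- Since `D ≤ e < 2 ^ (3 / 2)`, the factor `n ^ (3 / 2) ≥ 2 ^ (3 L / 2)` outgrows `D ^ L`. -/
lemma Sampler.eventually_one_le_mul_delta {s : Sampler} (hs : s.Valid) :
    ∀ᶠ L in Filter.atTop, ∀ n : ℕ, 2 ^ L ≤ n → 1 ≤ 4 * (n : ℝ) ^ (3 / 2 : ℝ) * s.delta L := by
  cases s with
  | bayesianCART =>
    refine .of_forall fun L n hn => ?_
    have := Real.one_le_rpow (Nat.one_le_cast.2 (Nat.one_le_two_pow.trans hn))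
      (by norm_num : (0 : ℝ) ≤ 3 / 2)
    rw [Sampler.delta]
    linarith
  | twiggy D =>
    obtain ⟨hD, hDe⟩ := hs
    have := sub_pos.2 hD
    have hratio : 1 < 2.8 / Real.exp 1 := by
      rw [one_lt_div (Real.exp_pos 1)]
      linarith [Real.exp_one_lt_d9]
    filter_upwards [Filter.eventually_ge_atTop 1, (tendsto_pow_atTop_atTop_of_one_lt
      hratio).eventually_ge_atTop (1 / (8 * (D - 1)))] with L hL hgrowth n hn
    have hDL : 0 < D ^ L - 1 := sub_pos.2 (one_lt_pow₀ hD (by omega))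
    rw [div_le_iff₀ (by positivity), div_pow, div_mul_eq_mul_div, le_div_iff₀ (by positivity),
      one_mul] at hgrowth
    rw [Sampler.delta, mul_div_assoc', le_div_iff₀ hDL, one_mul]
    calc D ^ L - 1 ≤ Real.exp 1 ^ L :=
          (sub_le_self _ zero_le_one).trans (pow_le_pow_left₀ (by linarith) hDe L)
      _ ≤ 2.8 ^ L * (8 * (D - 1)) := hgrowth
      _ ≤ (n : ℝ) ^ (3 / 2 : ℝ) * (8 * (D - 1)) := by
          gcongr
          exact two_point_eight_pow_le_rpow hn
      _ = _ := by ring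

lemma sixteen_mul_sq_le_two_pow (hL : 14 ≤ L) : 16 * (2 * L + 1) ^ 2 ≤ 2 ^ L := by
  induction L, hL using Nat.le_induction with
  | base => norm_num
  | succ L hL ih =>
    rw [pow_succ 2 L]
    nlinarith

/-- The sample size `n` is large compared to the depth `L`, the bound `C` on the coefficients and
the proposal probabilities of the sampler. -/
structure LargeSample (s : Sampler) (n L : ℕ) (C : ℝ) : Prop where
  two_pow_le : 2 ^ (L + 1) ≤ n
  eight_le : 8 ≤ n
  one_le_delta : 1 ≤ 4 * (n : ℝ) ^ (3 / 2 : ℝ) * s.delta L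
  le_sqrt : 4 * (2 * L + 1) ≤ √(n : ℝ)
  sq_le : 4 * C ^ 2 ≤ n

lemma eventually_largeSample {s : Sampler} (hs : s.Valid) (C : ℝ) :
    ∀ᶠ L in Filter.atTop, ∀ n : ℕ, 2 ^ (L + 1) ≤ n → LargeSample s n L C := by
  filter_upwards [Sampler.eventually_one_le_mul_delta hs, Filter.eventually_ge_atTop 14,
    Filter.eventually_ge_atTop ⌈4 * C ^ 2⌉₊] with L hdelta hL hC n hn
  have hLn : 2 ^ L ≤ n := (Nat.pow_le_pow_right two_pos L.le_succ).trans hn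
  have hn8 : 2 ^ 3 ≤ 2 ^ L := Nat.pow_le_pow_right two_pos (by omega)
  have hsq : (16 : ℝ) * (2 * L + 1) ^ 2 ≤ n := by
    exact_mod_cast (sixteen_mul_sq_le_two_pow hL).trans hLn
  exact
    { two_pow_le := hn
      eight_le := hn8.trans hLn
      one_le_delta := hdelta n hLn
      le_sqrt := Real.le_sqrt_of_sq_le (by linarith)
      sq_le := (Nat.le_ceil _).trans (Nat.cast_le.2 (hC.trans (Nat.lt_two_pow_self.le.trans hLn))) }

namespace LargeSample

variable {s : Sampler} {n : ℕ} {A C c : ℝ}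

lemma pos (h : LargeSample s n L C) : 0 < n :=
  (by norm_num : 0 < 8).trans_le h.eight_le

lemma natCast_pos (h : LargeSample s n L C) : (0 : ℝ) < n :=
  Nat.cast_pos.2 h.pos

lemma one_le_natCast (h : LargeSample s n L C) : (1 : ℝ) ≤ n :=
  Nat.one_le_cast.2 h.pos

lemma one_le_log (h : LargeSample s n L C) : 1 ≤ Real.log n :=
  one_le_log_natCast (by linarith [h.eight_le])

lemma two_pow_le_sq (h : LargeSample s n L C) : (2 : ℝ) ^ (2 * L + 2) ≤ n ^ 2 := by
  rw [show 2 * L + 2 = (L + 1) * 2 by ring, pow_mul]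
  exact pow_le_pow_left₀ (by positivity) (by exact_mod_cast h.two_pow_le) 2

lemma inv_le_delta (h : LargeSample s n L C) : (4 * (n : ℝ) ^ (3 / 2 : ℝ))⁻¹ ≤ s.delta L := by
  have := h.natCast_pos
  rw [inv_le_iff_one_le_mul₀' (by positivity)]
  exact h.one_le_delta

lemma delta_pos (h : LargeSample s n L C) : 0 < s.delta L := by
  have := h.natCast_pos
  exact lt_of_lt_of_le (by positivity) h.inv_le_delta

lemma noiseWeight_le_delta (h : LargeSample s n L C) (hc : 3 ≤ c) :
    noiseWeight n c ≤ s.delta L := by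
  have hn : (8 : ℝ) ≤ n := by exact_mod_cast h.eight_le
  refine le_trans ?_ h.inv_le_delta
  rw [noiseWeight, mul_inv, ← Real.rpow_neg h.natCast_pos.le, mul_comm, div_eq_mul_inv]
  gcongr
  · linarith
  · linarith

end LargeSample

/-! ### The error terms of the drift bounds -/

section Errors

variable {s : Sampler} {n : ℕ} {A C c : ℝ}

lemma two_pow_div_signalWeight_le (hLn : 2 ^ (L + 1) ≤ n) (A : ℝ) :
    2 ^ L / signalWeight n A ≤ 1 / (2 * (n : ℝ) ^ (A ^ 2 / 8 * Real.log n - 1)) := by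
  have hpow : (2 : ℝ) ^ L * 2 ≤ n := by exact_mod_cast hLn
  have hn0 : (0 : ℝ) < n := lt_of_lt_of_le (by positivity) hpow
  rw [signalWeight, Real.rpow_sub_one hn0.ne', div_le_div_iff₀ (by positivity) (by positivity),
    one_mul, ← mul_assoc, mul_div_assoc', div_le_iff₀ hn0, mul_comm ((n : ℝ) ^ _)]
  gcongr

lemma rpow_one_sub_eq (n : ℕ) (A : ℝ) : (n : ℝ) ^ (1 - A ^ 2 * Real.log n / 8) =
    1 / (n : ℝ) ^ (A ^ 2 / 8 * Real.log n - 1) := by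
  rw [one_div, ← Real.rpow_neg n.cast_nonneg]
  congr 1
  ring

lemma two_mul_bigM_mul_noiseWeight_le (s : Sampler) (n L : ℕ) (c : ℝ) :
    2 * s.bigM L * noiseWeight n c ≤ s.bigM L / (n : ℝ) ^ (c - 3 / 2) := by
  have hnonneg : 0 ≤ s.bigM L / (n : ℝ) ^ (c - 3 / 2) :=
    div_nonneg (s.bigM_nonneg L) (by positivity)
  calc 2 * s.bigM L * noiseWeight n c = s.bigM L / (n : ℝ) ^ (c - 3 / 2) / 2 := by
        rw [noiseWeight, Real.rpow_neg n.cast_nonneg]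
        ring
    _ ≤ _ := half_le_self hnonneg

lemma noiseWeight_pos (hn : 0 < n) (c : ℝ) : 0 < noiseWeight n c := by
  rw [noiseWeight]
  positivity

lemma noiseWeight_le_one (hn : 0 < n) (hc : 3 / 2 ≤ c) : noiseWeight n c ≤ 1 := by
  have := Real.rpow_le_one_of_one_le_of_nonpos (Nat.one_le_cast.2 hn)
    (by linarith : -(c - 3 / 2) ≤ 0)
  rw [noiseWeight]
  linarith

lemma noiseWeight_le (hn : 1 ≤ n) (hc : 4 ≤ c) : noiseWeight n c ≤ 1 / (4 * (n ^ 2 * √n)) := by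
  have hn0 : (0 : ℝ) < n := by positivity
  calc noiseWeight n c ≤ (n : ℝ) ^ (-(2 + 1 / 2) : ℝ) / 4 := by
        rw [noiseWeight]
        gcongr
        · exact_mod_cast hn
        · linarith
    _ = _ := by
        rw [Real.rpow_neg hn0.le, Real.rpow_add hn0, Real.rpow_two, ← Real.sqrt_eq_rpow]
        ring

lemma Sampler.bigM_le (s : Sampler) (L : ℕ) : s.bigM L ≤ 2 * L + 1 := by
  cases s <;> simp [Sampler.bigM]

namespace LargeSample

lemma two_pow_le_signalWeight (h : LargeSample s n L C) (hA : 24 ≤ A) :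
    2 ^ (L + 1) ≤ signalWeight n A := by
  have hn1 := h.one_le_natCast
  calc (2 : ℝ) ^ (L + 1) ≤ (n : ℝ) ^ (1 : ℝ) := by
        rw [Real.rpow_one]
        exact_mod_cast h.two_pow_le
    _ ≤ _ := Real.rpow_le_rpow_of_exponent_le hn1 (by nlinarith [h.one_le_log])

lemma two_pow_div_signalWeight_le_inv_pow (h : LargeSample s n L C) (hA : 24 ≤ A) :
    2 ^ L / signalWeight n A ≤ ((n : ℝ) ^ 10)⁻¹ := by
  have hn0 := h.natCast_pos
  have hn1 := h.one_le_natCast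
  have hexponent : ((10 : ℕ) : ℝ) ≤ A ^ 2 / 8 * Real.log n - 1 := by
    push_cast
    nlinarith [h.one_le_log]
  refine (two_pow_div_signalWeight_le h.two_pow_le A).trans ?_
  rw [one_div, ← Real.rpow_natCast (n : ℝ) 10]
  refine inv_anti₀ (by positivity) ((Real.rpow_le_rpow_of_exponent_le hn1 hexponent).trans ?_)
  exact le_mul_of_one_le_left (by positivity) one_le_two

lemma two_pow_mul_noiseWeight_le (h : LargeSample s n L C) (hc : 4 ≤ c) :
    2 ^ L * noiseWeight n c ≤ 1 / 2 := by
  have hn1 := h.one_le_natCast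
  have hpow : (2 : ℝ) ^ L * 2 ≤ n := by exact_mod_cast h.two_pow_le
  have hweight : noiseWeight n c ≤ 1 / n := by
    refine (noiseWeight_le h.pos hc).trans ?_
    have hsqrt : 1 ≤ √(n : ℝ) := Real.one_le_sqrt.2 hn1
    refine one_div_le_one_div_of_le (by positivity) ?_
    nlinarith [mul_le_mul (show (1 : ℝ) * n ≤ n ^ 2 by nlinarith) hsqrt zero_le_one (sq_nonneg _)]
  calc 2 ^ L * noiseWeight n c ≤ n / 2 * (1 / n) := by
        have := noiseWeight_pos h.pos c
        gcongr
        linarith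
    _ = 1 / 2 := by field_simp

lemma perturbation_le (h : LargeSample s n L C) (hA : 24 ≤ A) (hc : 4 ≤ c) :
    2 * s.bigM L * noiseWeight n c + 10 * (2 ^ L / signalWeight n A) ≤
      1 / 2 ^ (2 * L + 2) / 2 := by
  have hn0 := h.natCast_pos
  have hn8 : (8 : ℝ) ≤ n := by exact_mod_cast h.eight_le
  have hnoise : 2 * s.bigM L * noiseWeight n c ≤ 1 / n ^ 2 / 4 :=
    calc 2 * s.bigM L * noiseWeight n c ≤ 2 * (√n / 4) * (1 / (4 * (n ^ 2 * √n))) := by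
          have := s.bigM_nonneg L
          have := noiseWeight_pos h.pos c
          gcongr
          · linarith [s.bigM_le L, h.le_sqrt]
          · exact noiseWeight_le h.pos hc
      _ = 1 / n ^ 2 / 8 := by
          field_simp
          norm_num
      _ ≤ 1 / n ^ 2 / 4 := by gcongr; norm_num
  have hsignal : 10 * (2 ^ L / signalWeight n A) ≤ 1 / n ^ 2 / 4 :=
    calc 10 * (2 ^ L / signalWeight n A) ≤ 10 * (1 / (n ^ 2 * 8 ^ 8)) := by
          refine mul_le_mul_of_nonneg_left ?_ (by norm_num)
          refine (h.two_pow_div_signalWeight_le_inv_pow hA).trans ?_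
          rw [← one_div, pow_add (n : ℝ) 2 8]
          gcongr
      _ = 1 / n ^ 2 * (10 / 8 ^ 8) := by ring
      _ ≤ 1 / n ^ 2 * (1 / 4) := mul_le_mul_of_nonneg_left (by norm_num) (by positivity)
      _ = _ := by ring
  have hpow : 1 / (n : ℝ) ^ 2 ≤ 1 / 2 ^ (2 * L + 2) :=
    one_div_le_one_div_of_le (by positivity) h.two_pow_le_sq
  linarith

end LargeSample

end Errors

/-! ### The rate of the first drift condition -/

/-- The relative decrease of the first drift function in one step. -/
noncomputable def driftRate₁ (s : Sampler) (n L : ℕ) (A C : ℝ) : ℝ :=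
  s.delta L * A ^ 2 * Real.log n ^ 2 / (2 ^ (2 * L + 2) * C ^ 2 * n)

lemma driftRate₁_eq (s : Sampler) (n L : ℕ) (A C : ℝ) : driftRate₁ s n L A C =
    s.delta L / 2 ^ (L + 1) * (A ^ 2 * Real.log n ^ 2 / (2 ^ L * C ^ 2 * n) / 2) := by
  rw [driftRate₁, div_div, div_mul_div_comm]
  congr 1 <;> ring

namespace LargeSample

variable {s : Sampler} {n : ℕ} {A C : ℝ}

lemma driftRate₁_pos (h : LargeSample s n L C) (hA : 0 < A) (hC : 0 < C) :
    0 < driftRate₁ s n L A C := by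
  have := h.natCast_pos
  have := h.delta_pos
  have := zero_lt_one.trans_le h.one_le_log
  rw [driftRate₁]
  positivity

lemma inv_pow_six_le_driftRate₁ (h : LargeSample s n L C) (hA : 1 ≤ A) (hC : 0 < C) :
    ((n : ℝ) ^ 6)⁻¹ ≤ driftRate₁ s n L A C := by
  have hn0 := h.natCast_pos
  have hn1 := h.one_le_natCast
  have hδ : 1 / (4 * (n : ℝ) ^ 2) ≤ s.delta L := by
    refine le_trans ?_ h.inv_le_delta
    rw [one_div, ← Real.rpow_two]
    gcongr
    norm_num
  have hnum : 1 ≤ A ^ 2 * Real.log n ^ 2 :=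
    one_le_mul_of_one_le_of_one_le (one_le_pow₀ hA) (one_le_pow₀ h.one_le_log)
  have hden : 2 ^ (2 * L + 2) * C ^ 2 * n ≤ (n : ℝ) ^ 4 / 4 :=
    calc 2 ^ (2 * L + 2) * C ^ 2 * n ≤ (n : ℝ) ^ 2 * (n / 4) * n := by
          gcongr
          · exact h.two_pow_le_sq
          · linarith [h.sq_le]
      _ = (n : ℝ) ^ 4 / 4 := by ring
  calc ((n : ℝ) ^ 6)⁻¹ = 1 / (4 * (n : ℝ) ^ 2) * 1 / (n ^ 4 / 4) := by field_simp
    _ ≤ s.delta L * (A ^ 2 * Real.log n ^ 2) / (2 ^ (2 * L + 2) * C ^ 2 * n) := by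
        have := h.delta_pos
        gcongr
    _ = driftRate₁ s n L A C := by rw [driftRate₁, ← mul_assoc (s.delta L)]

lemma loss_le_driftRate₁ (h : LargeSample s n L C) (hA : 24 ≤ A) (hC : 0 < C) :
    (Real.exp 1 - 1) * (2 ^ L / signalWeight n A) ≤ driftRate₁ s n L A C / 2 := by
  have hn0 := h.natCast_pos
  have hn8 : (8 : ℝ) ≤ n := by exact_mod_cast h.eight_le
  calc (Real.exp 1 - 1) * (2 ^ L / signalWeight n A) ≤ 2 * (1 / (n ^ 6 * 8 ^ 4)) := by
        refine mul_le_mul ?_ ((h.two_pow_div_signalWeight_le_inv_pow hA).trans ?_) ?_ two_pos.le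
        · linarith [Real.exp_one_lt_three]
        · rw [← one_div, pow_add (n : ℝ) 6 4]
          gcongr
        · rw [signalWeight]
          positivity
    _ = ((n : ℝ) ^ 6)⁻¹ * (2 / 8 ^ 4) := by ring
    _ ≤ ((n : ℝ) ^ 6)⁻¹ * (1 / 2) := mul_le_mul_of_nonneg_left (by norm_num) (by positivity)
    _ = ((n : ℝ) ^ 6)⁻¹ / 2 := by ring
    _ ≤ _ := div_le_div_of_nonneg_right
        (h.inv_pow_six_le_driftRate₁ (by linarith) hC) two_pos.le

end LargeSample

/-! ### The posterior on the noise event -/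

namespace SignalAssumption

variable {n : ℕ} {A C : ℝ} {B : Finset Index} {β : Index → ℝ}

lemma energy_le_one (h : SignalAssumption n L A C B β) (hC : 0 < C) :
    1 / (2 ^ L * C ^ 2) * ∑ v ∈ B, β v ^ 2 ≤ 1 := by
  have hcard : (B.card : ℝ) ≤ 2 ^ L := by
    exact_mod_cast (Finset.card_le_card h.1).trans_eq (card_fullIndices L)
  rw [one_div_mul_eq_div, div_le_one (by positivity)]
  calc ∑ v ∈ B, β v ^ 2 ≤ B.card • C ^ 2 :=
        Finset.sum_le_card_nsmul _ _ _ fun v hv => sq_le_sq' (abs_lt.1 (h.2 v hv).2).1.le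
          (abs_lt.1 (h.2 v hv).2).2.le
    _ = B.card * C ^ 2 := nsmul_eq_mul _ _
    _ ≤ 2 ^ L * C ^ 2 := by gcongr

lemma le_energy (h : SignalAssumption n L A C B β) (hA : 0 ≤ A) {v : Index} (hv : v ∈ B) :
    A ^ 2 * Real.log n ^ 2 / (2 ^ L * C ^ 2 * n) ≤ 1 / (2 ^ L * C ^ 2) * β v ^ 2 := by
  have hsq : (A * Real.log n / √n) ^ 2 ≤ β v ^ 2 := by
    rw [← sq_abs (β v)]
    have := Real.log_natCast_nonneg n
    exact pow_le_pow_left₀ (by positivity) (h.2 v hv).1.le 2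
  calc A ^ 2 * Real.log n ^ 2 / (2 ^ L * C ^ 2 * n)
      = 1 / (2 ^ L * C ^ 2) * (A * Real.log n / √n) ^ 2 := by
        rw [div_pow, Real.sq_sqrt n.cast_nonneg, mul_pow, div_mul_div_comm, one_mul]
    _ ≤ _ := by gcongr

end SignalAssumption

lemma concentrated_posterior {s : Sampler} (hs : s.Valid) {Lmax : ℕ} (hL : L ≤ Lmax) {c A C : ℝ}
    (hc : 3 ≤ c) (hA : 4 * (c + 3) ≤ A) {B : Finset Index} {β : Index → ℝ} {Ts : CartTree L}
    (hlarge : LargeSample s (sampleSize Lmax) L C)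
    (hsig : SignalAssumption (sampleSize Lmax) L A C B β)
    (hleast : IsLeast {T : CartTree L | B ⊆ T.int} Ts)
    (hconn : s = Sampler.bayesianCART → Ts.int = insert none B)
    {noise : Fin (sampleSize Lmax) → ℝ} (hnoise : noise ∈ noiseEvent (sampleSize Lmax) L) :
    Concentrated s (noiseWeight (sampleSize Lmax) c) (signalWeight (sampleSize Lmax) A) B Ts
      (posterior (sampleSize Lmax) c (signalVec (sampleSize Lmax) B β + noise))
      fun v => nodeWeight (sampleSize Lmax) c (signalVec (sampleSize Lmax) B β + noise)
        (some v) where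
  valid := hs
  subset := hsig.1
  isLeast := hleast
  connected := hconn
  pos := posterior_pos _ hL (by linarith)
  sum_eq := sum_posterior _ hL (by linarith)
  factor_pos v := nodeWeight_pos (one_lt_sampleSize Lmax) (by linarith) _ _
  factor T T' h := posterior_eq_mul_prod _ hL h
  factor_le v hv hvB := by
    have hv' : some v ∈ fullIndices L := Finset.some_mem_insertNone.2 hv
    refine nodeWeight_le_of_abs_haarCoef_le (one_lt_sampleSize Lmax) ?_
    rw [haarCoef_add, haarCoef_signalVec hL hsig.1 β hv', if_neg hvB, zero_add]
    exact hnoise _ hv'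
  le_prod R _ hcard := by
    rintro ⟨v, hv, hvB⟩
    have hv' : some v ∈ fullIndices L := hsig.1 hvB
    refine le_prod_nodeWeight (by linarith [hlarge.eight_le]) hlarge.two_pow_le (by linarith) hA
      hcard hv (sq_log_le_of_signal hlarge.eight_le (by linarith) (hsig.2 _ hvB).1
        (hnoise _ hv') ?_)
    rw [haarCoef_add, haarCoef_signalVec hL hsig.1 β hv', if_pos hvB]
  small_pos := noiseWeight_pos hlarge.pos c
  small_le_one := noiseWeight_le_one hlarge.pos (by linarith)
  small_le_delta := hlarge.noiseWeight_le_delta hc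
  two_pow_le_large := hlarge.two_pow_le_signalWeight (by linarith)

lemma drift₁_eq_missingEnergy {Lmax : ℕ} (hL : L ≤ Lmax) {B : Finset Index}
    (hB : B ⊆ fullIndices L) (β : Index → ℝ) (C : ℝ) :
    (drift₁ (sampleSize Lmax) C (signalVec (sampleSize Lmax) B β) : CartTree L → ℝ) =
      missingEnergy (1 / (2 ^ L * C ^ 2)) B β :=
  funext fun T => drift₁_eq hL hB β C T

section Consequences

variable {s : Sampler} {n : ℕ} {c A C : ℝ} {B : Finset Index} {β : Index → ℝ}
  {Ts T : CartTree L} {π : CartTree L → ℝ} {ρ : Node → ℝ}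

lemma Concentrated.mulVec_missingEnergy_le_rate
    (h : Concentrated s (noiseWeight n c) (signalWeight n A) B Ts π ρ)
    (hsig : SignalAssumption n L A C B β) (hLn : 2 ^ (L + 1) ≤ n) (hA : 0 ≤ A) (hC : 0 < C)
    (hT : ¬ Ts ≤ T) :
    (metropolisHastings s.proposal π *ᵥ missingEnergy (1 / (2 ^ L * C ^ 2)) B β) T /
        missingEnergy (1 / (2 ^ L * C ^ 2)) B β T ≤
      1 - driftRate₁ s n L A C +
        (Real.exp 1 - 1) / (2 * (n : ℝ) ^ (A ^ 2 / 8 * Real.log n - 1)) := by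
  have he : 0 ≤ Real.exp 1 - 1 := by linarith [Real.add_one_le_exp 1]
  refine (h.mulVec_missingEnergy_le (by positivity) (hsig.energy_le_one hC) (by positivity)
    (fun v hv => hsig.le_energy hA hv) hT).trans ?_
  rw [driftRate₁_eq, div_eq_mul_one_div (Real.exp 1 - 1)]
  have := two_pow_div_signalWeight_le hLn A
  gcongr

lemma Concentrated.mulVec_drift₂_le_rate
    (h : Concentrated s (noiseWeight n c) (signalWeight n A) B Ts π ρ) (hLn : 2 ^ (L + 1) ≤ n)
    (hT : Ts < T) :
    (metropolisHastings s.proposal π *ᵥ drift₂ Ts) T / drift₂ Ts T ≤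
      1 - 1 / 2 ^ (2 * L + 2) + s.bigM L / (n : ℝ) ^ (c - 3 / 2) +
        (n : ℝ) ^ (1 - A ^ 2 * Real.log n / 8) := by
  refine (h.mulVec_drift₂_le hT).trans ?_
  have hloss : 2 ^ L / signalWeight n A ≤ (n : ℝ) ^ (1 - A ^ 2 * Real.log n / 8) / 2 := by
    refine (two_pow_div_signalWeight_le hLn A).trans_eq ?_
    rw [rpow_one_sub_eq, div_div, mul_comm]
  linarith [two_mul_bigM_mul_noiseWeight_le s n L c]

lemma inv_min_driftRate₁_le (h : LargeSample s n L C) (hA : 0 < A) (hC : 0 < C) :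
    (min (driftRate₁ s n L A C) (1 / 2 ^ (2 * L + 2)))⁻¹ ≤
      4 * max (C ^ 2 / (s.delta L * A ^ 2) * (2 ^ (2 * L) * n / Real.log n ^ 2))
        (2 ^ (2 * L + 1)) := by
  have := h.delta_pos
  have hlog := zero_lt_one.trans_le h.one_le_log
  have := h.natCast_pos
  rw [inv_le_comm₀ (lt_min (h.driftRate₁_pos hA hC) (by positivity)) (by positivity)]
  refine le_min ?_ ?_
  · calc _ ≤ (4 * (C ^ 2 / (s.delta L * A ^ 2) * (2 ^ (2 * L) * n / Real.log n ^ 2)))⁻¹ := by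
          gcongr
          exact le_max_left _ _
      _ = driftRate₁ s n L A C := by
          rw [driftRate₁, pow_add]
          field_simp
          norm_num
  · rw [one_div]
    gcongr
    calc (2 : ℝ) ^ (2 * L + 2) ≤ 4 * 2 ^ (2 * L + 1) := by
          rw [pow_succ _ (2 * L + 1)]
          linarith [pow_pos (two_pos (α := ℝ)) (2 * L + 1)]
      _ ≤ _ := by
          gcongr
          exact le_max_right _ _

lemma Concentrated.mixingTime_le_twoDriftRate
    (h : Concentrated s (noiseWeight n c) (signalWeight n A) B Ts π ρ)
    (hlarge : LargeSample s n L C) (hsig : SignalAssumption n L A C B β) (hA : 24 ≤ A)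
    (hC : 0 < C) (hc : 4 ≤ c) {ε : ℝ} (hε : 0 < ε) (hε' : ε < 1) :
    (mixingTime (lazyChain (metropolisHastings s.proposal π)) π ε : ℝ≥0∞) ≤
      ENNReal.ofReal (952 * twoDriftRate s n L A C ε) := by
  have hA0 : 0 < A := by linarith
  have hn0 := hlarge.natCast_pos
  have hlog := zero_lt_one.trans_le hlarge.one_le_log
  have hx : 0 < A ^ 2 * Real.log n ^ 2 / (2 ^ L * C ^ 2 * n) := by positivity
  set r := min (driftRate₁ s n L A C) (1 / 2 ^ (2 * L + 2))
  have hr : 0 < r := lt_min (hlarge.driftRate₁_pos hA0 hC) (by positivity)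
  have hr₁ : r ≤ driftRate₁ s n L A C := min_le_left _ _
  have hr₂ : r ≤ 1 / 2 ^ (2 * L + 2) := min_le_right _ _
  have hperturbation := hlarge.perturbation_le hA hc
  have hloss : (Real.exp 1 - 1) * (2 ^ L / signalWeight n A) ≤ r / 2 := by
    rw [← min_div_div_right zero_le_two]
    refine le_min (hlarge.loss_le_driftRate₁ hA hC) (le_trans ?_ hperturbation)
    have hM := mul_nonneg (s.bigM_nonneg L) h.small_pos.le
    have he : Real.exp 1 - 1 ≤ 10 := by linarith [Real.exp_one_lt_three]
    have hlarge0 := h.large_pos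
    have : 0 ≤ 2 ^ L / signalWeight n A := by positivity
    linarith [mul_le_mul_of_nonneg_right he this]
  refine (h.mixingTime_le (hlarge.two_pow_mul_noiseWeight_le hc) (by positivity)
    (hsig.energy_le_one hC) hx (fun v hv => hsig.le_energy hA0.le hv) (half_pos hr) hloss
    (by rw [← driftRate₁_eq]; linarith) (by linarith) hε hε').trans (ENNReal.ofReal_le_ofReal ?_)
  have hlog6 : 0 ≤ Real.log (6 / ε) := Real.log_nonneg (by rw [le_div_iff₀ hε]; linarith)
  have hinv := inv_min_driftRate₁_le hlarge hA0 hC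
  calc 119 / (r / 2) * Real.log (6 / ε) = 238 * (Real.log (6 / ε) * r⁻¹) := by field_simp; ring
    _ ≤ 238 * (Real.log (6 / ε) * (4 * max _ _)) := by gcongr
    _ = 952 * twoDriftRate s n L A C ε := by rw [twoDriftRate]; ring

end Consequences

/-! ### Comparison with the canonical-path bound -/

/-- The factor `κ` by which the canonical-path bounds of the two samplers differ. -/
noncomputable def Sampler.pathFactor : Sampler → ℕ → ℝ
  | .bayesianCART, _ => 1
  | .twiggy D, L => (D ^ L - 1) / (D - 1)

lemma canonicalPathRate_eq (s : Sampler) (n L m : ℕ) (c C ε : ℝ) :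
    canonicalPathRate s n L m c C ε = s.pathFactor L * 2 ^ (2 * L + 3) *
      (n * ((c + 1 / 2) * Real.log (1 + n) + m * C ^ 2 + 1)
        + 4 * m * Real.log n + Real.log (2 / ε)) := by
  cases s <;> rfl

lemma one_le_pathFactor {s : Sampler} (hs : s.Valid) (hL : 1 ≤ L) : 1 ≤ s.pathFactor L := by
  cases s with
  | bayesianCART => exact le_rfl
  | twiggy D =>
    have hDL : D ≤ D ^ L := le_self_pow₀ hs.1.le (by omega)
    rw [Sampler.pathFactor, one_le_div (sub_pos.2 hs.1)]
    linarith

lemma inv_delta_le_pathFactor {s : Sampler} (hs : s.Valid) (hL : 1 ≤ L) :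
    (s.delta L)⁻¹ ≤ s.pathFactor L := by
  have hκ := one_le_pathFactor hs hL
  cases s with
  | bayesianCART => simp [Sampler.delta, Sampler.pathFactor]
  | twiggy D =>
    rw [Sampler.pathFactor] at hκ ⊢
    rw [Sampler.delta, inv_div, mul_comm, ← div_div]
    exact half_le_self (by linarith)

section Comparison

variable {s : Sampler} {n m : ℕ} {c A C ε : ℝ}

lemma max_le_pathFactor_mul (hs : s.Valid) (hL : 1 ≤ L) (hn : 3 ≤ n) :
    max (C ^ 2 / (s.delta L * A ^ 2) * (2 ^ (2 * L) * n / Real.log n ^ 2)) (2 ^ (2 * L + 1)) ≤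
      (C ^ 2 / A ^ 2 + 2) * (s.pathFactor L * 2 ^ (2 * L) * n) := by
  have hκ := one_le_pathFactor hs hL
  have hlog := one_le_log_natCast hn
  have hn1 : (1 : ℝ) ≤ n := by exact_mod_cast (by omega : 1 ≤ n)
  refine max_le ?_ ?_
  · calc C ^ 2 / (s.delta L * A ^ 2) * (2 ^ (2 * L) * n / Real.log n ^ 2)
        = C ^ 2 / A ^ 2 * ((s.delta L)⁻¹ * (2 ^ (2 * L) * n / Real.log n ^ 2)) := by ring
      _ ≤ C ^ 2 / A ^ 2 * (s.pathFactor L * (2 ^ (2 * L) * n)) := by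
          gcongr
          · exact inv_delta_le_pathFactor hs hL
          · exact div_le_self (by positivity) (one_le_pow₀ hlog)
      _ ≤ (C ^ 2 / A ^ 2 + 2) * (s.pathFactor L * 2 ^ (2 * L) * n) := by
          rw [← mul_assoc (s.pathFactor L)]
          gcongr
          linarith
  · calc (2 : ℝ) ^ (2 * L + 1) = 2 * (1 * 2 ^ (2 * L) * 1) := by rw [pow_succ]; ring
      _ ≤ (C ^ 2 / A ^ 2 + 2) * (s.pathFactor L * 2 ^ (2 * L) * n) := by
          gcongr
          linarith [show 0 ≤ C ^ 2 / A ^ 2 by positivity]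

lemma mul_log_le_canonicalPath (hn : 1 ≤ n) (hc : 1 / 2 ≤ c) (hε : 0 < ε) (hε' : ε ≤ 2) :
    n * Real.log n ≤ n * ((c + 1 / 2) * Real.log (1 + n) + m * C ^ 2 + 1)
      + 4 * m * Real.log n + Real.log (2 / ε) := by
  have hn0 : (0 : ℝ) < n := by positivity
  have := Real.log_natCast_nonneg n
  have hlog2 : 0 ≤ Real.log (2 / ε) := Real.log_nonneg (by rwa [one_le_div hε])
  have hle : Real.log n ≤ (c + 1 / 2) * Real.log (1 + n) + m * C ^ 2 + 1 :=
    calc Real.log n ≤ Real.log (1 + n) := Real.log_le_log hn0 (by linarith)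
      _ ≤ (c + 1 / 2) * Real.log (1 + n) :=
          le_mul_of_one_le_left (Real.log_nonneg (by linarith)) (by linarith)
      _ ≤ _ := by
          rw [add_assoc]
          exact le_add_of_nonneg_right (by positivity)
  have hmul := mul_le_mul_of_nonneg_left hle hn0.le
  have : 0 ≤ 4 * m * Real.log n := by positivity
  linarith

lemma twoDriftRate_le_canonicalPathRate (hs : s.Valid) (hL : 1 ≤ L) (hn : 3 ≤ n)
    (hc : 1 / 2 ≤ c) (hε : 0 < ε) (hε' : ε ≤ 2) :
    twoDriftRate s n L A C ε ≤ Real.log (6 / ε) * (C ^ 2 / A ^ 2 + 2) / Real.log n *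
      canonicalPathRate s n L m c C ε := by
  have hlog := zero_lt_one.trans_le (one_le_log_natCast hn)
  have hlog6 : 0 ≤ Real.log (6 / ε) := Real.log_nonneg (by rw [one_le_div hε]; linarith)
  have := zero_lt_one.trans_le (one_le_pathFactor hs hL)
  rw [twoDriftRate, canonicalPathRate_eq]
  calc _ ≤ Real.log (6 / ε) * ((C ^ 2 / A ^ 2 + 2) * (s.pathFactor L * 2 ^ (2 * L) * n)) :=
        mul_le_mul_of_nonneg_left (max_le_pathFactor_mul hs hL hn) hlog6
    _ = Real.log (6 / ε) * (C ^ 2 / A ^ 2 + 2) / Real.log n *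
        (s.pathFactor L * 2 ^ (2 * L) * (n * Real.log n)) := by field_simp
    _ ≤ _ := by
        have := mul_log_le_canonicalPath (n := n) (m := m) (C := C) (by omega) hc hε hε'
        gcongr <;> norm_num

end Comparison

end BCART

open BCART in
theorem mainTheorem7 :
    (∃ K : ℝ, 0 < K ∧
      ∀ c : ℝ, 3 < c → ∃ A₀ : ℝ, 0 < A₀ ∧ ∀ A : ℝ, A₀ ≤ A → ∀ C : ℝ, 0 < C →
      ∀ s : Sampler, s.Valid → ∃ L₀ : ℕ, ∀ L Lmax n : ℕ, L₀ ≤ L → L ≤ Lmax → n = sampleSize Lmax →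
      ∀ (B : Finset Index) (β : Index → ℝ) (Ts : CartTree L),
        SignalAssumption n L A C B β →
        IsLeast {T : CartTree L | B ⊆ T.int} Ts →
        (s = Sampler.bayesianCART → Ts.int = insert none B) →
        ∃ E : Set (Fin n → ℝ), MeasurableSet E ∧ 1 - 4 / (n : ℝ) ≤ (noiseLaw n).real E ∧
          ∀ noise ∈ E, ∀ Y : Fin n → ℝ, Y = signalVec n B β + noise →
            (∀ T : CartTree L, ¬ Ts ≤ T →
              (transition s n c Y *ᵥ drift₁ n C (signalVec n B β)) T /
                  drift₁ n C (signalVec n B β) T ≤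
                1 - s.delta L * A ^ 2 * Real.log n ^ 2 / (2 ^ (2 * L + 2) * C ^ 2 * n)
                  + (Real.exp 1 - 1) / (2 * (n : ℝ) ^ (A ^ 2 / 8 * Real.log n - 1))) ∧
            (∀ T : CartTree L, Ts < T →
              (transition s n c Y *ᵥ drift₂ Ts) T / drift₂ Ts T ≤
                1 - 1 / 2 ^ (2 * L + 2) + s.bigM L / (n : ℝ) ^ (c - 3 / 2)
                  + (n : ℝ) ^ (1 - A ^ 2 * Real.log n / 8)) ∧
            (4 ≤ c → ∀ ε : ℝ, 0 < ε → ε < 1 →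
              (mixingTime (lazyChain (transition (L := L) s n c Y)) (posterior n c Y) ε : ℝ≥0∞) ≤
                ENNReal.ofReal (K * twoDriftRate s n L A C ε))) ∧
    (∀ c A C : ℝ, 4 ≤ c → 0 < A → 0 < C → ∀ s : Sampler, s.Valid →
      ∀ ε : ℝ, 0 < ε → ε < 1 → ∃ K : ℝ, 0 < K ∧
        ∀ L Lmax n m : ℕ, 1 ≤ L → L ≤ Lmax → n = sampleSize Lmax →
          twoDriftRate s n L A C ε ≤ K / Real.log n * canonicalPathRate s n L m c C ε) := by
  refine ⟨⟨952, by norm_num, fun c hc => ⟨4 * (c + 3), by linarith, fun A hA C hC s hs => ?_⟩⟩, ?_⟩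
  · obtain ⟨L₀, hL₀⟩ := Filter.eventually_atTop.1 (eventually_largeSample hs C)
    refine ⟨L₀, ?_⟩
    rintro L Lmax n hL₀L hL rfl B β Ts hsig hleast hconn
    have hLn := two_pow_le_sampleSize hL
    have hlarge := hL₀ L hL₀L _ hLn
    refine ⟨noiseEvent _ L, measurableSet_noiseEvent _ _, noiseLaw_noiseEvent hL rfl, ?_⟩
    rintro noise hnoise Y rfl
    have h := concentrated_posterior hs hL hc.le hA hlarge hsig hleast hconn hnoise
    refine ⟨fun T hT => ?_, fun T hT => h.mulVec_drift₂_le_rate hLn hT, fun hc4 ε hε hε' =>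
      h.mixingTime_le_twoDriftRate hlarge hsig (by linarith) hC hc4 hε hε'⟩
    rw [drift₁_eq_missingEnergy hL hsig.1]
    exact h.mulVec_missingEnergy_le_rate hsig hLn (by linarith) hC hT
  · intro c A C hc _ _ s hs ε hε hε'
    have hlog6 : 0 < Real.log (6 / ε) := Real.log_pos (by rw [lt_div_iff₀ hε]; linarith)
    refine ⟨Real.log (6 / ε) * (C ^ 2 / A ^ 2 + 2), by positivity, ?_⟩
    rintro L Lmax n m hL hLmax rfl
    have hn : 3 ≤ sampleSize Lmax :=
      (by norm_num : 3 ≤ 2 ^ (1 + 1)).trans (two_pow_le_sampleSize (hL.trans hLmax))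
    exact twoDriftRate_le_canonicalPathRate hs hL hn (by linarith) hε (by linarith)
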